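/- Let $p$ be a prime, let $s,\ell\ge 1$ be integers and put $q=p^s$. Let $|\cdot|$ be the absolute value of $\mathbb{C}_p$ and let $\mathbf W$, $\mathbf W_\ell$ denote $p$-typical Witt vectors and Witt vectors of length $\ell$. *Data.* Let $F(T)=pT+T^p+pT^2G(T)$ with $G\in\mathbb{Z}_p[[T]]$ (a Lubin–Tate series), and let $(\pi_m)_{m\ge0}$ be a Tate generator for $F$: elements of $\mathbb{C}_p$ algebraic over $\mathbb{Q}_p$ with $|\pi_m|<1$, $\pi_0\neq0$, $F(\pi_0)=0$ and $F(\pi_{m+1})=\pi_m$ for all $m\ge0$. Let $\mathcal{O}$ be the $\mathbb{Z}_p$-subalgebra and $K$ the subfield over $\mathbb{Q}_p$ of $\mathbb{C}_p$ generated by all the zeros $z$, algebraic over $\mathbb{Q}_p$ with $|z|<1$, of the composition powers $F^{\circ(m+1)}$, $m\ge0$. Let $\varphi$ be an absolute Frobenius: a continuous automorphism of the field $\mathbb{C}_p$ which fixes $K$ pointwise and satisfies $|\varphi(x)-x^p|<1$ whenever $|x|\le1$. For $\mathbf a\in\mathbf W(\mathbb{C}_p)$ let $\mathbf a^{\varphi}$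 be obtained by applying $\varphi$ to its components. *Generalized Pulita exponentials.* Let $AH(x)=\exp\bigl(\sum_{n\ge0}p^{-n}x^{p^n}\bigr)$ and $E(\mathbf a)=\prod_{i\ge0}AH(a_ix^{p^i})$ for $\mathbf a=(a_i)_{i\ge0}\in\mathbf W(\mathbb{C}_p)$. For $m\ge0$ let $\boldsymbol\varpi_m\in\mathbf W(\mathbb{C}_p)$ be the Witt vector with ghost components $(\pi_m,\pi_{m-1},\dots,\pi_0,0,0,\dots)$, and put $$\theta_m(\mathbf a)(x)=\frac{E(\boldsymbol\varpi_m\mathbf a)(x)}{E(\boldsymbol\varpi_m\mathbf a^{\varphi})(x^p)},\qquad \theta_{m,s}(\mathbf a)(x)=\prod_{i=0}^{s-1}\theta_m(\mathbf a^{\varphi^i})(x^{p^i}).$$ *Reduction.* Let $\mu_{q-1}$ be the group of $(q-1)$-st roots of unity in $\mathbb{C}_p$, let $\mathbb{F}_q$ be a field with $q$ elements, and fix a ring homomorphism $\mathbb{Z}_p[\mu_{q-1}]\to\mathbb{F}_q$. **Proposition.** The chosen homomorphism extends uniquely to a ring homomorphism $\rho:\mathcal{O}[\mu_{q-1}]\to\mathbb{F}_q$.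 Let $t\in\mathbb{Z}_p[\mu_{q-1}]$ be such that $t^{p^s}=t$. There is a unique homomorphism $\psi_{\ell,s,t}$ from the additive group $\mathbf W_\ell(\mathbb{F}_q)$ to $\mathbb{C}_p^\times$ such that, for every Witt vector $\mathbf a=(a_i)_{i\ge0}$ over $\mathcal{O}[\mu_{q-1}]$, the series $\theta_{\ell-1,s}(\mathbf a)$ converges at $t$ and $$\psi_{\ell,s,t}\bigl(\rho(a_0),\dots,\rho(a_{\ell-1})\bigr)=\theta_{\ell-1,s}(\mathbf a)(t).$$ If moreover $\mathrm{Tr}_{\mathbb{Q}_p(\mu_{q-1})/\mathbb{Q}_p}(t)\notin p\mathbb{Z}_p$, then: 1. for every additive character $\psi:\mathbf W_\ell(\mathbb{F}_q)\to\mathbb{C}_p^\times$ there is a unique $\mathbf a\in\mathbf W_\ell(\mathbb{F}_q)$ such that $\psi(\mathbf y)=\psi_{\ell,s,t}(\mathbf a\mathbf y)$ for all $\mathbf y\in\mathbf W_\ell(\mathbb{F}_q)$; 2. the image of $\psi_{\ell,s,t}$ is exactly the group $\mu_{p^\ell}$ of roots of unity in $\mathbb{C}_p$ of order dividing $p^\ell$.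 -/

import Mathlib

namespace PulitaCharacter

noncomputable section

variable (p : ℕ) [Fact p.Prime]

/-- This makes `ℂ_p`, the completion of `PadicAlgCl p`, a `ℤ_p`-algebra. -/
instance uniformContinuousConstSMul : UniformContinuousConstSMul ℤ_[p] (PadicAlgCl p) where
  uniformContinuous_const_smul c := by
    have h : (fun x : PadicAlgCl p => c • x) = fun x => (c : ℚ_[p]) • x := by
      funext x
      exact (algebraMap_smul ℚ_[p] c x).symm
    exact h ▸ uniformContinuous_const_smul (c : ℚ_[p])

instance isScalarTower : IsScalarTower ℤ_[p] ℚ_[p] ℂ_[p] :=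
  IsScalarTower.of_algebraMap_eq fun x => by
    rw [UniformSpace.Completion.algebraMap_def, UniformSpace.Completion.algebraMap_def,
      IsScalarTower.algebraMap_apply ℤ_[p] ℚ_[p] (PadicAlgCl p)]

/-- The value `∑ Fₙ zⁿ` at `z ∈ ℂ_p` of a power series with coefficients in `ℤ_p`. It is only used
for `‖z‖ < 1`, where the series converges. -/
def evalZp (F : PowerSeries ℤ_[p]) (z : ℂ_[p]) : ℂ_[p] :=
  ∑' n : ℕ, algebraMap ℤ_[p] ℂ_[p] (PowerSeries.coeff n F) * z ^ n

/-- Lubin-Tate series for the uniformizer `p` of `ℤ_p`: `F = p T + T ^ p + p T² G(T)` with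
`G ∈ ℤ_p⟦T⟧`. -/
def IsLubinTate (F : PowerSeries ℤ_[p]) : Prop :=
  ∃ G : PowerSeries ℤ_[p],
    F = PowerSeries.C (p : ℤ_[p]) * PowerSeries.X + PowerSeries.X ^ p
      + PowerSeries.C (p : ℤ_[p]) * PowerSeries.X ^ 2 * G

/-- Tate generators: sequences of elements of the valuation ideal of an algebraic extension of
`ℚ_p` (inside `ℂ_p`) with `F(π₀) = 0`, `π₀ ≠ 0` and `F(π_{m+1}) = π_m`. -/
structure IsTateGenerator (F : PowerSeries ℤ_[p]) (π : ℕ → ℂ_[p]) : Prop where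
  isAlgebraic : ∀ m, IsAlgebraic ℚ_[p] (π m)
  norm_lt_one : ∀ m, ‖π m‖ < 1
  ne_zero : π 0 ≠ 0
  eval_zero : evalZp p F (π 0) = 0
  eval_succ : ∀ m, evalZp p F (π (m + 1)) = π m

/-- The zeros, in the valuation ideal of the algebraic closure of `ℚ_p` in `ℂ_p`, of all the
composition powers `F ∘ ⋯ ∘ F` (`m + 1` factors). -/
def torsionPoints (F : PowerSeries ℤ_[p]) : Set ℂ_[p] :=
  {z | IsAlgebraic ℚ_[p] z ∧ ‖z‖ < 1 ∧ ∃ m : ℕ, (evalZp p F)^[m + 1] z = 0}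

/-- The field `K = ⋃ₘ K_m`, generated over `ℚ_p` by the zeros of the composition powers of `F`. -/
def lubinTateField (F : PowerSeries ℤ_[p]) : IntermediateField ℚ_[p] ℂ_[p] :=
  IntermediateField.adjoin ℚ_[p] (torsionPoints p F)

/-- Absolute Frobenius: a continuous automorphism of the field `ℂ_p` that fixes `K` and satisfies
`|φ(x) - x ^ p| < 1` whenever `|x| ≤ 1`. -/
structure IsAbsoluteFrobenius (F : PowerSeries ℤ_[p]) (φ : ℂ_[p] ≃+* ℂ_[p]) : Prop where
  continuous : Continuous φ
  fixes : ∀ x ∈ lubinTateField p F, φ x = x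
  norm_sub_pow_lt_one : ∀ x : ℂ_[p], ‖x‖ ≤ 1 → ‖φ x - x ^ p‖ < 1

/-- The group `μ_{q-1}` of the `(q-1)`-st roots of unity in `ℂ_p`, where `q = p ^ s`. -/
def mu (s : ℕ) : Set ℂ_[p] := {z | z ^ (p ^ s - 1) = 1}

/-- The subring `ℤ_p[μ_{q-1}]` of `ℂ_p`. -/
def Zmu (s : ℕ) : Subalgebra ℤ_[p] ℂ_[p] := Algebra.adjoin ℤ_[p] (mu p s)

/-- The field `ℚ_p(μ_{q-1})`. -/
def Qmu (s : ℕ) : IntermediateField ℚ_[p] ℂ_[p] := IntermediateField.adjoin ℚ_[p] (mu p s)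

/-- The subring `𝓞[μ_{q-1}]` of `ℂ_p`, where `𝓞` is the `ℤ_p`-algebra generated by the zeros of the
composition powers of `F`. -/
def Omu (F : PowerSeries ℤ_[p]) (s : ℕ) : Subalgebra ℤ_[p] ℂ_[p] :=
  Algebra.adjoin ℤ_[p] (torsionPoints p F ∪ mu p s)

theorem Zmu_le_Omu (F : PowerSeries ℤ_[p]) (s : ℕ) : Zmu p s ≤ Omu p F s :=
  Algebra.adjoin_mono Set.subset_union_right

theorem Zmu_subset_Qmu (s : ℕ) {x : ℂ_[p]} (hx : x ∈ Zmu p s) : x ∈ Qmu p s := by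
  induction hx using Algebra.adjoin_induction with
  | mem x hx => exact IntermediateField.subset_adjoin _ _ hx
  | algebraMap r =>
    rw [IsScalarTower.algebraMap_apply ℤ_[p] ℚ_[p] ℂ_[p]]
    exact (Qmu p s).algebraMap_mem _
  | add x y _ _ hx hy => exact add_mem hx hy
  | mul x y _ _ hx hy => exact mul_mem hx hy

/-- The trace of `ℚ_p(μ_{q-1})` over `ℚ_p`, at an element of `ℤ_p[μ_{q-1}]`. -/
def trace (s : ℕ) (t : Zmu p s) : ℚ_[p] :=
  Algebra.trace ℚ_[p] (Qmu p s) ⟨(t : ℂ_[p]), Zmu_subset_Qmu p s t.2⟩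

/-- The composite `f ∘ g` of power series over `ℂ_p`. It is only used for `g` without constant term,
for which the substitution is defined. -/
def comp (f g : PowerSeries ℂ_[p]) : PowerSeries ℂ_[p] := f.subst g

open Classical in
/-- The Artin-Hasse series `AH(x) = exp (∑ₙ x ^ (p ^ n) / p ^ n)`. -/
def artinHasse : PowerSeries ℂ_[p] :=
  comp p (PowerSeries.exp ℂ_[p])
    (PowerSeries.mk fun k : ℕ => if ∃ n : ℕ, k = p ^ n then ((k : ℂ_[p]))⁻¹ else 0)

/-- The Artin-Hasse morphism `E(a) = ∏_{i ≥ 0} AH(a_i x ^ (p ^ i))`. As `p ^ i > n` for `i > n`, only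
the factors with `i ≤ n` contribute to the coefficient of `x ^ n`. -/
def artinHasseE (a : WittVector p ℂ_[p]) : PowerSeries ℂ_[p] :=
  PowerSeries.mk fun n : ℕ => PowerSeries.coeff n
    (∏ i ∈ Finset.range (n + 1),
      comp p (artinHasse p) (PowerSeries.C (a.coeff i) * PowerSeries.X ^ (p ^ i)))

/-- `p` is invertible in `ℂ_p`, so that the ghost map of `ℂ_p` is bijective. -/
instance invertiblePrime : Invertible (p : ℂ_[p]) :=
  invertibleOfNonzero (by
    rw [← map_natCast (algebraMap ℚ_[p] ℂ_[p])]
    simpa using (Fact.out : p.Prime).ne_zero)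

/-- The Witt vector `ϖ_m` over `ℂ_p`, with ghost components `(π_m, π_{m-1}, …, π_0, 0, 0, …)`. It is
the specialization at `T = π_m` of the Witt vector over `ℤ_p⟦T⟧` whose ghost components are the
composition powers of `F(T)`, since the value at `π_m` of the `n`-th of these is `π_{m-n}`, or `0`
if `n > m`. -/
def varpi (π : ℕ → ℂ_[p]) (m : ℕ) : WittVector p ℂ_[p] :=
  (WittVector.ghostEquiv p ℂ_[p]).symm fun n => if n ≤ m then π (m - n) else 0

/-- The Pulita exponential `θ_m(a) = E(ϖ_m a)(x) / E(ϖ_m a^φ)(x ^ p)`. -/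
def theta (π : ℕ → ℂ_[p]) (φ : ℂ_[p] ≃+* ℂ_[p]) (m : ℕ) (a : WittVector p ℂ_[p]) :
    PowerSeries ℂ_[p] :=
  artinHasseE p (varpi p π m * a) *
    (comp p (artinHasseE p (varpi p π m * WittVector.map (φ : ℂ_[p] →+* ℂ_[p]) a))
      (PowerSeries.X ^ p))⁻¹

/-- The generalized Pulita exponential `θ_{m,s}(a) = ∏_{i < s} θ_m(a^{φ^i})(x ^ (p ^ i))`. -/
def thetaGen (π : ℕ → ℂ_[p]) (φ : ℂ_[p] ≃+* ℂ_[p]) (m s : ℕ) (a : WittVector p ℂ_[p]) :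
    PowerSeries ℂ_[p] :=
  ∏ i ∈ Finset.range s,
    comp p (theta p π φ m ((WittVector.map (φ : ℂ_[p] →+* ℂ_[p]))^[i] a))
      (PowerSeries.X ^ (p ^ i))

/-- The character `ψ` of `W_ℓ(k)` is induced by the composite of `θ̄_{ℓ-1,s}` and the evaluation
at `t`: for each Witt vector `a` over `𝓞[μ_{q-1}]`, the series `θ_{ℓ-1,s}(a)` converges at `t`, and
its sum is the value of `ψ` at the vector of length `ℓ` of the reductions of the first `ℓ`
components of `a`. -/
def IsInducedCharacter (F : PowerSeries ℤ_[p]) (π : ℕ → ℂ_[p]) (φ : ℂ_[p] ≃+* ℂ_[p]) (ℓ s : ℕ)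
    (t : ℂ_[p]) {k : Type*} [Field k] (red : Omu p F s →+* k)
    (ψ : AddChar (TruncatedWittVector p ℓ k) ℂ_[p]ˣ) : Prop :=
  ∀ a : WittVector p (Omu p F s),
    HasSum
      (fun n : ℕ => PowerSeries.coeff n
        (thetaGen p π φ (ℓ - 1) s
          (WittVector.map (Omu p F s).subtype a)) * t ^ n)
      ((ψ (WittVector.truncate ℓ (WittVector.map red a)) : ℂ_[p]ˣ) : ℂ_[p])

end

end PulitaCharacter

/-!
The Artin-Hasse morphism `E` is additive and turns Verschiebung into `X ↦ X ^ p`; with `φ` killed by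
`φ ^ s = id` on `𝓞[μ_{q-1}]`, the product defining `θ_{m,s}(a)` telescopes to
`E(w - V ^ s w)` with `w = ϖ_m a` (`thetaGen_eq`). Everything is thus a statement about the additive
map `a ↦ E(ϖ_m a - V ^ s (ϖ_m a))` on Witt vectors. Instead of exponentials and logarithms, `E` is
handled through the differential equation `X f' = (∑ₖ gₖ X ^ (p ^ k)) f`, where the `gₖ` are the
ghost components (`IsGhostExp`).

Convergence on the closed unit disc rests on three facts. The integrality of the Artin-Hasse series
gives bounds for the coefficients of `E(a)` in terms of the components of `a`. If `a` and `b` have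
components of norm at most `r < 1`, then the coefficients of `E(ab)` tend to zero
(`isNull_artinHasseE_mul`): splitting off the first components of `a` and `b` reduces `ab` to
`p V(a' b')` up to convergent factors, and taking `p`-th powers improves any bound on the tail of an
integral series with constant term one. Finally `ϖ_m - V ϖ_m` is, up to a rapidly decreasing vector,
the product of `ϖ_{m+1}` with a vector of this kind (`exists_varpi_sub_verschiebung_eq`), by a lemma
of Dwork type: a sequence of ghost components satisfying the Lubin-Tate recursion comes from a Witt
vector with small components (`wittLE_of_iterates`). This settles Witt vectors `a` with Teichmüller
components; if the first `m + 1` components of `a` have norm less than `1`, then `E(±ϖ_m a)` both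
converge at `t`, and since `t ^ q = t` the value of `E(ϖ_m a) / E(ϖ_m a)(X ^ q)` at `t` is `1`
(`evalAt_artinHasseE_eq_one`). Hence the value at `t` only depends on the reductions of the first
`m + 1` components, and it is multiplicative in `a`.

The reduction map exists and is unique because an algebraic `z` with `‖z‖ < 1` has a power in
`p ℤ_p[z]` (`exists_pow_eq_prime_mul`), so that the elements of norm less than `1` are sent to zero
by every homomorphism to a field of characteristic `p`, while modulo such elements `𝓞[μ_{q-1}]`
consists of `0` and `μ_{q-1}`.

If `t ≠ 0`, then the character is nontrivial on `V ^ (ℓ - 1) W_ℓ(𝔽_q)`, since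
`E(ϖ₀ - V ϖ₀) ≡ 1 + π₀ X` modulo `π₀²` and the trace of `𝔽_q` does not vanish
(`IsInducedCharacter.exists_ne_one`). As `V ^ (ℓ - 1) W_ℓ(𝔽_q)` lies in every nonzero ideal of
`W_ℓ(𝔽_q)`, the map `a ↦ ψ(a ·)` is injective, hence bijective onto the characters by counting, and
`ψ` does not kill `p ^ (ℓ - 1) W_ℓ(𝔽_q)`, so that its image contains an element of order `p ^ ℓ`.
-/

namespace PulitaCharacter

open PowerSeries Filter Topology

/-! ### The differential equation of the Artin-Hasse exponential -/

section ArtinHasseEquation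

variable {K : Type*} [Field K]

/-- The series `∑ₖ gₖ X ^ (p ^ k)` attached to a sequence `g` of ghost components. -/
noncomputable def ghostSeries (p : ℕ) (g : ℕ → K) : K⟦X⟧ :=
  PowerSeries.mk fun n => ∑ k ∈ Finset.range (n + 1), if n = p ^ k then g k else 0

/-- The series `f` solves `X f' = (∑ₖ gₖ X ^ (p ^ k)) f` and `f(0) = 1`, which characterizes
`f = exp (∑ₖ gₖ X ^ (p ^ k) / p ^ k)` over a field of characteristic zero. -/
def IsGhostExp (p : ℕ) (g : ℕ → K) (f : K⟦X⟧) : Prop :=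
  constantCoeff f = 1 ∧ X * d⁄dX K f = ghostSeries p g * f

theorem coeff_X_mul_derivative (f : K⟦X⟧) (n : ℕ) : coeff n (X * d⁄dX K f) = n * coeff n f := by
  cases n with
  | zero => simp
  | succ n => rw [coeff_succ_X_mul, coeff_derivative, mul_comm]; push_cast; rfl

theorem X_mul_derivative_mul (f g : K⟦X⟧) :
    X * d⁄dX K (f * g) = (X * d⁄dX K f) * g + f * (X * d⁄dX K g) := by
  rw [Derivation.leibniz]; simp only [smul_eq_mul]; ring

theorem coeff_ghostSeries_pow {p : ℕ} (hp : 1 < p) (g : ℕ → K) (k : ℕ) :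
    coeff (p ^ k) (ghostSeries p g) = g k := by
  rw [ghostSeries, coeff_mk, Finset.sum_eq_single k]
  · simp
  · intro j _ hj
    rw [if_neg]
    exact fun h => hj (Nat.pow_right_injective hp h).symm
  · intro h
    exact absurd (Finset.mem_range.2 (Nat.lt_succ_of_lt (Nat.lt_pow_self hp))) h

theorem coeff_ghostSeries_of_forall_ne {p : ℕ} (g : ℕ → K) {n : ℕ} (h : ∀ k, n ≠ p ^ k) :
    coeff n (ghostSeries p g) = 0 := by
  rw [ghostSeries, coeff_mk]
  exact Finset.sum_eq_zero fun k _ => if_neg (h k)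

theorem ghostSeries_add (p : ℕ) (g h : ℕ → K) :
    ghostSeries p (g + h) = ghostSeries p g + ghostSeries p h := by
  ext n
  simp only [ghostSeries, coeff_mk, map_add, ← Finset.sum_add_distrib]
  refine Finset.sum_congr rfl fun k _ => ?_
  split_ifs <;> simp

/-- The coefficient of degree `n` of the solution only depends on the ghost components of
index `k` with `p ^ k ≤ n`. -/
theorem IsGhostExp.coeff_eq [CharZero K] {p : ℕ} (hp : 1 < p) {g h : ℕ → K} {f f' : K⟦X⟧}
    (hf : IsGhostExp p g f) (hf' : IsGhostExp p h f') {n : ℕ}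
    (hgh : ∀ k, p ^ k ≤ n → g k = h k) : coeff n f = coeff n f' := by
  induction n using Nat.strong_induction_on with
  | _ n ih =>
  rcases Nat.eq_zero_or_pos n with rfl | hn
  · simp only [coeff_zero_eq_constantCoeff_apply, hf.1, hf'.1]
  have h1 := congrArg (coeff n) hf.2
  have h2 := congrArg (coeff n) hf'.2
  rw [coeff_X_mul_derivative, coeff_mul] at h1 h2
  have h3 : ∑ x ∈ Finset.HasAntidiagonal.antidiagonal n, coeff x.1 (ghostSeries p g) * coeff x.2 f =
      ∑ x ∈ Finset.HasAntidiagonal.antidiagonal n, coeff x.1 (ghostSeries p h) * coeff x.2 f' := by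
    refine Finset.sum_congr rfl fun x hx => ?_
    rw [Finset.HasAntidiagonal.mem_antidiagonal] at hx
    by_cases hk : ∃ k, x.1 = p ^ k
    · obtain ⟨k, hk⟩ := hk
      have : 0 < p ^ k := Nat.pow_pos (by omega)
      rw [hk, coeff_ghostSeries_pow hp, coeff_ghostSeries_pow hp, hgh k (by omega),
        ih x.2 (by omega) fun j hj => hgh j (by omega)]
    · push Not at hk
      rw [coeff_ghostSeries_of_forall_ne _ hk, coeff_ghostSeries_of_forall_ne _ hk]
      simp
  rw [h3, ← h2] at h1
  exact mul_left_cancel₀ (Nat.cast_ne_zero.2 hn.ne') h1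

theorem IsGhostExp.unique [CharZero K] {p : ℕ} (hp : 1 < p) {g : ℕ → K} {f f' : K⟦X⟧}
    (hf : IsGhostExp p g f) (hf' : IsGhostExp p g f') : f = f' := by
  ext n
  exact hf.coeff_eq hp hf' fun _ _ => rfl

theorem IsGhostExp.mul {p : ℕ} {g h : ℕ → K} {f f' : K⟦X⟧}
    (hf : IsGhostExp p g f) (hf' : IsGhostExp p h f') : IsGhostExp p (g + h) (f * f') := by
  refine ⟨by rw [map_mul, hf.1, hf'.1, one_mul], ?_⟩
  rw [X_mul_derivative_mul, hf.2, hf'.2, ghostSeries_add]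
  ring

theorem isGhostExp_zero (p : ℕ) : IsGhostExp p (0 : ℕ → K) 1 := by
  refine ⟨by simp, ?_⟩
  have : ghostSeries p (0 : ℕ → K) = 0 := by ext n; simp [ghostSeries]
  simp [this]

theorem IsGhostExp.prod {p : ℕ} {ι : Type*} (s : Finset ι) {g : ι → ℕ → K} {f : ι → K⟦X⟧}
    (hf : ∀ i, IsGhostExp p (g i) (f i)) :
    IsGhostExp p (∑ i ∈ s, g i) (∏ i ∈ s, f i) := by
  classical
  induction s using Finset.induction_on with
  | empty => simpa using isGhostExp_zero p
  | insert a s ha ih => rw [Finset.sum_insert ha, Finset.prod_insert ha]; exact (hf a).mul ih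

theorem IsGhostExp.rescale {p : ℕ} (hp : 1 < p) {g : ℕ → K} {f : K⟦X⟧} (hf : IsGhostExp p g f)
    (c : K) : IsGhostExp p (fun k => c ^ p ^ k * g k) (PowerSeries.rescale c f) := by
  refine ⟨?_, ?_⟩
  · rw [← coeff_zero_eq_constantCoeff_apply, coeff_rescale, coeff_zero_eq_constantCoeff_apply, hf.1]
    simp
  · have h1 : X * d⁄dX K (PowerSeries.rescale c f) = PowerSeries.rescale c (X * d⁄dX K f) := by
      ext n
      rw [coeff_X_mul_derivative, coeff_rescale, coeff_rescale, coeff_X_mul_derivative]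
      ring
    have h2 : ghostSeries p (fun k => c ^ p ^ k * g k) =
        PowerSeries.rescale c (ghostSeries p g) := by
      ext n
      rw [coeff_rescale]
      by_cases hk : ∃ k, n = p ^ k
      · obtain ⟨k, rfl⟩ := hk
        rw [coeff_ghostSeries_pow hp, coeff_ghostSeries_pow hp]
      · push Not at hk
        rw [coeff_ghostSeries_of_forall_ne _ hk, coeff_ghostSeries_of_forall_ne _ hk, mul_zero]
    rw [h1, h2, hf.2, map_mul]

theorem IsGhostExp.expand {p : ℕ} (hp : 1 < p) {g : ℕ → K} {f : K⟦X⟧} (hf : IsGhostExp p g f)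
    (i : ℕ) (h : p ^ i ≠ 0) :
    IsGhostExp p (fun k => if i ≤ k then (p : K) ^ i * g (k - i) else 0)
      (PowerSeries.expand (p ^ i) h f) := by
  refine ⟨by rw [constantCoeff_expand, hf.1], ?_⟩
  have h1 : X * d⁄dX K (PowerSeries.expand (p ^ i) h f) =
      (p : K) ^ i • PowerSeries.expand (p ^ i) h (X * d⁄dX K f) := by
    ext n
    rw [coeff_X_mul_derivative, coeff_smul, coeff_expand, coeff_expand]
    split_ifs with hd
    · obtain ⟨m, rfl⟩ := hd
      rw [Nat.mul_div_cancel_left _ (Nat.pos_of_ne_zero h), coeff_X_mul_derivative]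
      push_cast
      simp only [smul_eq_mul]
      ring
    · simp
  have h2 : ghostSeries p (fun k => if i ≤ k then (p : K) ^ i * g (k - i) else 0) =
      (p : K) ^ i • PowerSeries.expand (p ^ i) h (ghostSeries p g) := by
    ext n
    rw [coeff_smul, coeff_expand]
    by_cases hk : ∃ k, n = p ^ k
    · obtain ⟨k, rfl⟩ := hk
      rw [coeff_ghostSeries_pow hp]
      by_cases hik : i ≤ k
      · rw [if_pos hik, if_pos (pow_dvd_pow p hik), Nat.pow_div hik (by omega),
          coeff_ghostSeries_pow hp, smul_eq_mul]
      · rw [if_neg hik, if_neg (fun hd => hik ((Nat.pow_dvd_pow_iff_le_right hp).1 hd)), smul_zero]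
    · push Not at hk
      rw [coeff_ghostSeries_of_forall_ne _ hk]
      split_ifs with hd
      · obtain ⟨m, rfl⟩ := hd
        rw [Nat.mul_div_cancel_left _ (Nat.pos_of_ne_zero h), coeff_ghostSeries_of_forall_ne,
          smul_zero]
        intro k hmk
        exact hk (i + k) (by rw [hmk, pow_add])
      · simp
  rw [h1, h2, hf.2, map_mul, smul_mul_assoc]

end ArtinHasseEquation

/-! ### Additivity of the Artin-Hasse morphism -/

section ArtinHasse

variable (p : ℕ) [hp : Fact p.Prime]

theorem isGhostExp_artinHasse : IsGhostExp p (1 : ℕ → ℂ_[p]) (artinHasse p) := by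
  classical
  set L : ℂ_[p]⟦X⟧ := PowerSeries.mk fun k : ℕ =>
    if ∃ n : ℕ, k = p ^ n then ((k : ℂ_[p]))⁻¹ else 0 with hL
  have hL0 : constantCoeff L = 0 := by
    rw [← coeff_zero_eq_constantCoeff_apply, hL, coeff_mk, if_neg]
    rintro ⟨n, hn⟩
    exact (Nat.pow_pos hp.out.pos).ne hn
  have hs : HasSubst L := HasSubst.of_constantCoeff_zero' hL0
  have hA : artinHasse p = (PowerSeries.exp ℂ_[p]).subst L := by
    unfold artinHasse comp
    congr 1
  have hXL : X * d⁄dX ℂ_[p] L = ghostSeries p (1 : ℕ → ℂ_[p]) := by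
    ext n
    rw [coeff_X_mul_derivative, hL, coeff_mk]
    by_cases hk : ∃ k, n = p ^ k
    · rw [if_pos hk]
      obtain ⟨k, rfl⟩ := hk
      rw [coeff_ghostSeries_pow hp.out.one_lt, mul_inv_cancel₀]
      · rfl
      · exact Nat.cast_ne_zero.2 (Nat.pow_pos hp.out.pos).ne'
    · rw [if_neg hk, mul_zero, coeff_ghostSeries_of_forall_ne]
      exact fun k h => hk ⟨k, h⟩
  refine ⟨?_, ?_⟩
  · have h : PowerSeries.exp ℂ_[p] = 1 + (PowerSeries.exp ℂ_[p] - 1) := by ring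
    have h0 : constantCoeff ((PowerSeries.exp ℂ_[p] - 1).subst L) = 0 :=
      constantCoeff_subst_eq_zero hL0 _ (by simp)
    rw [hA, h, subst_add hs, map_add, h0, ← coe_substAlgHom hs, map_one]
    simp
  · rw [hA, derivative_subst hs, derivative_exp, ← hXL]
    ring

variable {p}

theorem ghostComponent_eq_sum (a : WittVector p ℂ_[p]) (k : ℕ) :
    WittVector.ghostComponent k a =
      ∑ i ∈ Finset.range (k + 1), (p : ℂ_[p]) ^ i * a.coeff i ^ p ^ (k - i) := by
  rw [WittVector.ghostComponent_apply, wittPolynomial_eq_sum_C_mul_X_pow]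
  simp

theorem comp_artinHasse_eq (c : ℂ_[p]) (i : ℕ) (h : p ^ i ≠ 0) :
    comp p (artinHasse p) (PowerSeries.C c * PowerSeries.X ^ p ^ i) =
      PowerSeries.expand (p ^ i) h (PowerSeries.rescale c (artinHasse p)) := by
  have h1 : HasSubst (c • X : ℂ_[p]⟦X⟧) := HasSubst.smul_X' c
  rw [comp, rescale_eq_subst, expand_apply, subst_comp_subst_apply h1 (HasSubst.X_pow h)]
  congr 1
  rw [← coe_substAlgHom (HasSubst.X_pow h), map_smul, coe_substAlgHom,
    subst_X (HasSubst.X_pow h), smul_eq_C_mul]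

theorem isGhostExp_artinHasse_factor (c : ℂ_[p]) (i : ℕ) :
    IsGhostExp p (fun k => if i ≤ k then (p : ℂ_[p]) ^ i * c ^ p ^ (k - i) else 0)
      (comp p (artinHasse p) (PowerSeries.C c * PowerSeries.X ^ p ^ i)) := by
  have h : p ^ i ≠ 0 := (Nat.pow_pos hp.out.pos).ne'
  rw [comp_artinHasse_eq c i h]
  have := ((isGhostExp_artinHasse p).rescale hp.out.one_lt c).expand hp.out.one_lt i h
  simpa using this

theorem isGhostExp_artinHasseE (a : WittVector p ℂ_[p]) :
    IsGhostExp p (fun k => WittVector.ghostComponent k a) (artinHasseE p a) := by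
  set P : ℕ → ℂ_[p]⟦X⟧ := fun n => ∏ i ∈ Finset.range (n + 1),
    comp p (artinHasse p) (PowerSeries.C (a.coeff i) * PowerSeries.X ^ p ^ i) with hP
  have hlt : ∀ {k n : ℕ}, p ^ k ≤ n → k < n := fun h => (Nat.lt_pow_self hp.out.one_lt).trans_le h
  have hPn : ∀ n, IsGhostExp p (∑ i ∈ Finset.range (n + 1), fun k =>
      if i ≤ k then (p : ℂ_[p]) ^ i * a.coeff i ^ p ^ (k - i) else 0) (P n) := fun n =>
    IsGhostExp.prod _ fun i => isGhostExp_artinHasse_factor (a.coeff i) i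
  have hg : ∀ n k, k ≤ n → (∑ i ∈ Finset.range (n + 1), fun k =>
      if i ≤ k then (p : ℂ_[p]) ^ i * a.coeff i ^ p ^ (k - i) else 0) k =
      WittVector.ghostComponent k a := by
    intro n k hkn
    rw [Finset.sum_apply, ghostComponent_eq_sum]
    symm
    apply Finset.sum_subset_zero_on_sdiff (Finset.range_mono (by omega))
    · intro i hi
      simp only [Finset.mem_sdiff, Finset.mem_range] at hi
      rw [if_neg (by omega)]
    · intro i hi
      rw [Finset.mem_range] at hi
      rw [if_pos (by omega)]
  have hc : ∀ n j, j ≤ n → coeff j (P n) = coeff j (artinHasseE p a) := by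
    intro n j hj
    rw [artinHasseE, coeff_mk]
    refine (hPn n).coeff_eq hp.out.one_lt (hPn j) fun k hk => ?_
    have := hlt hk
    rw [hg n k (by omega), hg j k (by omega)]
  refine ⟨?_, ?_⟩
  · rw [← coeff_zero_eq_constantCoeff_apply, ← hc 0 0 le_rfl, coeff_zero_eq_constantCoeff_apply,
      (hPn 0).1]
  · ext n
    have h1 := congrArg (coeff n) (hPn n).2
    rw [coeff_X_mul_derivative, hc n n le_rfl, coeff_mul] at h1
    rw [coeff_X_mul_derivative, h1, coeff_mul]
    refine Finset.sum_congr rfl fun x hx => ?_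
    rw [Finset.HasAntidiagonal.mem_antidiagonal] at hx
    rw [hc n x.2 (by omega)]
    congr 1
    by_cases hk : ∃ k, x.1 = p ^ k
    · obtain ⟨k, hk⟩ := hk
      have := hlt hk.ge
      rw [hk, coeff_ghostSeries_pow hp.out.one_lt, coeff_ghostSeries_pow hp.out.one_lt,
        hg n k (by omega)]
    · push Not at hk
      rw [coeff_ghostSeries_of_forall_ne _ hk, coeff_ghostSeries_of_forall_ne _ hk]

theorem artinHasseE_eq_of_isGhostExp {a : WittVector p ℂ_[p]} {f : ℂ_[p]⟦X⟧} {g : ℕ → ℂ_[p]}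
    (hf : IsGhostExp p g f) (hg : ∀ k, g k = WittVector.ghostComponent k a) :
    artinHasseE p a = f := by
  obtain rfl : g = fun k => WittVector.ghostComponent k a := funext hg
  exact (isGhostExp_artinHasseE a).unique hp.out.one_lt hf

theorem artinHasseE_add (a b : WittVector p ℂ_[p]) :
    artinHasseE p (a + b) = artinHasseE p a * artinHasseE p b :=
  artinHasseE_eq_of_isGhostExp ((isGhostExp_artinHasseE a).mul (isGhostExp_artinHasseE b))
    fun k => by simp

theorem artinHasseE_zero : artinHasseE p 0 = 1 :=
  artinHasseE_eq_of_isGhostExp (isGhostExp_zero p) fun k => by simp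

theorem artinHasseE_verschiebung_iterate (a : WittVector p ℂ_[p]) (i : ℕ) (h : p ^ i ≠ 0) :
    artinHasseE p (WittVector.verschiebung^[i] a) =
      PowerSeries.expand (p ^ i) h (artinHasseE p a) := by
  refine artinHasseE_eq_of_isGhostExp
    ((isGhostExp_artinHasseE a).expand hp.out.one_lt i h) fun k => ?_
  induction i generalizing k with
  | zero => simp
  | succ i ih =>
    rw [Function.iterate_succ_apply']
    cases k with
    | zero => simp [WittVector.ghostComponent_zero_verschiebung]
    | succ k =>
      rw [WittVector.ghostComponent_verschiebung, ← ih (Nat.pow_pos hp.out.pos).ne']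
      by_cases hik : i ≤ k
      · rw [if_pos hik, if_pos (by omega), Nat.succ_sub_succ]; ring
      · rw [if_neg hik, if_neg (by omega), mul_zero]

theorem artinHasseE_teichmuller_mul (c : ℂ_[p]) (a : WittVector p ℂ_[p]) :
    artinHasseE p (WittVector.teichmuller p c * a) = PowerSeries.rescale c (artinHasseE p a) :=
  artinHasseE_eq_of_isGhostExp ((isGhostExp_artinHasseE a).rescale hp.out.one_lt c) fun k => by
    simp [WittVector.ghostComponent_teichmuller]

end ArtinHasse

/-! ### Integrality of the Artin-Hasse series -/

section ArtinHasseIntegral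

variable (p : ℕ) [hp : Fact p.Prime]

theorem norm_algebraMap_padicInt (z : ℤ_[p]) : ‖algebraMap ℤ_[p] ℂ_[p] z‖ = ‖z‖ := by
  rw [IsScalarTower.algebraMap_apply ℤ_[p] ℚ_[p] ℂ_[p], norm_algebraMap', PadicInt.algebraMap_apply,
    PadicInt.padic_norm_e_of_padicInt]

theorem norm_prime : ‖(p : ℂ_[p])‖ = (p : ℝ)⁻¹ := by
  rw [← map_natCast (algebraMap ℚ_[p] ℂ_[p]), norm_algebraMap', Padic.norm_p]

theorem norm_prime_pos : 0 < ‖(p : ℂ_[p])‖ := by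
  rw [norm_prime]; exact inv_pos.2 (Nat.cast_pos.2 hp.out.pos)

theorem norm_prime_lt_one : ‖(p : ℂ_[p])‖ < 1 := by
  rw [norm_prime]; exact inv_lt_one_of_one_lt₀ (by exact_mod_cast hp.out.one_lt)

theorem padicValNat_factorial_lt {n : ℕ} (hn : n ≠ 0) : padicValNat p n.factorial < n := by
  have h1 := sub_one_mul_padicValNat_factorial (p := p) n
  have h2 : 0 < (p.digits n).sum := by
    by_contra h
    rw [Nat.pos_iff_ne_zero, not_not] at h
    rw [List.sum_eq_zero_iff] at h
    have h3 := Nat.ofDigits_digits p n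
    have h4 : ∀ l : List ℕ, (∀ x ∈ l, x = 0) → Nat.ofDigits p l = 0 := by
      intro l
      induction l with
      | nil => intro _; rfl
      | cons a l ih =>
        intro hl
        rw [Nat.ofDigits_cons, hl a (by simp), ih fun x hx => hl x (by simp [hx])]
        simp
    exact hn (h3.symm.trans (h4 _ h))
  have h5 : padicValNat p n.factorial ≤ (p - 1) * padicValNat p n.factorial :=
    Nat.le_mul_of_pos_left _ (by have := hp.out.two_le; omega)
  omega

/-- `p ^ n / n!` is divisible by `p` in `ℤ_p` for `n ≥ 1`. -/
theorem exists_pow_eq_factorial_mul {n : ℕ} (hn : n ≠ 0) :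
    ∃ z : ℤ_[p], (p : ℤ_[p]) ^ n = n.factorial * (p * z) := by
  obtain ⟨m, hm⟩ : p ^ padicValNat p n.factorial ∣ n.factorial := pow_padicValNat_dvd
  have hpm : ¬ p ∣ m := by
    rintro ⟨c, rfl⟩
    refine pow_succ_padicValNat_not_dvd (p := p) (Nat.factorial_ne_zero n) ⟨c, ?_⟩
    rw [pow_succ, mul_assoc]; exact hm
  have hu : IsUnit (m : ℤ_[p]) := by
    rw [PadicInt.isUnit_iff]
    refine le_antisymm (PadicInt.norm_le_one _) (not_lt.1 fun h => hpm ?_)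
    have := (PadicInt.norm_int_lt_one_iff_dvd (p := p) (m : ℤ)).1 (by exact_mod_cast h)
    exact_mod_cast this
  obtain ⟨u, hu⟩ := hu
  have hlt := padicValNat_factorial_lt p hn
  refine ⟨p ^ (n - 1 - padicValNat p n.factorial) * ↑u⁻¹, ?_⟩
  have h1 : (n.factorial : ℤ_[p]) = p ^ padicValNat p n.factorial * u := by
    rw [hu, ← Nat.cast_pow, ← Nat.cast_mul, ← hm]
  have h2 : (p : ℤ_[p]) ^ n = p ^ padicValNat p n.factorial * p *
      p ^ (n - 1 - padicValNat p n.factorial) := by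
    rw [← pow_succ, ← pow_add]; congr 1; omega
  rw [h1, h2]
  linear_combination (-(p : ℤ_[p]) ^ padicValNat p n.factorial * p *
      p ^ (n - 1 - padicValNat p n.factorial)) * u.mul_inv

/-- The series `exp (p X)`, written as `1 + p S` with `S` over `ℤ_p`. -/
theorem exists_rescale_exp_eq : ∃ S : ℤ_[p]⟦X⟧,
    PowerSeries.rescale (p : ℂ_[p]) (PowerSeries.exp ℂ_[p]) =
      PowerSeries.map (algebraMap ℤ_[p] ℂ_[p]) (1 + PowerSeries.C (p : ℤ_[p]) * S) := by
  choose z hz using fun (n : ℕ) (hn : n ≠ 0) => exists_pow_eq_factorial_mul p hn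
  refine ⟨PowerSeries.mk fun n => if hn : n = 0 then 0 else z n hn, ?_⟩
  ext n
  rw [coeff_rescale, coeff_exp, coeff_map, map_add, coeff_C_mul, coeff_mk, coeff_one]
  by_cases hn : n = 0
  · subst hn; simp
  · rw [dif_neg hn, if_neg hn, zero_add]
    have h1 := congrArg (algebraMap ℤ_[p] ℂ_[p]) (hz n hn)
    have h2 : (n.factorial : ℂ_[p]) ≠ 0 := Nat.cast_ne_zero.2 (Nat.factorial_ne_zero n)
    rw [map_pow, map_mul (algebraMap ℤ_[p] ℂ_[p]) (n.factorial : ℤ_[p]), map_natCast,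
      map_natCast] at h1
    rw [h1, map_div₀, map_one, map_natCast]
    field_simp

theorem isGhostExp_rescale_exp : IsGhostExp p (Pi.single 0 (p : ℂ_[p]))
    (PowerSeries.rescale (p : ℂ_[p]) (PowerSeries.exp ℂ_[p])) := by
  have h : IsGhostExp p (Pi.single 0 (1 : ℂ_[p])) (PowerSeries.exp ℂ_[p]) := by
    refine ⟨by simp, ?_⟩
    rw [derivative_exp]
    congr 1
    ext n
    rw [coeff_X]
    by_cases hk : ∃ k, n = p ^ k
    · obtain ⟨k, rfl⟩ := hk
      rw [coeff_ghostSeries_pow hp.out.one_lt]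
      rcases Nat.eq_zero_or_pos k with rfl | hk
      · simp
      · rw [if_neg (Nat.one_lt_pow hk.ne' hp.out.one_lt).ne', Pi.single_eq_of_ne hk.ne']
    · push Not at hk
      rw [coeff_ghostSeries_of_forall_ne _ hk, if_neg (by simpa using hk 0)]
  convert h.rescale hp.out.one_lt (p : ℂ_[p]) using 1
  ext k
  rcases Nat.eq_zero_or_pos k with rfl | hk
  · simp
  · rw [Pi.single_eq_of_ne hk.ne', Pi.single_eq_of_ne hk.ne', mul_zero]

theorem IsGhostExp.pow {K : Type*} [Field K] {p : ℕ} {g : ℕ → K} {f : K⟦X⟧}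
    (hf : IsGhostExp p g f) (n : ℕ) : IsGhostExp p (n • g) (f ^ n) := by
  simpa using IsGhostExp.prod (Finset.range n) (fun _ : ℕ => hf)

theorem artinHasse_pow : artinHasse p ^ p =
    PowerSeries.expand p hp.out.ne_zero (artinHasse p) *
      PowerSeries.rescale (p : ℂ_[p]) (PowerSeries.exp ℂ_[p]) := by
  have h1 := (isGhostExp_artinHasse p).pow p
  have h2 := (isGhostExp_artinHasse p).expand hp.out.one_lt 1 (by simpa using hp.out.ne_zero)
  simp only [pow_one] at h2
  refine h1.unique hp.out.one_lt ?_
  convert h2.mul (isGhostExp_rescale_exp p) using 1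
  ext k
  rcases Nat.eq_zero_or_pos k with rfl | hk
  · simp
  · have : 1 ≤ k := hk
    simp [this, hk.ne']

/-- The Dwork congruence `P ^ p ≡ P(X ^ p)` modulo `p` over `ℤ_p`. -/
theorem exists_coeff_pow_eq (P : Polynomial ℤ_[p]) (n : ℕ) :
    ∃ w : ℤ_[p], (P ^ p).coeff n = (Polynomial.expand ℤ_[p] p P).coeff n + p * w := by
  have h : (P ^ p - Polynomial.expand ℤ_[p] p P).map PadicInt.toZMod = 0 := by
    rw [Polynomial.map_sub, Polynomial.map_pow, Polynomial.map_expand, ZMod.expand_card, sub_self]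
  have h2 : (P ^ p - Polynomial.expand ℤ_[p] p P).coeff n ∈
      RingHom.ker (PadicInt.toZMod (p := p)) := by
    rw [RingHom.mem_ker, ← Polynomial.coeff_map, h, Polynomial.coeff_zero]
  rw [PadicInt.ker_toZMod, PadicInt.maximalIdeal_eq_span_p, Ideal.mem_span_singleton] at h2
  obtain ⟨w, hw⟩ := h2
  refine ⟨w, ?_⟩
  rw [← hw, Polynomial.coeff_sub]; ring

/-- The Artin-Hasse series has coefficients in `ℤ_p`. This is Dwork's argument: by induction on the
degree, compare the coefficients of both sides of `AH(X) ^ p = AH(X ^ p) exp (p X)`. -/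
theorem coeff_artinHasse_mem (n : ℕ) :
    ∃ z : ℤ_[p], coeff n (artinHasse p) = algebraMap ℤ_[p] ℂ_[p] z := by
  induction n using Nat.strong_induction_on with
  | _ n ih =>
  rcases Nat.eq_zero_or_pos n with rfl | hn
  · exact ⟨1, by rw [coeff_zero_eq_constantCoeff_apply, (isGhostExp_artinHasse p).1, map_one]⟩
  choose z hz using ih
  set ι := algebraMap ℤ_[p] ℂ_[p] with hι
  -- `P` collects the terms of degree below `n`; the coefficient of degree `n` of `AH ^ p` is that
  -- of `P ^ p` plus `p` times the unknown coefficient, and the one of `AH(X ^ p)` involves `P` only.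
  set P : Polynomial ℤ_[p] := ∑ i : Fin n, Polynomial.monomial i (z i i.2) with hP
  have hPc : ∀ i (hi : i < n), P.coeff i = z i hi := by
    intro i hi
    rw [hP, Polynomial.finsetSum_coeff, Finset.sum_eq_single ⟨i, hi⟩]
    · simp
    · intro j _ hj
      rw [Polynomial.coeff_monomial, if_neg]
      exact fun h => hj (Fin.ext h)
    · simp
  have hPn : ∀ i, n ≤ i → P.coeff i = 0 := by
    intro i hi
    rw [hP, Polynomial.finsetSum_coeff]
    exact Finset.sum_eq_zero fun j _ => by
      rw [Polynomial.coeff_monomial, if_neg]; have := j.2; omega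
  set A : ℂ_[p]⟦X⟧ := PowerSeries.map ι (P : ℤ_[p]⟦X⟧) with hA
  have hAc : ∀ i, i < n → coeff i (artinHasse p) = coeff i A := by
    intro i hi
    rw [hz i hi, hA, coeff_map, Polynomial.coeff_coe, hPc i hi]
  obtain ⟨Q, hQ⟩ : (X : ℂ_[p]⟦X⟧) ^ n ∣ artinHasse p - A := by
    rw [X_pow_dvd_iff]
    intro i hi
    rw [map_sub, hAc i hi, sub_self]
  have hQ0 : constantCoeff Q = coeff n (artinHasse p) := by
    have := congrArg (coeff n) hQ
    rw [map_sub, hA, coeff_map, Polynomial.coeff_coe, hPn n le_rfl, map_zero, sub_zero,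
      coeff_X_pow_mul', if_pos le_rfl, Nat.sub_self] at this
    rw [this, coeff_zero_eq_constantCoeff_apply]
  have hA0 : constantCoeff A = 1 := by
    rw [← coeff_zero_eq_constantCoeff_apply, ← hAc 0 hn, coeff_zero_eq_constantCoeff_apply,
      (isGhostExp_artinHasse p).1]
  have hl : coeff n (artinHasse p ^ p) = ι ((P ^ p).coeff n) + p * coeff n (artinHasse p) := by
    obtain ⟨k, hk⟩ := Polynomial.powAddExpansion A (X ^ n * Q) p
    have h1 : artinHasse p = A + X ^ n * Q := by rw [← hQ]; ring
    have h2 : coeff n (A ^ p) = ι ((P ^ p).coeff n) := by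
      rw [hA, ← map_pow, coeff_map, ← Polynomial.coe_pow, Polynomial.coeff_coe]
    have h3 : (p : ℂ_[p]⟦X⟧) * A ^ (p - 1) * (X ^ n * Q) =
        X ^ n * (PowerSeries.C (p : ℂ_[p]) * (A ^ (p - 1) * Q)) := by
      rw [map_natCast]; ring
    have h4 : k * (X ^ n * Q) ^ 2 = X ^ n * (X ^ n * (k * Q ^ 2)) := by ring
    conv_lhs => rw [h1, hk, map_add, map_add, h2, h3, h4]
    rw [coeff_X_pow_mul', if_pos le_rfl, coeff_X_pow_mul', if_pos le_rfl, Nat.sub_self,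
      coeff_C_mul, coeff_X_pow_mul', if_neg (by omega), coeff_zero_eq_constantCoeff_apply, map_mul,
      map_pow, hA0, hQ0]
    ring
  obtain ⟨S, hS⟩ := exists_rescale_exp_eq p
  have hr : coeff n (PowerSeries.expand p hp.out.ne_zero (artinHasse p) *
      PowerSeries.rescale (p : ℂ_[p]) (PowerSeries.exp ℂ_[p])) =
      ι (coeff n (PowerSeries.expand p hp.out.ne_zero (P : ℤ_[p]⟦X⟧) *
        (1 + PowerSeries.C (p : ℤ_[p]) * S))) := by
    rw [hS, ← coeff_map, map_mul (PowerSeries.map ι), map_expand, coeff_mul, coeff_mul]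
    refine Finset.sum_congr rfl fun x hx => ?_
    rw [Finset.HasAntidiagonal.mem_antidiagonal] at hx
    congr 1
    rw [coeff_expand, coeff_expand]
    split_ifs with hd
    · refine hAc _ ?_
      rcases Nat.eq_zero_or_pos x.1 with h0 | h0
      · rw [h0, Nat.zero_div]; exact hn
      · exact (Nat.div_lt_self h0 hp.out.one_lt).trans_le (by omega)
    · rfl
  have hPe : coeff n (PowerSeries.expand p hp.out.ne_zero (P : ℤ_[p]⟦X⟧)) =
      (Polynomial.expand ℤ_[p] p P).coeff n := by
    rw [coeff_expand, Polynomial.coeff_expand hp.out.pos, Polynomial.coeff_coe]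
  obtain ⟨w, hw⟩ := exists_coeff_pow_eq p P n
  have hfin : (p : ℂ_[p]) * coeff n (artinHasse p) = p * ι (coeff n
      (PowerSeries.expand p hp.out.ne_zero (P : ℤ_[p]⟦X⟧) * S) - w) := by
    have h1 : coeff n (artinHasse p ^ p) = _ := congrArg (coeff n) (artinHasse_pow p)
    rw [hl, hr, mul_add, mul_one, mul_left_comm, map_add, coeff_C_mul, hPe, hw, map_add, map_add,
      map_mul, map_mul, map_natCast] at h1
    rw [map_sub]
    linear_combination h1
  exact ⟨_, mul_left_cancel₀ (Nat.cast_ne_zero.2 hp.out.ne_zero) hfin⟩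

theorem norm_coeff_artinHasse_le_one (n : ℕ) : ‖coeff n (artinHasse p)‖ ≤ 1 := by
  obtain ⟨z, hz⟩ := coeff_artinHasse_mem p n
  rw [hz, norm_algebraMap_padicInt]
  exact PadicInt.norm_le_one z

end ArtinHasseIntegral

/-! ### Coefficient bounds for power series -/

section SeriesBounds

variable {p : ℕ} [hp : Fact p.Prime]

theorem norm_sum_le_of_le {ι : Type*} {s : Finset ι} {f : ι → ℂ_[p]} {r : ℝ} (hr : 0 ≤ r)
    (h : ∀ i ∈ s, ‖f i‖ ≤ r) : ‖∑ i ∈ s, f i‖ ≤ r :=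
  IsUltrametricDist.norm_sum_le_of_forall_le_of_nonneg hr h

theorem norm_add_le_of_le {x y : ℂ_[p]} {r : ℝ} (hx : ‖x‖ ≤ r) (hy : ‖y‖ ≤ r) : ‖x + y‖ ≤ r :=
  (IsUltrametricDist.norm_add_le_max x y).trans (max_le hx hy)

theorem norm_sub_le_of_le {x y : ℂ_[p]} {r : ℝ} (hx : ‖x‖ ≤ r) (hy : ‖y‖ ≤ r) : ‖x - y‖ ≤ r := by
  rw [sub_eq_add_neg]; exact norm_add_le_of_le hx (by rwa [norm_neg])

theorem norm_add_lt_of_lt {x y : ℂ_[p]} {r : ℝ} (hx : ‖x‖ < r) (hy : ‖y‖ < r) : ‖x + y‖ < r :=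
  (IsUltrametricDist.norm_add_le_max x y).trans_lt (max_lt hx hy)

theorem norm_sub_lt_of_lt {x y : ℂ_[p]} {r : ℝ} (hx : ‖x‖ < r) (hy : ‖y‖ < r) : ‖x - y‖ < r := by
  rw [sub_eq_add_neg]; exact norm_add_lt_of_lt hx (by rwa [norm_neg])

/-- All coefficients of `f` have norm at most `r`: the Gauss norm of `f` is at most `r`. -/
def GaussLE (r : ℝ) (f : ℂ_[p]⟦X⟧) : Prop := ∀ n, ‖coeff n f‖ ≤ r

/-- All but finitely many coefficients of `f` have norm at most `r`. -/
def TailLE (r : ℝ) (f : ℂ_[p]⟦X⟧) : Prop := ∃ M, ∀ n, M ≤ n → ‖coeff n f‖ ≤ r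

/-- The coefficients of `f` tend to zero, that is, `f` converges on the closed unit disc. -/
def IsNull (f : ℂ_[p]⟦X⟧) : Prop := Tendsto (fun n => coeff n f) atTop (𝓝 0)

theorem isNull_iff_tailLE {f : ℂ_[p]⟦X⟧} : IsNull f ↔ ∀ r > 0, TailLE r f := by
  rw [IsNull, Metric.tendsto_atTop]
  constructor
  · intro h r hr
    obtain ⟨M, hM⟩ := h r hr
    exact ⟨M, fun n hn => by simpa using (hM n hn).le⟩
  · intro h r hr
    obtain ⟨M, hM⟩ := h (r / 2) (by linarith)
    exact ⟨M, fun n hn => by rw [dist_zero_right]; linarith [hM n hn]⟩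

theorem IsNull.tailLE {f : ℂ_[p]⟦X⟧} (hf : IsNull f) {r : ℝ} (hr : 0 < r) : TailLE r f :=
  isNull_iff_tailLE.1 hf r hr

theorem GaussLE.mul {r s : ℝ} (hr : 0 ≤ r) (hs : 0 ≤ s) {f g : ℂ_[p]⟦X⟧} (hf : GaussLE r f)
    (hg : GaussLE s g) : GaussLE (r * s) (f * g) := by
  intro n
  rw [coeff_mul]
  refine norm_sum_le_of_le (mul_nonneg hr hs) fun x _ => ?_
  rw [norm_mul]
  exact mul_le_mul (hf _) (hg _) (norm_nonneg _) hr

theorem GaussLE.one_mul_one {f g : ℂ_[p]⟦X⟧} (hf : GaussLE 1 f) (hg : GaussLE 1 g) :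
    GaussLE 1 (f * g) := by
  simpa using hf.mul zero_le_one zero_le_one hg

theorem gaussLE_one : GaussLE (p := p) 1 1 := by
  intro n
  rw [coeff_one]
  split_ifs <;> simp

theorem GaussLE.pow {r : ℝ} (hr : 0 ≤ r) {f : ℂ_[p]⟦X⟧} (hf : GaussLE r f) (n : ℕ) :
    GaussLE (r ^ n) (f ^ n) := by
  induction n with
  | zero => simpa using gaussLE_one
  | succ n ih => rw [pow_succ, pow_succ]; exact ih.mul (pow_nonneg hr n) hr hf

theorem TailLE.mul {r : ℝ} (hr : 0 ≤ r) {f g : ℂ_[p]⟦X⟧} (hf1 : GaussLE 1 f) (hg1 : GaussLE 1 g)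
    (hf : TailLE r f) (hg : TailLE r g) : TailLE r (f * g) := by
  obtain ⟨M, hM⟩ := hf
  obtain ⟨N, hN⟩ := hg
  refine ⟨M + N, fun n hn => ?_⟩
  rw [coeff_mul]
  refine norm_sum_le_of_le hr fun x hx => ?_
  rw [Finset.HasAntidiagonal.mem_antidiagonal] at hx
  rw [norm_mul]
  by_cases h : M ≤ x.1
  · exact (mul_le_mul (hM _ h) (hg1 _) (norm_nonneg _) hr).trans (mul_one r).le
  · exact (mul_le_mul (hf1 _) (hN _ (by omega)) (norm_nonneg _) zero_le_one).trans (one_mul r).le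

theorem IsNull.mul {f g : ℂ_[p]⟦X⟧} (hf1 : GaussLE 1 f) (hg1 : GaussLE 1 g)
    (hf : IsNull f) (hg : IsNull g) : IsNull (f * g) :=
  isNull_iff_tailLE.2 fun _ hr => TailLE.mul hr.le hf1 hg1 (hf.tailLE hr) (hg.tailLE hr)

theorem GaussLE.expand {r : ℝ} (hr : 0 ≤ r) {f : ℂ_[p]⟦X⟧} (hf : GaussLE r f) (m : ℕ) (hm : m ≠ 0) :
    GaussLE r (PowerSeries.expand m hm f) := by
  intro n
  rw [coeff_expand]
  split_ifs
  · exact hf _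
  · simpa using hr

theorem TailLE.expand {r : ℝ} (hr : 0 ≤ r) {f : ℂ_[p]⟦X⟧} (hf : TailLE r f) (m : ℕ) (hm : m ≠ 0) :
    TailLE r (PowerSeries.expand m hm f) := by
  obtain ⟨M, hM⟩ := hf
  refine ⟨M * m, fun n hn => ?_⟩
  rw [coeff_expand]
  split_ifs
  · exact hM _ ((Nat.le_div_iff_mul_le (Nat.pos_of_ne_zero hm)).2 hn)
  · simpa using hr

theorem IsNull.expand {f : ℂ_[p]⟦X⟧} (hf : IsNull f) (m : ℕ) (hm : m ≠ 0) :
    IsNull (PowerSeries.expand m hm f) :=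
  isNull_iff_tailLE.2 fun _ hr => (hf.tailLE hr).expand hr.le m hm

theorem GaussLE.rescale {r : ℝ} {f : ℂ_[p]⟦X⟧} (hf : GaussLE r f) {c : ℂ_[p]} (hc : ‖c‖ ≤ 1) :
    GaussLE r (PowerSeries.rescale c f) := by
  intro n
  rw [coeff_rescale, norm_mul, norm_pow]
  exact (mul_le_of_le_one_left (norm_nonneg _) (pow_le_one₀ (norm_nonneg _) hc)).trans (hf n)

theorem IsNull.rescale {f : ℂ_[p]⟦X⟧} (hf : IsNull f) {c : ℂ_[p]} (hc : ‖c‖ ≤ 1) :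
    IsNull (PowerSeries.rescale c f) := by
  refine squeeze_zero_norm (fun n => ?_) (tendsto_norm_zero.comp hf)
  rw [coeff_rescale, norm_mul, norm_pow]
  exact mul_le_of_le_one_left (norm_nonneg _) (pow_le_one₀ (norm_nonneg _) hc)

theorem isNull_of_norm_coeff_le_pow {f : ℂ_[p]⟦X⟧} {r : ℝ} (hr : 0 ≤ r) (hr1 : r < 1)
    (hf : ∀ n, ‖coeff n f‖ ≤ r ^ n) : IsNull f :=
  squeeze_zero_norm hf (tendsto_pow_atTop_nhds_zero_of_lt_one hr hr1)

theorem GaussLE.isNull_rescale {f : ℂ_[p]⟦X⟧} (hf : GaussLE 1 f) {c : ℂ_[p]} (hc : ‖c‖ < 1) :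
    IsNull (PowerSeries.rescale c f) := by
  refine isNull_of_norm_coeff_le_pow (norm_nonneg c) hc fun n => ?_
  rw [coeff_rescale, norm_mul, norm_pow]
  exact mul_le_of_le_one_right (pow_nonneg (norm_nonneg _) _) (hf n)

/-- The ring of series whose coefficients have norm at most one. -/
def integralSeries (p : ℕ) [Fact p.Prime] : Subring ℂ_[p]⟦X⟧ where
  carrier := {f | GaussLE 1 f}
  mul_mem' hf hg := GaussLE.one_mul_one hf hg
  one_mem' := gaussLE_one
  add_mem' hf hg n := by rw [map_add]; exact norm_add_le_of_le (hf n) (hg n)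
  zero_mem' n := by simp
  neg_mem' hf n := by rw [map_neg, norm_neg]; exact hf n

/-- Taking `p`-th powers contracts the size of the tail of an integral series. -/
theorem TailLE.pow_prime {f : ℂ_[p]⟦X⟧} {r c : ℝ} (hr : 0 ≤ r) (hr1 : r ≤ 1) (hf1 : GaussLE 1 f)
    (hf : TailLE r f) (hpc : ‖(p : ℂ_[p])‖ ≤ c) (hrc : r ≤ c) : TailLE (c * r) (f ^ p) := by
  -- Write `f` as a polynomial `N` plus a series of size `r`. The power `N ^ p` has no coefficients
  -- of high degree, and the other terms of `f ^ p` carry a factor `p` or a `p`-th power of the rest.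
  obtain ⟨M, hM⟩ := hf
  set N : Polynomial ℂ_[p] := trunc M f with hN
  have hNc : ∀ n, coeff n (N : ℂ_[p]⟦X⟧) = if n < M then coeff n f else 0 := fun n => by
    rw [Polynomial.coeff_coe, hN, coeff_trunc]
  have hN1 : GaussLE 1 (N : ℂ_[p]⟦X⟧) := by
    intro n
    rw [hNc]
    split_ifs
    · exact hf1 n
    · simp
  have hv : GaussLE r (f - (N : ℂ_[p]⟦X⟧)) := by
    intro n
    rw [map_sub, hNc]
    split_ifs with h
    · simpa using hr
    · rw [sub_zero]; exact hM n (by omega)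
  have hv1 : GaussLE 1 (f - (N : ℂ_[p]⟦X⟧)) := fun n => (hv n).trans hr1
  obtain ⟨k, hk⟩ := exists_add_pow_prime_eq hp.out (⟨_, hN1⟩ : integralSeries p)
    (⟨_, hv1⟩ : integralSeries p)
  have hk' : f ^ p = (N : ℂ_[p]⟦X⟧) ^ p + (f - (N : ℂ_[p]⟦X⟧)) ^ p +
      p * N * (f - (N : ℂ_[p]⟦X⟧)) * (k : ℂ_[p]⟦X⟧) := by
    have := congrArg Subtype.val hk
    push_cast at this
    rwa [add_sub_cancel] at this
  have hc : 0 ≤ c := (norm_nonneg _).trans hpc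
  have hcr : 0 ≤ c * r := mul_nonneg hc hr
  refine ⟨(N ^ p).natDegree + 1, fun n hn => ?_⟩
  rw [hk', map_add, map_add]
  refine norm_add_le_of_le (norm_add_le_of_le ?_ ?_) ?_
  · rw [← Polynomial.coe_pow, Polynomial.coeff_coe,
      Polynomial.coeff_eq_zero_of_natDegree_lt (by omega)]
    simpa using hcr
  · refine (hv.pow hr p n).trans ?_
    obtain ⟨m, hm⟩ : ∃ m, p = m + 2 := ⟨p - 2, by have := hp.out.two_le; omega⟩
    rw [hm, pow_succ]
    refine mul_le_mul_of_nonneg_right ?_ hr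
    rw [pow_succ]
    exact (mul_le_of_le_one_left hr (pow_le_one₀ hr hr1)).trans hrc
  · have h1 : (p : ℂ_[p]⟦X⟧) * N * (f - (N : ℂ_[p]⟦X⟧)) * (k : ℂ_[p]⟦X⟧) =
        PowerSeries.C (p : ℂ_[p]) * ((f - (N : ℂ_[p]⟦X⟧)) * (N * k)) := by rw [map_natCast]; ring
    rw [h1, coeff_C_mul, norm_mul]
    refine mul_le_mul hpc ?_ (norm_nonneg _) hc
    have := hv.mul hr zero_le_one (hN1.one_mul_one k.2) n
    rwa [mul_one] at this

end SeriesBounds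

/-! ### Coefficient bounds for the Artin-Hasse morphism -/

section ArtinHasseBounds

variable {p : ℕ} [hp : Fact p.Prime]

theorem coeff_artinHasse_factor (c : ℂ_[p]) (i n : ℕ) :
    coeff n (comp p (artinHasse p) (PowerSeries.C c * PowerSeries.X ^ p ^ i)) =
      if p ^ i ∣ n then c ^ (n / p ^ i) * coeff (n / p ^ i) (artinHasse p) else 0 := by
  rw [comp_artinHasse_eq c i (Nat.pow_pos hp.out.pos).ne', coeff_expand, coeff_rescale]

theorem constantCoeff_artinHasseE (a : WittVector p ℂ_[p]) : constantCoeff (artinHasseE p a) = 1 :=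
  (isGhostExp_artinHasseE a).1

/-- If `‖a i‖ ≤ r ^ (p ^ i)` for all `i`, then `E(a)` converges on the disc of radius `1 / r`. -/
theorem norm_coeff_artinHasseE_le_pow {a : WittVector p ℂ_[p]} {r : ℝ} (hr : 0 ≤ r)
    (ha : ∀ i, ‖a.coeff i‖ ≤ r ^ p ^ i) (n : ℕ) : ‖coeff n (artinHasseE p a)‖ ≤ r ^ n := by
  rw [artinHasseE, coeff_mk]
  generalize Finset.range (n + 1) = s
  induction s using Finset.induction_on generalizing n with
  | empty =>
    rw [Finset.prod_empty, coeff_one]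
    split_ifs with h
    · simp [h]
    · simpa using pow_nonneg hr n
  | insert i s hi ih =>
    rw [Finset.prod_insert hi, coeff_mul]
    refine norm_sum_le_of_le (pow_nonneg hr n) fun x hx => ?_
    rw [Finset.HasAntidiagonal.mem_antidiagonal] at hx
    rw [← hx, pow_add, norm_mul]
    refine mul_le_mul ?_ (ih _) (norm_nonneg _) (pow_nonneg hr _)
    rw [coeff_artinHasse_factor]
    split_ifs with hd
    · obtain ⟨m, hm⟩ := hd
      rw [hm, Nat.mul_div_cancel_left _ (Nat.pow_pos hp.out.pos), norm_mul, norm_pow, pow_mul]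
      exact (mul_le_of_le_one_right (pow_nonneg (norm_nonneg _) _)
        (norm_coeff_artinHasse_le_one p m)).trans (pow_le_pow_left₀ (norm_nonneg _) (ha i) m)
    · simpa using pow_nonneg hr _

/-- If the components of index at least `i₀` have norm at most `r ≤ 1`, then modulo elements of
norm at most `r` the series `E(a)` is the product of the first `i₀` Artin-Hasse factors. -/
theorem norm_coeff_artinHasseE_sub_le {a : WittVector p ℂ_[p]} {r : ℝ} (hr : 0 ≤ r)
    (i₀ : ℕ) (ha0 : ∀ i, ‖a.coeff i‖ ≤ 1) (ha : ∀ i, i₀ ≤ i → ‖a.coeff i‖ ≤ r) (n : ℕ)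
    (hn : i₀ ≤ n + 1) :
    ‖coeff n (artinHasseE p a - ∏ i ∈ Finset.range i₀,
      comp p (artinHasse p) (PowerSeries.C (a.coeff i) * PowerSeries.X ^ p ^ i))‖ ≤ r := by
  set Φ : ℕ → ℂ_[p]⟦X⟧ := fun i =>
    comp p (artinHasse p) (PowerSeries.C (a.coeff i) * PowerSeries.X ^ p ^ i) with hΦ
  have hΦ1 : ∀ i, GaussLE 1 (Φ i) := by
    intro i m
    rw [hΦ, coeff_artinHasse_factor]
    split_ifs
    · rw [norm_mul, norm_pow]
      exact mul_le_one₀ (pow_le_one₀ (norm_nonneg _) (ha0 i)) (norm_nonneg _)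
        (norm_coeff_artinHasse_le_one p _)
    · simp
  have hΦr : ∀ i, i₀ ≤ i → GaussLE r (Φ i - 1) := by
    intro i hi m
    rw [map_sub, hΦ, coeff_artinHasse_factor, coeff_one]
    rcases Nat.eq_zero_or_pos m with rfl | hm
    · simp [(isGhostExp_artinHasse p).1, hr]
    · rw [if_neg hm.ne', sub_zero]
      split_ifs with hd
      · obtain ⟨k, rfl⟩ := hd
        have hk : k ≠ 0 := by rintro rfl; simp at hm
        rw [Nat.mul_div_cancel_left _ (Nat.pow_pos hp.out.pos), norm_mul, norm_pow]
        refine (mul_le_of_le_one_right (pow_nonneg (norm_nonneg _) _)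
          (norm_coeff_artinHasse_le_one p k)).trans ?_
        exact (pow_le_of_le_one (norm_nonneg _) (ha0 i) hk).trans (ha i hi)
      · simpa using hr
  have key : ∀ m, i₀ ≤ m → GaussLE 1 (∏ i ∈ Finset.range m, Φ i) ∧
      GaussLE r (∏ i ∈ Finset.range m, Φ i - ∏ i ∈ Finset.range i₀, Φ i) := by
    have h1 : ∀ m, GaussLE 1 (∏ i ∈ Finset.range m, Φ i) := fun m =>
      (integralSeries p).prod_mem fun i _ => hΦ1 i
    intro m hm
    refine ⟨h1 m, ?_⟩
    induction m, hm using Nat.le_induction with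
    | base => intro m; simpa using hr
    | succ m hm ih =>
      intro k
      rw [Finset.prod_range_succ]
      have : (∏ i ∈ Finset.range m, Φ i) * Φ m - ∏ i ∈ Finset.range i₀, Φ i =
        (∏ i ∈ Finset.range m, Φ i) * (Φ m - 1) +
          (∏ i ∈ Finset.range m, Φ i - ∏ i ∈ Finset.range i₀, Φ i) := by ring
      rw [this, map_add]
      refine norm_add_le_of_le ?_ (ih k)
      simpa using (h1 m).mul zero_le_one hr (hΦr m hm) k
  rw [map_sub, artinHasseE, coeff_mk, ← map_sub]
  exact (key (n + 1) hn).2 n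

theorem gaussLE_artinHasseE_sub_one {a : WittVector p ℂ_[p]} {r : ℝ} (hr : 0 ≤ r) (hr1 : r ≤ 1)
    (ha : ∀ i, ‖a.coeff i‖ ≤ r) : GaussLE r (artinHasseE p a - 1) := fun n => by
  simpa using norm_coeff_artinHasseE_sub_le hr 0 (fun i => (ha i).trans hr1)
    (fun i _ => ha i) n (Nat.zero_le _)

theorem gaussLE_artinHasseE {a : WittVector p ℂ_[p]} (ha : ∀ i, ‖a.coeff i‖ ≤ 1) :
    GaussLE 1 (artinHasseE p a) := by
  have h := (integralSeries p).add_mem (gaussLE_artinHasseE_sub_one zero_le_one le_rfl ha)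
    gaussLE_one
  rwa [sub_add_cancel] at h

end ArtinHasseBounds

/-! ### Witt vectors with small components -/

section WittBounds

variable {p : ℕ} [hp : Fact p.Prime]

/-- The closed unit ball of `ℂ_p`, as a subring. -/
def unitBall (p : ℕ) [Fact p.Prime] : Subring ℂ_[p] where
  carrier := {x | ‖x‖ ≤ 1}
  mul_mem' hx hy := by
    simp only [Set.mem_ofPred_eq, norm_mul] at *
    exact mul_le_one₀ hx (norm_nonneg _) hy
  one_mem' := by simp
  add_mem' hx hy := norm_add_le_of_le hx hy
  zero_mem' := by simp
  neg_mem' hx := by simpa using hx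

/-- The ideal `{‖x‖ ≤ r}` of the closed unit ball. -/
def ballIdeal (p : ℕ) [Fact p.Prime] {r : ℝ} (hr : 0 ≤ r) : Ideal (unitBall p) where
  carrier := {x | ‖(x : ℂ_[p])‖ ≤ r}
  add_mem' hx hy := norm_add_le_of_le hx hy
  zero_mem' := by simpa using hr
  smul_mem' c x hx := by
    simp only [Set.mem_ofPred_eq, smul_eq_mul, Subring.coe_mul, norm_mul] at *
    exact (mul_le_of_le_one_left (norm_nonneg _) c.2).trans hx

/-- All components of the Witt vector `w` have norm at most `r`. -/
def WittLE (r : ℝ) (w : WittVector p ℂ_[p]) : Prop := ∀ i, ‖w.coeff i‖ ≤ r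

/-- Witt vectors with components of norm at most `r` are the images of an ideal of the ring of Witt
vectors over the closed unit ball. -/
theorem wittLE_iff {r : ℝ} (hr : 0 ≤ r) (hr1 : r ≤ 1) {w : WittVector p ℂ_[p]} :
    WittLE r w ↔ ∃ y ∈ RingHom.ker (WittVector.map (p := p) (Ideal.Quotient.mk (ballIdeal p hr))),
      WittVector.map (unitBall p).subtype y = w := by
  constructor
  · intro hw
    refine ⟨WittVector.mk p fun i => ⟨w.coeff i, (hw i).trans hr1⟩, ?_, ?_⟩
    · rw [RingHom.mem_ker]
      ext i
      rw [WittVector.map_coeff, WittVector.zero_coeff, Ideal.Quotient.eq_zero_iff_mem]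
      exact hw i
    · ext i
      rw [WittVector.map_coeff]
      rfl
  · rintro ⟨y, hy, rfl⟩ i
    rw [RingHom.mem_ker] at hy
    have := congrArg (fun z => WittVector.coeff z i) hy
    simp only [WittVector.map_coeff, WittVector.zero_coeff] at this
    rw [Ideal.Quotient.eq_zero_iff_mem] at this
    exact this

theorem WittLE.mono {r s : ℝ} {w : WittVector p ℂ_[p]} (hw : WittLE r w) (h : r ≤ s) :
    WittLE s w := fun i => (hw i).trans h

theorem wittLE_zero {r : ℝ} (hr : 0 ≤ r) : WittLE (p := p) r 0 := fun i => by simpa using hr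

theorem WittLE.add {r : ℝ} (hr : 0 ≤ r) (hr1 : r ≤ 1) {x y : WittVector p ℂ_[p]}
    (hx : WittLE r x) (hy : WittLE r y) : WittLE r (x + y) := by
  obtain ⟨x, hx', rfl⟩ := (wittLE_iff hr hr1).1 hx
  obtain ⟨y, hy', rfl⟩ := (wittLE_iff hr hr1).1 hy
  exact (wittLE_iff hr hr1).2 ⟨x + y, Ideal.add_mem _ hx' hy', map_add _ _ _⟩

theorem WittLE.neg {r : ℝ} (hr : 0 ≤ r) (hr1 : r ≤ 1) {x : WittVector p ℂ_[p]}
    (hx : WittLE r x) : WittLE r (-x) := by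
  obtain ⟨x, hx', rfl⟩ := (wittLE_iff hr hr1).1 hx
  exact (wittLE_iff hr hr1).2 ⟨-x, neg_mem hx', map_neg _ _⟩

theorem WittLE.sub {r : ℝ} (hr : 0 ≤ r) (hr1 : r ≤ 1) {x y : WittVector p ℂ_[p]}
    (hx : WittLE r x) (hy : WittLE r y) : WittLE r (x - y) := by
  rw [sub_eq_add_neg]; exact hx.add hr hr1 (hy.neg hr hr1)

theorem WittLE.mul_left {r : ℝ} (hr : 0 ≤ r) (hr1 : r ≤ 1) {x y : WittVector p ℂ_[p]}
    (hx : WittLE 1 x) (hy : WittLE r y) : WittLE r (x * y) := by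
  obtain ⟨x, -, rfl⟩ := (wittLE_iff zero_le_one le_rfl).1 hx
  obtain ⟨y, hy', rfl⟩ := (wittLE_iff hr hr1).1 hy
  exact (wittLE_iff hr hr1).2 ⟨x * y, Ideal.mul_mem_left _ _ hy', map_mul _ _ _⟩

theorem WittLE.mul_right {r : ℝ} (hr : 0 ≤ r) (hr1 : r ≤ 1) {x y : WittVector p ℂ_[p]}
    (hx : WittLE r x) (hy : WittLE 1 y) : WittLE r (x * y) := by
  rw [mul_comm]; exact hy.mul_left hr hr1 hx

theorem wittLE_teichmuller {r : ℝ} (hr : 0 ≤ r) {c : ℂ_[p]} (hc : ‖c‖ ≤ r) :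
    WittLE r (WittVector.teichmuller p c) := by
  intro i
  rcases Nat.eq_zero_or_pos i with rfl | hi
  · rwa [WittVector.teichmuller_coeff_zero]
  · rw [WittVector.teichmuller_coeff_pos p c i hi]; simpa using hr

theorem wittLE_one : WittLE (p := p) 1 1 := by
  have := wittLE_teichmuller (p := p) (r := 1) zero_le_one (c := 1) (by simp)
  rwa [map_one] at this

theorem wittLE_natCast (n : ℕ) : WittLE (p := p) 1 n := by
  induction n with
  | zero => simpa using wittLE_zero zero_le_one
  | succ n ih => rw [Nat.cast_succ]; exact ih.add zero_le_one le_rfl wittLE_one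

theorem WittLE.pow {x : WittVector p ℂ_[p]} (hx : WittLE 1 x) (n : ℕ) : WittLE 1 (x ^ n) := by
  induction n with
  | zero => simpa using wittLE_one
  | succ n ih => rw [pow_succ]; exact ih.mul_left zero_le_one le_rfl hx

theorem WittLE.verschiebung {r : ℝ} (hr : 0 ≤ r) {x : WittVector p ℂ_[p]} (hx : WittLE r x) :
    WittLE r (WittVector.verschiebung x) := by
  intro i
  cases i with
  | zero => simpa using hr
  | succ i => rw [WittVector.verschiebung_coeff_succ]; exact hx i

theorem WittLE.shift {r : ℝ} {x : WittVector p ℂ_[p]} (hx : WittLE r x) (n : ℕ) :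
    WittLE r (x.shift n) := fun i => by rw [WittVector.shift_coeff]; exact hx _

/-- The ghost map of `ℂ_p` is injective. -/
theorem ext_ghostComponent {x y : WittVector p ℂ_[p]}
    (h : ∀ n, WittVector.ghostComponent n x = WittVector.ghostComponent n y) : x = y :=
  (WittVector.ghostMap.bijective_of_invertible p ℂ_[p]).1 (funext fun n => by
    simpa [WittVector.ghostMap_apply] using h n)

theorem teichmuller_add_verschiebung_shift {R : Type*} [CommRing R] (w : WittVector p R) :
    WittVector.teichmuller p (w.coeff 0) + WittVector.verschiebung (w.shift 1) = w := by
  ext n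
  rw [WittVector.coeff_add_of_disjoint]
  · cases n with
    | zero => simp
    | succ n =>
      rw [WittVector.teichmuller_coeff_pos _ _ _ n.succ_pos, WittVector.verschiebung_coeff_succ,
        WittVector.shift_coeff, zero_add, add_comm]
  · intro n
    cases n with
    | zero => right; simp
    | succ n => left; exact WittVector.teichmuller_coeff_pos _ _ _ n.succ_pos

theorem frobenius_teichmuller (c : ℂ_[p]) :
    WittVector.frobenius (WittVector.teichmuller p c) = WittVector.teichmuller p (c ^ p) :=
  ext_ghostComponent fun n => by
    rw [WittVector.ghostComponent_frobenius, WittVector.ghostComponent_teichmuller,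
      WittVector.ghostComponent_teichmuller, ← pow_mul, pow_succ']

theorem verschiebung_mul_verschiebung {R : Type*} [CommRing R] (x y : WittVector p R) :
    WittVector.verschiebung x * WittVector.verschiebung y = WittVector.verschiebung (x * y) * p := by
  rw [← WittVector.verschiebung_mul_frobenius, WittVector.frobenius_verschiebung, ← mul_assoc,
    mul_comm (x * y), mul_comm _ (p : WittVector p R), ← nsmul_eq_mul, ← nsmul_eq_mul, map_nsmul]

theorem artinHasseE_mul_natCast (a : WittVector p ℂ_[p]) (n : ℕ) :
    artinHasseE p (a * n) = artinHasseE p a ^ n := by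
  induction n with
  | zero => simp [artinHasseE_zero]
  | succ n ih => rw [Nat.cast_succ, mul_add, mul_one, artinHasseE_add, ih, pow_succ]

theorem artinHasseE_verschiebung (a : WittVector p ℂ_[p]) :
    artinHasseE p (WittVector.verschiebung a) =
      PowerSeries.expand p hp.out.ne_zero (artinHasseE p a) := by
  have := artinHasseE_verschiebung_iterate a 1 (by simpa using hp.out.ne_zero)
  simpa using this

/-- Splitting off the leading components of both factors of a product of Witt vectors. -/
theorem mul_eq_split (a b : WittVector p ℂ_[p]) :
    a * b = WittVector.teichmuller p (a.coeff 0) * b +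
      (WittVector.verschiebung (WittVector.teichmuller p (b.coeff 0 ^ p) * a.shift 1) +
        WittVector.verschiebung (a.shift 1 * b.shift 1) * p) := by
  rw [← verschiebung_mul_verschiebung, mul_comm (WittVector.teichmuller p (b.coeff 0 ^ p)),
    ← frobenius_teichmuller, WittVector.verschiebung_mul_frobenius, ← mul_add,
    teichmuller_add_verschiebung_shift, ← add_mul, teichmuller_add_verschiebung_shift]

/-- Every use of the splitting `mul_eq_split` improves the bound for the tail of `E(a b)` by a factor
`c`: the only factor whose coefficients need not tend to zero is the `p`-th power of an exponential
of the same kind. -/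
theorem tailLE_artinHasseE_mul {r c : ℝ} (hr : 0 < r) (hrc : r ≤ c) (hc1 : c < 1)
    (hpc : ‖(p : ℂ_[p])‖ ≤ c) (n : ℕ) {a b : WittVector p ℂ_[p]} (ha : WittLE r a)
    (hb : WittLE r b) : TailLE (c ^ n * r) (artinHasseE p (a * b)) := by
  have hr1 : r < 1 := hrc.trans_lt hc1
  have hc : 0 < c := hr.trans_le hrc
  induction n generalizing a b with
  | zero =>
    refine ⟨1, fun n hn => ?_⟩
    have := gaussLE_artinHasseE_sub_one hr.le hr1.le
      ((ha.mono hr1.le).mul_left hr.le hr1.le hb) n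
    rw [map_sub, coeff_one, if_neg (by omega), sub_zero] at this
    simpa using this
  | succ n ih =>
    have hpos : 0 < c ^ (n + 1) * r := mul_pos (pow_pos hc _) hr
    have hle : c ^ n * r ≤ r := mul_le_of_le_one_left hr.le (pow_le_one₀ hc.le hc1.le)
    have hE : ∀ {w : WittVector p ℂ_[p]}, WittLE r w → GaussLE 1 (artinHasseE p w) := fun h =>
      gaussLE_artinHasseE (h.mono hr1.le)
    have hb0 : ‖b.coeff 0 ^ p‖ < 1 := by
      rw [norm_pow]
      exact pow_lt_one₀ (norm_nonneg _) ((hb 0).trans_lt hr1) hp.out.ne_zero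
    have hab : WittLE r (a.shift 1 * b.shift 1) :=
      ((ha.shift 1).mono hr1.le).mul_left hr.le hr1.le (hb.shift 1)
    rw [mul_eq_split, artinHasseE_add, artinHasseE_add, artinHasseE_teichmuller_mul,
      artinHasseE_verschiebung, artinHasseE_teichmuller_mul, artinHasseE_mul_natCast,
      artinHasseE_verschiebung]
    have h1 := (hE hb).isNull_rescale ((ha 0).trans_lt hr1)
    have h1' := (hE hb).rescale ((ha 0).trans hr1.le)
    have h2 := ((hE (ha.shift 1)).isNull_rescale hb0).expand p hp.out.ne_zero
    have h2' := ((hE (ha.shift 1)).rescale hb0.le).expand zero_le_one p hp.out.ne_zero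
    have h3' := (hE hab).expand zero_le_one p hp.out.ne_zero
    have h3 := ((ih (ha.shift 1) (hb.shift 1)).expand (by positivity) p hp.out.ne_zero).pow_prime
      (by positivity) (hle.trans hr1.le) h3' hpc (hle.trans hrc)
    have h3'' := h3'.pow zero_le_one p
    rw [one_pow] at h3''
    rw [← mul_assoc, ← pow_succ'] at h3
    exact TailLE.mul hpos.le h1' (h2'.one_mul_one h3'') (h1.tailLE hpos)
      (TailLE.mul hpos.le h2' h3'' (h2.tailLE hpos) h3)

/-- **Overconvergence of products.** If `a` and `b` have components of norm at most `r < 1`, then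
`E(a b)` converges on the closed unit disc. Splitting off leading components gives
`E(a b) = E(b)(a₀ X) · E(a')(b₀ ^ p X ^ p) · E(a' b')(X ^ p) ^ p`, where the first two factors
converge and the `p`-th power contracts the tail of the third. -/
theorem isNull_artinHasseE_mul {r : ℝ} (hr1 : r < 1) {a b : WittVector p ℂ_[p]} (ha : WittLE r a)
    (hb : WittLE r b) : IsNull (artinHasseE p (a * b)) := by
  set s : ℝ := max r ‖(p : ℂ_[p])‖ with hs
  have hs0 : 0 < s := (norm_prime_pos p).trans_le (le_max_right _ _)
  have hs1 : s < 1 := max_lt hr1 (norm_prime_lt_one p)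
  rw [isNull_iff_tailLE]
  intro ε hε
  obtain ⟨n, hn⟩ := exists_pow_lt_of_lt_one hε hs1
  obtain ⟨M, hM⟩ := tailLE_artinHasseE_mul hs0 le_rfl hs1 (le_max_right _ _) n
    (ha.mono (le_max_left _ _)) (hb.mono (le_max_left _ _))
  refine ⟨M, fun m hm => (hM m hm).trans ?_⟩
  exact (mul_le_of_le_one_right (pow_nonneg hs0.le n) hs1.le).trans hn.le

end WittBounds

/-! ### Evaluation of power series -/

section Evaluation

variable {p : ℕ} [hp : Fact p.Prime]

instance nonarchimedeanRing_padicComplex : NonarchimedeanRing ℂ_[p] where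
  is_nonarchimedean := NonarchimedeanAddGroup.is_nonarchimedean

/-- The series `f` converges at `z`. -/
def ConvergesAt (f : ℂ_[p]⟦X⟧) (z : ℂ_[p]) : Prop := Summable fun n => coeff n f * z ^ n

/-- The value of the series `f` at `z`; it is `0` where `f` does not converge. -/
noncomputable def evalAt (f : ℂ_[p]⟦X⟧) (z : ℂ_[p]) : ℂ_[p] := ∑' n, coeff n f * z ^ n

theorem convergesAt_of_tendsto {f : ℂ_[p]⟦X⟧} {z : ℂ_[p]}
    (h : Tendsto (fun n => coeff n f * z ^ n) atTop (𝓝 0)) : ConvergesAt f z := by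
  apply NonarchimedeanAddGroup.summable_of_tendsto_cofinite_zero
  rwa [Nat.cofinite_eq_atTop]

theorem IsNull.convergesAt {f : ℂ_[p]⟦X⟧} (hf : IsNull f) {z : ℂ_[p]} (hz : ‖z‖ ≤ 1) :
    ConvergesAt f z := by
  refine convergesAt_of_tendsto (squeeze_zero_norm (fun n => ?_) (tendsto_norm_zero.comp hf))
  rw [norm_mul, norm_pow]
  exact mul_le_of_le_one_right (norm_nonneg _) (pow_le_one₀ (norm_nonneg _) hz)

theorem GaussLE.convergesAt {r : ℝ} {f : ℂ_[p]⟦X⟧} (hf : GaussLE r f) {z : ℂ_[p]} (hz : ‖z‖ < 1) :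
    ConvergesAt f z := by
  refine convergesAt_of_tendsto (squeeze_zero_norm (a := fun n => r * ‖z‖ ^ n) (fun n => ?_) ?_)
  · rw [norm_mul, norm_pow]
    exact mul_le_mul_of_nonneg_right (hf n) (pow_nonneg (norm_nonneg _) _)
  · simpa using (tendsto_pow_atTop_nhds_zero_of_lt_one (norm_nonneg z) hz).const_mul r

theorem hasSum_cauchyProduct {u v : ℕ → ℂ_[p]} (hu : Summable u) (hv : Summable v) :
    HasSum (fun n => ∑ kl ∈ Finset.HasAntidiagonal.antidiagonal n, u kl.1 * v kl.2)
      ((∑' n, u n) * ∑' n, v n) := by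
  have h : Summable fun x : ℕ × ℕ => u x.1 * v x.2 := hu.mul_of_nonarchimedean hv
  rw [hu.tsum_mul_tsum_eq_tsum_sum_antidiagonal hv h]
  exact (summable_sum_mul_antidiagonal_of_summable_mul h).hasSum

theorem hasSum_evalAt_mul {f g : ℂ_[p]⟦X⟧} {z : ℂ_[p]} (hf : ConvergesAt f z)
    (hg : ConvergesAt g z) :
    HasSum (fun n => coeff n (f * g) * z ^ n) (evalAt f z * evalAt g z) := by
  refine (hasSum_cauchyProduct hf hg).congr_fun fun n => ?_
  rw [coeff_mul, Finset.sum_mul]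
  refine Finset.sum_congr rfl fun x hx => ?_
  rw [← Finset.HasAntidiagonal.mem_antidiagonal.1 hx, pow_add]; ring

theorem ConvergesAt.mul {f g : ℂ_[p]⟦X⟧} {z : ℂ_[p]} (hf : ConvergesAt f z)
    (hg : ConvergesAt g z) : ConvergesAt (f * g) z := (hasSum_evalAt_mul hf hg).summable

theorem evalAt_mul {f g : ℂ_[p]⟦X⟧} {z : ℂ_[p]} (hf : ConvergesAt f z)
    (hg : ConvergesAt g z) : evalAt (f * g) z = evalAt f z * evalAt g z :=
  (hasSum_evalAt_mul hf hg).tsum_eq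

theorem evalAt_add {f g : ℂ_[p]⟦X⟧} {z : ℂ_[p]} (hf : ConvergesAt f z)
    (hg : ConvergesAt g z) : evalAt (f + g) z = evalAt f z + evalAt g z := by
  simp only [evalAt, map_add, add_mul]
  exact Summable.tsum_add hf hg

theorem hasSum_monomial (c z : ℂ_[p]) (m : ℕ) :
    HasSum (fun n => coeff n (PowerSeries.monomial m c) * z ^ n) (c * z ^ m) := by
  have := hasSum_single (f := fun n => coeff n (PowerSeries.monomial m c) * z ^ n) m
    (fun n hn => by simp [coeff_monomial, hn])
  simpa using this

theorem convergesAt_monomial (c z : ℂ_[p]) (m : ℕ) : ConvergesAt (PowerSeries.monomial m c) z :=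
  (hasSum_monomial c z m).summable

theorem evalAt_monomial (c z : ℂ_[p]) (m : ℕ) : evalAt (PowerSeries.monomial m c) z = c * z ^ m :=
  (hasSum_monomial c z m).tsum_eq

theorem evalAt_one (z : ℂ_[p]) : evalAt 1 z = 1 := by
  simpa using evalAt_monomial 1 z 0

theorem evalAt_rescale (f : ℂ_[p]⟦X⟧) (c z : ℂ_[p]) :
    evalAt (PowerSeries.rescale c f) z = evalAt f (c * z) := by
  simp only [evalAt, coeff_rescale, mul_pow]
  congr 1; ext n; ring

theorem evalAt_expand (f : ℂ_[p]⟦X⟧) (m : ℕ) (hm : m ≠ 0) (z : ℂ_[p]) :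
    evalAt (PowerSeries.expand m hm f) z = evalAt f (z ^ m) := by
  have hinj : Function.Injective fun n : ℕ => m * n := fun a b h =>
    Nat.eq_of_mul_eq_mul_left (Nat.pos_of_ne_zero hm) h
  rw [evalAt, ← hinj.tsum_eq]
  · simp only [coeff_expand_mul, evalAt, pow_mul]
  · intro n hn
    by_contra h
    refine hn ?_
    have h0 := coeff_expand_of_not_dvd m hm f (m := n) fun ⟨k, hk⟩ => h ⟨k, hk.symm⟩
    simp only [h0, zero_mul]

theorem norm_evalAt_le {f : ℂ_[p]⟦X⟧} {r : ℝ} (hr : 0 ≤ r) (hf : GaussLE r f) {z : ℂ_[p]}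
    (hz : ‖z‖ ≤ 1) : ‖evalAt f z‖ ≤ r := by
  refine IsUltrametricDist.norm_tsum_le_of_forall_le_of_nonneg hr fun n => ?_
  rw [norm_mul, norm_pow]
  exact (mul_le_of_le_one_right (norm_nonneg _) (pow_le_one₀ (norm_nonneg _) hz)).trans (hf n)

theorem gaussLE_map_padicInt (G : ℤ_[p]⟦X⟧) :
    GaussLE 1 (PowerSeries.map (algebraMap ℤ_[p] ℂ_[p]) G) := fun n => by
  rw [coeff_map, norm_algebraMap_padicInt]; exact PadicInt.norm_le_one _

theorem evalZp_eq_evalAt (G : ℤ_[p]⟦X⟧) (z : ℂ_[p]) :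
    evalZp p G z = evalAt (PowerSeries.map (algebraMap ℤ_[p] ℂ_[p]) G) z := rfl

theorem norm_evalZp_le_one (G : ℤ_[p]⟦X⟧) {z : ℂ_[p]} (hz : ‖z‖ ≤ 1) : ‖evalZp p G z‖ ≤ 1 :=
  norm_evalAt_le zero_le_one (gaussLE_map_padicInt G) hz

theorem evalZp_lubinTate (G : ℤ_[p]⟦X⟧) {z : ℂ_[p]} (hz : ‖z‖ < 1) :
    evalZp p (PowerSeries.C (p : ℤ_[p]) * PowerSeries.X + PowerSeries.X ^ p
      + PowerSeries.C (p : ℤ_[p]) * PowerSeries.X ^ 2 * G) z =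
      p * z + z ^ p + p * z ^ 2 * evalZp p G z := by
  have h : PowerSeries.map (algebraMap ℤ_[p] ℂ_[p])
      (PowerSeries.C (p : ℤ_[p]) * PowerSeries.X + PowerSeries.X ^ p
      + PowerSeries.C (p : ℤ_[p]) * PowerSeries.X ^ 2 * G) =
      PowerSeries.monomial 1 (p : ℂ_[p]) + PowerSeries.monomial p 1 +
        PowerSeries.monomial 2 (p : ℂ_[p]) * PowerSeries.map (algebraMap ℤ_[p] ℂ_[p]) G := by
    have hm : ∀ (n : ℕ) (c : ℂ_[p]), PowerSeries.monomial n c = PowerSeries.C c * X ^ n := by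
      intro n c
      ext k
      simp [coeff_monomial, coeff_X_pow]
    simp only [hm, map_add, map_mul, map_pow, PowerSeries.map_X, map_natCast, map_one, one_mul,
      pow_one]
  have hG := (gaussLE_map_padicInt G).convergesAt hz
  have h1 := convergesAt_monomial (p : ℂ_[p]) z 1
  have h2 := convergesAt_monomial (1 : ℂ_[p]) z p
  have h3 := convergesAt_monomial (p : ℂ_[p]) z 2
  have h12 : ConvergesAt (PowerSeries.monomial 1 (p : ℂ_[p]) + PowerSeries.monomial p 1) z := by
    have := Summable.add h1 h2
    simpa only [ConvergesAt, map_add, add_mul] using this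
  rw [evalZp_eq_evalAt, h, evalAt_add h12 (h3.mul hG), evalAt_add h1 h2, evalAt_mul h3 hG,
    evalAt_monomial, evalAt_monomial, evalAt_monomial, ← evalZp_eq_evalAt]
  ring

/-- On a closed disc of radius `r < 1`, a power series over `ℤ_p` is a uniform limit of polynomials
with coefficients in `ℕ`. -/
theorem exists_natPoly_approx (G : ℤ_[p]⟦X⟧) {r ε : ℝ} (hr : 0 ≤ r) (hr1 : r < 1) (hε : 0 < ε) :
    ∃ (M : ℕ) (c : ℕ → ℕ), ∀ z : ℂ_[p], ‖z‖ ≤ r →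
      ‖evalZp p G z - ∑ i ∈ Finset.range M, (c i : ℂ_[p]) * z ^ i‖ ≤ ε := by
  obtain ⟨M, hM⟩ := exists_pow_lt_of_lt_one hε hr1
  choose c hc using fun i => (PadicInt.denseRange_natCast (p := p)).exists_dist_lt (coeff i G) hε
  refine ⟨M, c, fun z hz => ?_⟩
  have hconv : Summable fun n => coeff n (PowerSeries.map (algebraMap ℤ_[p] ℂ_[p]) G) * z ^ n :=
    (gaussLE_map_padicInt G).convergesAt (hz.trans_lt hr1)
  have hfin : HasSum (fun i => if i ∈ Finset.range M then (c i : ℂ_[p]) * z ^ i else 0)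
      (∑ i ∈ Finset.range M, (c i : ℂ_[p]) * z ^ i) := by
    have := hasSum_sum_of_ne_finset_zero (s := Finset.range M) (L := SummationFilter.unconditional ℕ)
      (f := fun i => if i ∈ Finset.range M then (c i : ℂ_[p]) * z ^ i else 0)
      (fun b hb => if_neg hb)
    convert this using 1
    exact Finset.sum_congr rfl fun i hi => (if_pos hi).symm
  have := (hconv.hasSum.sub hfin).tsum_eq
  rw [evalZp_eq_evalAt, evalAt, ← this]
  refine IsUltrametricDist.norm_tsum_le_of_forall_le_of_nonneg hε.le fun n => ?_
  split_ifs with h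
  · rw [← sub_mul, norm_mul, norm_pow]
    refine (mul_le_of_le_one_right (norm_nonneg _)
      (pow_le_one₀ (norm_nonneg _) (hz.trans hr1.le))).trans ?_
    rw [coeff_map, ← map_natCast (algebraMap ℤ_[p] ℂ_[p]), ← map_sub, norm_algebraMap_padicInt,
      ← dist_eq_norm]
    exact (hc n).le
  · rw [sub_zero, norm_mul, norm_pow]
    refine (mul_le_of_le_one_left (pow_nonneg (norm_nonneg _) _) (gaussLE_map_padicInt G n)).trans ?_
    rw [Finset.mem_range, not_lt] at h
    exact (pow_le_pow_left₀ (norm_nonneg _) hz n).trans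
      ((pow_le_pow_of_le_one hr hr1.le h).trans hM.le)

end Evaluation

/-! ### A lemma of Dwork type for Lubin-Tate recursions -/

section Dwork

variable {p : ℕ} [hp : Fact p.Prime]

theorem pow_mul_coeff_eq (w : WittVector p ℂ_[p]) (k : ℕ) :
    (p : ℂ_[p]) ^ k * w.coeff k = WittVector.ghostComponent k w -
      ∑ i ∈ Finset.range k, (p : ℂ_[p]) ^ i * w.coeff i ^ p ^ (k - i) := by
  rw [ghostComponent_eq_sum, Finset.sum_range_succ]
  simp

theorem norm_coeff_mul_eq (w : WittVector p ℂ_[p]) (k : ℕ) :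
    ‖(p : ℂ_[p])‖ ^ k * ‖w.coeff k‖ = ‖WittVector.ghostComponent k w -
      ∑ i ∈ Finset.range k, (p : ℂ_[p]) ^ i * w.coeff i ^ p ^ (k - i)‖ := by
  rw [← pow_mul_coeff_eq, norm_mul, norm_pow]

theorem coeff_eq_of_ghostComponent_eq {x y : WittVector p ℂ_[p]} {N : ℕ}
    (h : ∀ k ≤ N, WittVector.ghostComponent k x = WittVector.ghostComponent k y) :
    x.coeff N = y.coeff N := by
  induction N using Nat.strong_induction_on with
  | _ N ih =>
  have hpN : (p : ℂ_[p]) ^ N ≠ 0 := pow_ne_zero _ (Nat.cast_ne_zero.2 hp.out.ne_zero)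
  refine mul_left_cancel₀ hpN ?_
  rw [pow_mul_coeff_eq, pow_mul_coeff_eq, h N le_rfl]
  congr 1
  refine Finset.sum_congr rfl fun i hi => ?_
  rw [Finset.mem_range] at hi
  rw [ih i hi fun k hk => h k (by omega)]

theorem ghostComponent_eq_of_coeff_eq {x y : WittVector p ℂ_[p]} {N : ℕ}
    (h : ∀ k ≤ N, x.coeff k = y.coeff k) :
    WittVector.ghostComponent N x = WittVector.ghostComponent N y := by
  rw [ghostComponent_eq_sum, ghostComponent_eq_sum]
  refine Finset.sum_congr rfl fun i hi => ?_
  rw [Finset.mem_range] at hi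
  rw [h i (by omega)]

@[simp]
theorem ghostComponent_ghostEquiv_symm (g : ℕ → ℂ_[p]) (k : ℕ) :
    WittVector.ghostComponent k ((WittVector.ghostEquiv p ℂ_[p]).symm g) = g k := by
  rw [← WittVector.ghostMap_apply]
  exact congrFun ((WittVector.ghostEquiv p ℂ_[p]).apply_symm_apply g) k

/-- The Witt vector whose components of index at least `n` are replaced by zero. -/
noncomputable def truncWitt (n : ℕ) (w : WittVector p ℂ_[p]) : WittVector p ℂ_[p] :=
  WittVector.mk p fun i => if i < n then w.coeff i else 0

theorem truncWitt_coeff (n : ℕ) (w : WittVector p ℂ_[p]) (i : ℕ) :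
    (truncWitt n w).coeff i = if i < n then w.coeff i else 0 := rfl

theorem ghostComponent_truncWitt {n k : ℕ} (hk : k < n) (w : WittVector p ℂ_[p]) :
    WittVector.ghostComponent k (truncWitt n w) = WittVector.ghostComponent k w :=
  ghostComponent_eq_of_coeff_eq fun i hi => by rw [truncWitt_coeff, if_pos (by omega)]

theorem wittLE_truncWitt {r : ℝ} (hr : 0 ≤ r) {n : ℕ} {w : WittVector p ℂ_[p]}
    (h : ∀ i < n, ‖w.coeff i‖ ≤ r) : WittLE r (truncWitt n w) := by
  intro i
  rw [truncWitt_coeff]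
  split_ifs with hi
  · exact h i hi
  · simpa using hr

theorem wittLE_of_forall_exists {r : ℝ} {w : WittVector p ℂ_[p]}
    (h : ∀ N, ∃ y, WittLE r y ∧
      ∀ k ≤ N, WittVector.ghostComponent k y = WittVector.ghostComponent k w) : WittLE r w := by
  intro N
  obtain ⟨y, hy, hyw⟩ := h N
  rw [← coeff_eq_of_ghostComponent_eq hyw]
  exact hy N

theorem WittLE.norm_ghostComponent_le {r : ℝ} (hr : 0 ≤ r) (hr1 : r ≤ 1) {w : WittVector p ℂ_[p]}
    (hw : WittLE r w) (k : ℕ) : ‖WittVector.ghostComponent k w‖ ≤ r := by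
  rw [ghostComponent_eq_sum]
  refine norm_sum_le_of_le hr fun i _ => ?_
  rw [norm_mul, norm_pow, norm_pow]
  refine (mul_le_of_le_one_left (pow_nonneg (norm_nonneg _) _)
    (pow_le_one₀ (norm_nonneg _) (norm_prime_lt_one p).le)).trans ?_
  exact (pow_le_of_le_one (norm_nonneg _) ((hw i).trans hr1)
    (Nat.pow_pos hp.out.pos).ne').trans (hw i)

/-- Ghost components that are small enough are those of an integral Witt vector. -/
theorem norm_coeff_le_of_norm_ghostComponent_le {w : WittVector p ℂ_[p]} {N : ℕ}
    (h : ∀ k ≤ N, ‖WittVector.ghostComponent k w‖ ≤ ‖(p : ℂ_[p])‖ ^ N) {k : ℕ} (hk : k ≤ N) :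
    ‖w.coeff k‖ ≤ ‖(p : ℂ_[p])‖ ^ (N - k) := by
  have hp0 := norm_prime_pos p
  have hp1 := (norm_prime_lt_one p).le
  induction k using Nat.strong_induction_on with
  | _ k ih =>
  refine le_of_mul_le_mul_left ?_ (pow_pos hp0 k)
  rw [norm_coeff_mul_eq, ← pow_add, Nat.add_sub_cancel' hk]
  refine norm_sub_le_of_le (h k hk) (norm_sum_le_of_le (pow_nonneg hp0.le _) fun i hi => ?_)
  rw [Finset.mem_range] at hi
  rw [norm_mul, norm_pow, norm_pow]
  have h1 : ‖w.coeff i‖ ^ p ^ (k - i) ≤ ‖(p : ℂ_[p])‖ ^ (N - i) :=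
    (pow_le_of_le_one (norm_nonneg _) ((ih i hi (by omega)).trans (pow_le_one₀ hp0.le hp1))
      (Nat.pow_pos hp.out.pos).ne').trans (ih i hi (by omega))
  calc ‖(p : ℂ_[p])‖ ^ i * ‖w.coeff i‖ ^ p ^ (k - i)
      ≤ ‖(p : ℂ_[p])‖ ^ i * ‖(p : ℂ_[p])‖ ^ (N - i) :=
        mul_le_mul_of_nonneg_left h1 (pow_nonneg hp0.le _)
    _ = ‖(p : ℂ_[p])‖ ^ N := by rw [← pow_add, Nat.add_sub_cancel' (by omega)]

/-- Applying a power series over `ℤ_p` to ghost components of size at most `r < 1` yields the ghost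
components of an integral Witt vector: up to a small error the series is a polynomial with natural
coefficients, which can be applied to the Witt vector itself. -/
theorem exists_ghostComponent_evalZp (G : ℤ_[p]⟦X⟧) {r : ℝ} (hr : 0 ≤ r) (hr1 : r < 1)
    {y : WittVector p ℂ_[p]} (hy : WittLE r y) (N : ℕ) :
    ∃ γ : WittVector p ℂ_[p], WittLE 1 γ ∧ ∀ k ≤ N, WittVector.ghostComponent k γ =
      evalZp p G (WittVector.ghostComponent k y) := by
  obtain ⟨M, c, hc⟩ := exists_natPoly_approx G hr hr1 (pow_pos (norm_prime_pos p) N)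
  set q : WittVector p ℂ_[p] := ∑ i ∈ Finset.range M, (c i : WittVector p ℂ_[p]) * y ^ i with hq
  have hqle : WittLE 1 q := by
    rw [hq]
    refine Finset.sum_induction _ (WittLE 1) (fun _ _ ha hb => ha.add zero_le_one le_rfl hb)
      (wittLE_zero zero_le_one) fun i _ => ?_
    exact (wittLE_natCast _).mul_left zero_le_one le_rfl ((hy.mono hr1.le).pow i)
  set e : WittVector p ℂ_[p] := (WittVector.ghostEquiv p ℂ_[p]).symm fun k =>
    evalZp p G (WittVector.ghostComponent k y) - WittVector.ghostComponent k q with he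
  have hee : WittLE 1 (truncWitt (N + 1) e) := by
    refine wittLE_truncWitt zero_le_one fun i hi => ?_
    refine (norm_coeff_le_of_norm_ghostComponent_le (N := N) (fun k _ => ?_)
      (Nat.lt_succ_iff.1 hi)).trans (pow_le_one₀ (norm_prime_pos p).le (norm_prime_lt_one p).le)
    rw [he, ghostComponent_ghostEquiv_symm, hq, map_sum]
    simp only [map_mul, map_natCast, map_pow]
    exact hc _ (hy.norm_ghostComponent_le hr hr1.le k)
  refine ⟨q + truncWitt (N + 1) e, hqle.add zero_le_one le_rfl hee, fun k hk => ?_⟩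
  rw [map_add, ghostComponent_truncWitt (by omega), he, ghostComponent_ghostEquiv_symm]
  ring

/-- Integrally, the Frobenius of a Witt vector is congruent to its `p`-th power modulo `p`. -/
theorem exists_pow_sub_frobenius_eq {r : ℝ} (hr : 0 ≤ r) (hr1 : r ≤ 1) {y : WittVector p ℂ_[p]}
    (hy : WittLE r y) :
    ∃ v, WittLE r v ∧ y ^ p - WittVector.frobenius y = (p : WittVector p ℂ_[p]) * v := by
  set b := y.shift 1 with hb
  have hble : WittLE r b := hy.shift 1
  have hdec : WittVector.teichmuller p (y.coeff 0) + WittVector.verschiebung b = y :=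
    teichmuller_add_verschiebung_shift y
  set x := WittVector.teichmuller p (y.coeff 0) with hx
  have hxle : WittLE r x := wittLE_teichmuller hr (hy 0)
  have hVb : WittLE r (WittVector.verschiebung b) := hble.verschiebung hr
  obtain ⟨R, hR, hRe⟩ : ∃ R, WittLE 1 R ∧ y ^ p = x ^ p + WittVector.verschiebung b ^ p +
      (p : WittVector p ℂ_[p]) * x * WittVector.verschiebung b * R := by
    obtain ⟨x', -, hx'⟩ := (wittLE_iff zero_le_one le_rfl).1 (hxle.mono hr1)
    obtain ⟨b', -, hb'⟩ := (wittLE_iff zero_le_one le_rfl).1 (hVb.mono hr1)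
    obtain ⟨R', hR'⟩ := exists_add_pow_prime_eq hp.out x' b'
    refine ⟨WittVector.map (unitBall p).subtype R', fun i => ?_, ?_⟩
    · rw [WittVector.map_coeff]; exact (R'.coeff i).2
    · rw [← hdec, ← hx', ← hb', ← map_add, ← map_pow, hR']
      simp
  obtain ⟨m, hm⟩ : ∃ m, p = m + 2 := ⟨p - 2, by have := hp.out.two_le; omega⟩
  have hVp : WittVector.verschiebung b ^ p =
      (p : WittVector p ℂ_[p]) * (WittVector.verschiebung b ^ m * WittVector.verschiebung (b * b)) := by
    have h1 : WittVector.verschiebung b ^ p = WittVector.verschiebung b ^ (m + 2) := by rw [← hm]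
    rw [h1, pow_add, pow_two, verschiebung_mul_verschiebung]
    ring
  have hF : WittVector.frobenius y = x ^ p + (p : WittVector p ℂ_[p]) * b := by
    rw [← hdec, map_add, WittVector.frobenius_verschiebung, hx, frobenius_teichmuller, map_pow]
    ring
  refine ⟨x * WittVector.verschiebung b * R +
    WittVector.verschiebung b ^ m * WittVector.verschiebung (b * b) - b, ?_, ?_⟩
  · refine WittLE.sub hr hr1 (WittLE.add hr hr1 ?_ ?_) hble
    · exact ((hxle.mono hr1).mul_left hr hr1 hVb).mul_right hr hr1 hR
    · exact ((hVb.mono hr1).pow m).mul_left hr hr1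
        (((hble.mono hr1).mul_left hr hr1 hble).verschiebung hr)
  · rw [hRe, hF, hVp]; ring

/-- **Dwork's lemma for a Lubin-Tate series.** The iterates of a Lubin-Tate series at a point of
norm at most `r < 1` are the ghost components of a Witt vector with components of norm at most
`r`. -/
theorem wittLE_of_iterates (G : ℤ_[p]⟦X⟧) {r : ℝ} (hr : 0 ≤ r) (hr1 : r < 1)
    {w : WittVector p ℂ_[p]} (h0 : ‖w.coeff 0‖ ≤ r)
    (hw : ∀ k, WittVector.ghostComponent (k + 1) w = p * WittVector.ghostComponent k w +
      WittVector.ghostComponent k w ^ p +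
      p * WittVector.ghostComponent k w ^ 2 * evalZp p G (WittVector.ghostComponent k w)) :
    WittLE r w := by
  suffices h : ∀ N, ∀ i < N + 1, ‖w.coeff i‖ ≤ r from fun i => h i i (by omega)
  intro N
  induction N with
  | zero =>
    intro i hi
    obtain rfl : i = 0 := by omega
    exact h0
  | succ N ih =>
    intro i hi
    rcases Nat.lt_succ_iff_lt_or_eq.1 hi with hi | rfl
    · exact ih i hi
    set y := truncWitt (N + 1) w with hy
    have hyle : WittLE r y := wittLE_truncWitt hr ih
    have hyw : ∀ k ≤ N, WittVector.ghostComponent k y = WittVector.ghostComponent k w := fun k hk =>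
      ghostComponent_truncWitt (by omega) w
    obtain ⟨v, hv, hve⟩ := exists_pow_sub_frobenius_eq hr hr1.le hyle
    obtain ⟨γ, hγ, hγe⟩ := exists_ghostComponent_evalZp G hr hr1 hyle N
    -- `u` satisfies `F(z) = z ^ p + p u` in the first `N + 1` ghost components, so that
    -- `u + v` measures the defect of the ghost equation for the truncation `y`.
    set u := y + y * y * γ with hu
    have hule : WittLE r u := hyle.add hr hr1.le
      (((hyle.mono hr1.le).mul_left hr hr1.le hyle).mul_right hr hr1.le hγ)
    have huv : WittLE r (u + v) := hule.add hr hr1.le hv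
    have hp0 : (p : ℂ_[p]) ≠ 0 := Nat.cast_ne_zero.2 hp.out.ne_zero
    have hgv : ∀ k, (p : ℂ_[p]) * WittVector.ghostComponent k v =
        WittVector.ghostComponent k y ^ p - WittVector.ghostComponent (k + 1) y := fun k => by
      have := congrArg (WittVector.ghostComponent k) hve
      rw [map_sub, map_pow, WittVector.ghostComponent_frobenius, map_mul, map_natCast] at this
      exact this.symm
    have hgu : ∀ k ≤ N, (p : ℂ_[p]) * WittVector.ghostComponent k u =
        WittVector.ghostComponent (k + 1) w - WittVector.ghostComponent k w ^ p := fun k hk => by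
      rw [hu, map_add, map_mul, map_mul, hγe k hk, hyw k hk, hw k]; ring
    have hguv : ∀ k ≤ N, (p : ℂ_[p]) * WittVector.ghostComponent k (u + v) =
        WittVector.ghostComponent (k + 1) w - WittVector.ghostComponent (k + 1) y := fun k hk => by
      rw [map_add, mul_add, hgu k hk, hgv k, hyw k hk]; ring
    have hz : ∀ j < N, (u + v).coeff j = 0 := by
      intro j hj
      have : (u + v).coeff j = (0 : WittVector p ℂ_[p]).coeff j := by
        refine coeff_eq_of_ghostComponent_eq fun k hk => ?_
        refine mul_left_cancel₀ hp0 ?_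
        rw [hguv k (by omega), hyw (k + 1) (by omega)]
        simp
      simpa using this
    have hN1 := pow_mul_coeff_eq (u + v) N
    rw [Finset.sum_eq_zero, sub_zero] at hN1
    · have h1 : (p : ℂ_[p]) ^ (N + 1) * w.coeff (N + 1) = p ^ (N + 1) * (u + v).coeff N := by
        rw [pow_mul_coeff_eq, pow_succ', mul_assoc, hN1, hguv N le_rfl]
        congr 1
        rw [ghostComponent_eq_sum y, Finset.sum_range_succ _ (N + 1), hy, truncWitt_coeff,
          if_neg (lt_irrefl _), zero_pow (Nat.pow_pos hp.out.pos).ne', mul_zero, add_zero]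
        refine Finset.sum_congr rfl fun j hj => ?_
        rw [Finset.mem_range] at hj
        rw [truncWitt_coeff, if_pos hj]
      rw [mul_left_cancel₀ (pow_ne_zero _ hp0) h1]
      exact huv N
    · intro j hj
      rw [Finset.mem_range] at hj
      rw [hz j hj, zero_pow (Nat.pow_pos hp.out.pos).ne', mul_zero]

end Dwork

/-! ### The Witt vectors of a Tate generator -/

section LubinTate

variable {p : ℕ} [hp : Fact p.Prime]

theorem IsLubinTate.exists_evalZp_eq {F : ℤ_[p]⟦X⟧} (hF : IsLubinTate p F) :
    ∃ G : ℤ_[p]⟦X⟧, ∀ z : ℂ_[p], ‖z‖ < 1 →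
      evalZp p F z = p * z + z ^ p + p * z ^ 2 * evalZp p G z := by
  obtain ⟨G, rfl⟩ := hF
  exact ⟨G, fun z hz => evalZp_lubinTate G hz⟩

theorem IsLubinTate.norm_evalZp_le {F : ℤ_[p]⟦X⟧} (hF : IsLubinTate p F) {z : ℂ_[p]}
    (hz : ‖z‖ < 1) : ‖evalZp p F z‖ ≤ ‖z‖ := by
  obtain ⟨G, hG⟩ := hF.exists_evalZp_eq
  have hp1 := (norm_prime_lt_one p).le
  rw [hG z hz]
  refine norm_add_le_of_le (norm_add_le_of_le ?_ ?_) ?_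
  · rw [norm_mul]; exact mul_le_of_le_one_left (norm_nonneg _) hp1
  · rw [norm_pow]; exact pow_le_of_le_one (norm_nonneg _) hz.le hp.out.ne_zero
  · rw [norm_mul, norm_mul, norm_pow]
    refine (mul_le_of_le_one_right (by positivity) (norm_evalZp_le_one G hz.le)).trans ?_
    refine (mul_le_of_le_one_left (by positivity) hp1).trans ?_
    exact pow_le_of_le_one (norm_nonneg _) hz.le two_ne_zero

variable {F : ℤ_[p]⟦X⟧} {π : ℕ → ℂ_[p]}

theorem IsTateGenerator.norm_le (hF : IsLubinTate p F) (hπ : IsTateGenerator p F π) {i m : ℕ}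
    (h : i ≤ m) : ‖π i‖ ≤ ‖π m‖ := by
  induction m, h using Nat.le_induction with
  | base => exact le_rfl
  | succ m _ ih =>
    refine ih.trans ?_
    rw [← hπ.eval_succ m]
    exact hF.norm_evalZp_le (hπ.norm_lt_one _)

theorem ghostComponent_varpi (π : ℕ → ℂ_[p]) (m n : ℕ) :
    WittVector.ghostComponent n (varpi p π m) = if n ≤ m then π (m - n) else 0 :=
  ghostComponent_ghostEquiv_symm _ n

theorem ghostComponent_varpi_succ (hF : IsLubinTate p F) (hπ : IsTateGenerator p F π) (m n : ℕ) :
    WittVector.ghostComponent (n + 1) (varpi p π m) =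
      evalZp p F (WittVector.ghostComponent n (varpi p π m)) := by
  rw [ghostComponent_varpi, ghostComponent_varpi]
  rcases lt_trichotomy n m with h | rfl | h
  · rw [if_pos (by omega), if_pos h.le, ← hπ.eval_succ]
    congr 2; omega
  · rw [if_neg (by omega), if_pos le_rfl, Nat.sub_self, hπ.eval_zero]
  · rw [if_neg (by omega), if_neg (by omega)]
    have := hF.norm_evalZp_le (z := (0 : ℂ_[p])) (by simp)
    rw [norm_zero] at this
    exact (norm_le_zero_iff.1 this).symm

theorem norm_ghostComponent_varpi_le (hF : IsLubinTate p F) (hπ : IsTateGenerator p F π)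
    (m n : ℕ) : ‖WittVector.ghostComponent n (varpi p π m)‖ ≤ ‖π m‖ := by
  rw [ghostComponent_varpi]
  split_ifs
  · exact hπ.norm_le hF (Nat.sub_le _ _)
  · simp

theorem varpi_coeff_zero (π : ℕ → ℂ_[p]) (m : ℕ) : (varpi p π m).coeff 0 = π m := by
  have h := pow_mul_coeff_eq (varpi p π m) 0
  rw [ghostComponent_varpi] at h
  simpa using h

/-- The Witt vectors `ϖ_m` have topologically nilpotent components. -/
theorem wittLE_varpi (hF : IsLubinTate p F) (hπ : IsTateGenerator p F π) (m : ℕ) :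
    WittLE ‖π m‖ (varpi p π m) := by
  obtain ⟨G, hG⟩ := hF.exists_evalZp_eq
  refine wittLE_of_iterates G (norm_nonneg _) (hπ.norm_lt_one m) (by rw [varpi_coeff_zero])
    fun k => ?_
  rw [ghostComponent_varpi_succ hF hπ, hG]
  exact (norm_ghostComponent_varpi_le hF hπ m k).trans_lt (hπ.norm_lt_one m)

theorem frobenius_varpi_succ (π : ℕ → ℂ_[p]) (m : ℕ) :
    WittVector.frobenius (varpi p π (m + 1)) = varpi p π m :=
  ext_ghostComponent fun n => by
    rw [WittVector.ghostComponent_frobenius, ghostComponent_varpi, ghostComponent_varpi]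
    simp

theorem frobenius_varpi_zero (π : ℕ → ℂ_[p]) : WittVector.frobenius (varpi p π 0) = 0 :=
  ext_ghostComponent fun n => by
    rw [WittVector.ghostComponent_frobenius, ghostComponent_varpi]
    simp

/-- The Witt vector with ghost components `(p x, 0, 0, …)` has components that decrease like
`‖x‖ ^ (p ^ i)`. -/
theorem norm_coeff_le_of_ghostComponent_single {c : WittVector p ℂ_[p]} {x : ℂ_[p]}
    (h0 : WittVector.ghostComponent 0 c = p * x)
    (h : ∀ n, WittVector.ghostComponent (n + 1) c = 0) (i : ℕ) :
    ‖c.coeff i‖ ≤ ‖(p : ℂ_[p])‖ * ‖x‖ ^ p ^ i := by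
  have hp0 := norm_prime_pos p
  have hp1 := (norm_prime_lt_one p).le
  induction i using Nat.strong_induction_on with
  | _ k ih =>
  refine le_of_mul_le_mul_left ?_ (pow_pos hp0 k)
  rw [norm_coeff_mul_eq]
  rcases Nat.eq_zero_or_pos k with rfl | hk
  · simp [h0]
  · obtain ⟨n, rfl⟩ : ∃ n, k = n + 1 := ⟨k - 1, by omega⟩
    rw [h n, zero_sub, norm_neg]
    refine norm_sum_le_of_le (by positivity) fun i hi => ?_
    rw [Finset.mem_range] at hi
    rw [norm_mul, norm_pow, norm_pow]
    have h1 := pow_le_pow_left₀ (norm_nonneg _) (ih i hi) (p ^ (n + 1 - i))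
    rw [mul_pow, ← pow_mul, ← pow_add p, Nat.add_sub_cancel' hi.le] at h1
    refine (mul_le_mul_of_nonneg_left h1 (by positivity)).trans ?_
    rw [← mul_assoc, ← mul_assoc, ← pow_add, ← pow_succ]
    refine mul_le_mul_of_nonneg_right (pow_le_pow_of_le_one hp0.le hp1 ?_) (by positivity)
    have : n + 1 - i < p ^ (n + 1 - i) := Nat.lt_pow_self hp.out.one_lt
    omega

/-- The Witt vector `ϖ_m - V ϖ_m` differs from a product of two vectors with topologically nilpotent
components, one of which is `ϖ_{m+1}`, by the vector with ghost components
`(p π_{m+1}, 0, 0, …)`. -/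
theorem exists_varpi_sub_verschiebung_eq (hF : IsLubinTate p F) (hπ : IsTateGenerator p F π)
    (m : ℕ) : ∃ A c : WittVector p ℂ_[p], WittLE ‖π (m + 1)‖ A ∧
      (∀ i, ‖c.coeff i‖ ≤ ‖π (m + 1)‖ ^ p ^ i) ∧
      varpi p π m - WittVector.verschiebung (varpi p π m) = varpi p π (m + 1) * A + c := by
  obtain ⟨G, hG⟩ := hF.exists_evalZp_eq
  set w := varpi p π (m + 1) with hw
  set r := ‖π (m + 1)‖ with hr
  have hr0 : 0 ≤ r := norm_nonneg _
  have hr1 : r < 1 := hπ.norm_lt_one _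
  have hwle : WittLE r w := wittLE_varpi hF hπ (m + 1)
  obtain ⟨a, ha⟩ : ∃ a, p = a + 2 := ⟨p - 2, by have := hp.out.two_le; omega⟩
  set g : ℕ → ℂ_[p] := fun k => WittVector.ghostComponent k w with hg
  -- By `F(g) = p g + g (g ^ (p - 1) + p g G(g))`, the ghost components of `A` are the cofactors of
  -- `g` in `F(g) - p g`.
  set A : WittVector p ℂ_[p] := (WittVector.ghostEquiv p ℂ_[p]).symm fun k =>
    g k ^ a * g k + p * g k * evalZp p G (g k) with hA
  set c : WittVector p ℂ_[p] := (WittVector.ghostEquiv p ℂ_[p]).symm fun k =>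
    if k = 0 then p * π (m + 1) else 0 with hc
  refine ⟨A, c, wittLE_of_forall_exists fun N => ?_, fun i => ?_, ext_ghostComponent fun k => ?_⟩
  · obtain ⟨γ, hγ, hγe⟩ := exists_ghostComponent_evalZp G hr0 hr1 hwle N
    refine ⟨w ^ a * w + p * w * γ, ?_, fun k hk => ?_⟩
    · refine WittLE.add hr0 hr1.le (((hwle.mono hr1.le).pow a).mul_left hr0 hr1.le hwle) ?_
      exact ((wittLE_natCast p).mul_left hr0 hr1.le hwle).mul_right hr0 hr1.le hγ
    · rw [hA, ghostComponent_ghostEquiv_symm, map_add, map_mul, map_mul, map_mul, map_pow,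
        hγe k hk, map_natCast]
  · refine (norm_coeff_le_of_ghostComponent_single (x := π (m + 1)) ?_ (fun n => ?_) i).trans
      (mul_le_of_le_one_left (by positivity) (norm_prime_lt_one p).le)
    · rw [hc, ghostComponent_ghostEquiv_symm, if_pos rfl]
    · rw [hc, ghostComponent_ghostEquiv_symm, if_neg n.succ_ne_zero]
  · have hstep : ∀ k, g (k + 1) = p * g k + g k ^ p + p * g k ^ 2 * evalZp p G (g k) := fun k => by
      rw [hg, ← hG _ ((norm_ghostComponent_varpi_le hF hπ _ k).trans_lt hr1), hw]
      exact ghostComponent_varpi_succ hF hπ (m + 1) k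
    have hshift : ∀ k, WittVector.ghostComponent k (varpi p π m) = g (k + 1) := fun k => by
      rw [← frobenius_varpi_succ, WittVector.ghostComponent_frobenius]
    have hpow : ∀ k, g k ^ p = g k * (g k ^ a * g k) := fun k => by
      calc g k ^ p = g k ^ (a + 2) := congrArg (g k ^ ·) ha
        _ = g k * (g k ^ a * g k) := by ring
    rw [map_sub, map_add, map_mul, hA, hc, ghostComponent_ghostEquiv_symm,
      ghostComponent_ghostEquiv_symm, hshift]
    change _ = g k * _ + _
    cases k with
    | zero =>
      have h0 : g 0 = π (m + 1) := by
        change WittVector.ghostComponent 0 w = _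
        rw [hw, ghostComponent_varpi]
        simp
      rw [WittVector.ghostComponent_zero_verschiebung, hstep, hpow, if_pos rfl, ← h0]
      ring
    | succ k =>
      rw [WittVector.ghostComponent_verschiebung, hshift, hstep (k + 1), hpow,
        if_neg k.succ_ne_zero]
      ring

/-- The Pulita exponential `E(ϖ_m)(X) / E(ϖ_m)(X ^ p)` converges on the closed unit disc. -/
theorem isNull_artinHasseE_varpi_sub (hF : IsLubinTate p F) (hπ : IsTateGenerator p F π) (m : ℕ) :
    IsNull (artinHasseE p (varpi p π m - WittVector.verschiebung (varpi p π m))) := by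
  obtain ⟨A, c, hA, hc, h⟩ := exists_varpi_sub_verschiebung_eq hF hπ m
  have hr1 := hπ.norm_lt_one (m + 1)
  have hw := wittLE_varpi hF hπ (m + 1)
  have hcle : ∀ i, ‖c.coeff i‖ ≤ 1 := fun i => (hc i).trans (pow_le_one₀ (norm_nonneg _) hr1.le)
  rw [h, artinHasseE_add]
  refine IsNull.mul (gaussLE_artinHasseE ((hw.mono hr1.le).mul_left zero_le_one le_rfl
    (hA.mono hr1.le))) (gaussLE_artinHasseE hcle) (isNull_artinHasseE_mul hr1 hw hA) ?_
  exact isNull_of_norm_coeff_le_pow (norm_nonneg _) hr1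
    (norm_coeff_artinHasseE_le_pow (norm_nonneg _) hc)

end LubinTate

/-! ### Convergence on the closed unit disc -/

section VerschiebungDifference

variable {p : ℕ} [hp : Fact p.Prime]

/-- The additive map `w ↦ w - V ^ s w` on Witt vectors; on the level of Artin-Hasse exponentials it
is the passage from `E(X)` to `E(X) / E(X ^ (p ^ s))`. -/
noncomputable def verschiebungDiff (s : ℕ) (w : WittVector p ℂ_[p]) : WittVector p ℂ_[p] :=
  w - WittVector.verschiebung^[s] w

theorem verschiebung_iterate_add {R : Type*} [CommRing R] (s : ℕ) (x y : WittVector p R) :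
    WittVector.verschiebung^[s] (x + y) =
      WittVector.verschiebung^[s] x + WittVector.verschiebung^[s] y :=
  iterate_map_add WittVector.verschiebung s x y

theorem verschiebungDiff_add (s : ℕ) (x y : WittVector p ℂ_[p]) :
    verschiebungDiff s (x + y) = verschiebungDiff s x + verschiebungDiff s y := by
  rw [verschiebungDiff, verschiebungDiff, verschiebungDiff, verschiebung_iterate_add]
  ring

theorem verschiebungDiff_verschiebung (s : ℕ) (x : WittVector p ℂ_[p]) :
    verschiebungDiff s (WittVector.verschiebung x) =
      WittVector.verschiebung (verschiebungDiff s x) := by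
  rw [verschiebungDiff, verschiebungDiff, map_sub, ← Function.iterate_succ_apply,
    Function.iterate_succ_apply']

theorem WittLE.verschiebung_iterate {r : ℝ} (hr : 0 ≤ r) {x : WittVector p ℂ_[p]} (hx : WittLE r x)
    (s : ℕ) : WittLE r (WittVector.verschiebung^[s] x) := by
  induction s with
  | zero => exact hx
  | succ s ih => rw [Function.iterate_succ_apply']; exact ih.verschiebung hr

theorem WittLE.verschiebungDiff {r : ℝ} (hr : 0 ≤ r) (hr1 : r ≤ 1) {x : WittVector p ℂ_[p]}
    (hx : WittLE r x) (s : ℕ) : WittLE r (verschiebungDiff s x) :=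
  hx.sub hr hr1 (hx.verschiebung_iterate hr s)

theorem verschiebungDiff_succ (s : ℕ) (x : WittVector p ℂ_[p]) :
    verschiebungDiff (s + 1) x = verschiebungDiff s x +
      WittVector.verschiebung^[s] (x - WittVector.verschiebung x) := by
  rw [verschiebungDiff, verschiebungDiff, Function.iterate_succ_apply,
    iterate_map_sub (WittVector.verschiebung (p := p) (R := ℂ_[p]))]
  ring

theorem artinHasseE_verschiebungDiff_eq_prod (s : ℕ) (x : WittVector p ℂ_[p]) :
    artinHasseE p (verschiebungDiff s x) = ∏ i ∈ Finset.range s,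
      PowerSeries.expand (p ^ i) (pow_ne_zero i hp.out.ne_zero)
        (artinHasseE p (x - WittVector.verschiebung x)) := by
  induction s with
  | zero => simp [verschiebungDiff, artinHasseE_zero]
  | succ s ih =>
    rw [verschiebungDiff_succ, artinHasseE_add, ih, Finset.prod_range_succ,
      artinHasseE_verschiebung_iterate]

theorem verschiebung_mul_teichmuller (s : ℕ) (x : WittVector p ℂ_[p]) (c : ℂ_[p]) :
    WittVector.verschiebung^[s] (x * WittVector.teichmuller p (c ^ p ^ s)) =
      WittVector.verschiebung^[s] x * WittVector.teichmuller p c := by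
  induction s generalizing x c with
  | zero => simp
  | succ s ih =>
    rw [Function.iterate_succ_apply, Function.iterate_succ_apply, ← ih,
      ← WittVector.verschiebung_mul_frobenius, frobenius_teichmuller, ← pow_mul, pow_succ]

theorem verschiebungDiff_mul_teichmuller {s : ℕ} {c : ℂ_[p]} (hc : c ^ p ^ s = c)
    (x : WittVector p ℂ_[p]) :
    verschiebungDiff s (x * WittVector.teichmuller p c) =
      WittVector.teichmuller p c * verschiebungDiff s x := by
  rw [verschiebungDiff, verschiebungDiff, mul_comm (WittVector.teichmuller p c), sub_mul,
    ← verschiebung_mul_teichmuller, hc]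

theorem norm_le_one_of_pow_eq {s : ℕ} (hs : s ≠ 0) {c : ℂ_[p]} (hc : c ^ p ^ s = c) : ‖c‖ ≤ 1 := by
  by_contra h
  rw [not_le] at h
  have h1 : ‖c‖ ^ p ^ s = ‖c‖ := by rw [← norm_pow, hc]
  have h2 : ‖c‖ ^ 1 < ‖c‖ ^ p ^ s := pow_lt_pow_right₀ h (Nat.one_lt_pow hs hp.out.one_lt)
  rw [h1, pow_one] at h2
  exact lt_irrefl _ h2

variable {F : ℤ_[p]⟦X⟧} {π : ℕ → ℂ_[p]}

theorem isNull_artinHasseE_verschiebungDiff_varpi (hF : IsLubinTate p F)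
    (hπ : IsTateGenerator p F π) (m s : ℕ) :
    IsNull (artinHasseE p (verschiebungDiff s (varpi p π m))) := by
  have hw := (wittLE_varpi hF hπ m).mono (hπ.norm_lt_one m).le
  have hd : WittLE 1 (varpi p π m - WittVector.verschiebung (varpi p π m)) :=
    hw.sub zero_le_one le_rfl (hw.verschiebung zero_le_one)
  induction s with
  | zero =>
    rw [verschiebungDiff, Function.iterate_zero, id, sub_self, artinHasseE_zero]
    exact isNull_of_norm_coeff_le_pow le_rfl zero_lt_one fun n => by
      rw [coeff_one]; split_ifs with h <;> simp [h]
  | succ s ih =>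
    rw [verschiebungDiff_succ, artinHasseE_add]
    refine IsNull.mul (gaussLE_artinHasseE (hw.verschiebungDiff zero_le_one le_rfl s))
      (gaussLE_artinHasseE (hd.verschiebung_iterate zero_le_one s)) ih ?_
    rw [artinHasseE_verschiebung_iterate _ _ (pow_ne_zero s hp.out.ne_zero)]
    exact (isNull_artinHasseE_varpi_sub hF hπ m).expand _ _

/-- Convergence on the closed unit disc for Witt vectors whose components are zero or
`(p ^ s - 1)`-st roots of unity. -/
theorem isNull_artinHasseE_verschiebungDiff_mul (hF : IsLubinTate p F)
    (hπ : IsTateGenerator p F π) {s : ℕ} (hs : s ≠ 0) (m : ℕ) {y : WittVector p ℂ_[p]}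
    (hy : ∀ i, y.coeff i ^ p ^ s = y.coeff i) :
    IsNull (artinHasseE p (verschiebungDiff s (varpi p π m * y))) := by
  have hwle : ∀ m, WittLE 1 (varpi p π m) := fun m =>
    (wittLE_varpi hF hπ m).mono (hπ.norm_lt_one m).le
  have hsplit : ∀ m (y : WittVector p ℂ_[p]), varpi p π m * y =
      varpi p π m * WittVector.teichmuller p (y.coeff 0) +
        WittVector.verschiebung (WittVector.frobenius (varpi p π m) * y.shift 1) := fun m y => by
    conv_lhs => rw [← teichmuller_add_verschiebung_shift y]
    rw [mul_add, mul_comm (WittVector.frobenius _), WittVector.verschiebung_mul_frobenius,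
      mul_comm (WittVector.verschiebung _)]
  have hhead : ∀ m {c : ℂ_[p]}, c ^ p ^ s = c → IsNull (artinHasseE p (verschiebungDiff s
      (varpi p π m * WittVector.teichmuller p c))) := fun m c hc => by
    rw [verschiebungDiff_mul_teichmuller hc, artinHasseE_teichmuller_mul]
    exact (isNull_artinHasseE_verschiebungDiff_varpi hF hπ m s).rescale
      (norm_le_one_of_pow_eq hs hc)
  induction m generalizing y with
  | zero =>
    rw [hsplit, frobenius_varpi_zero, zero_mul, map_zero, add_zero]
    exact hhead 0 (hy 0)
  | succ m ih =>
    have hysh : ∀ i, (y.shift 1).coeff i ^ p ^ s = (y.shift 1).coeff i := fun i => by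
      rw [WittVector.shift_coeff]; exact hy _
    rw [hsplit, frobenius_varpi_succ, verschiebungDiff_add, artinHasseE_add,
      verschiebungDiff_verschiebung, artinHasseE_verschiebung]
    have h2 : WittLE 1 (varpi p π m * y.shift 1) :=
      (hwle m).mul_left zero_le_one le_rfl fun i => norm_le_one_of_pow_eq hs (hysh i)
    have h3 : WittLE 1 (varpi p π (m + 1) * WittVector.teichmuller p (y.coeff 0)) :=
      (hwle _).mul_left zero_le_one le_rfl
        (wittLE_teichmuller zero_le_one (norm_le_one_of_pow_eq hs (hy 0)))
    exact IsNull.mul (gaussLE_artinHasseE (h3.verschiebungDiff zero_le_one le_rfl s))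
      ((gaussLE_artinHasseE (h2.verschiebungDiff zero_le_one le_rfl s)).expand zero_le_one _ _)
      (hhead _ (hy 0)) ((ih hysh).expand _ _)

end VerschiebungDifference

/-! ### The Pulita exponential modulo the square of the first torsion point -/

section Nontriviality

variable {p : ℕ} [hp : Fact p.Prime]

theorem coeff_zero_artinHasse : coeff 0 (artinHasse p) = 1 := by
  rw [coeff_zero_eq_constantCoeff_apply, (isGhostExp_artinHasse p).1]

theorem coeff_one_artinHasse : coeff 1 (artinHasse p) = 1 := by
  have h := congrArg (coeff 1) (isGhostExp_artinHasse p).2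
  have h1 : coeff 1 (ghostSeries p (1 : ℕ → ℂ_[p])) = 1 := by
    simpa using coeff_ghostSeries_pow hp.out.one_lt (1 : ℕ → ℂ_[p]) 0
  have h0 : coeff 0 (ghostSeries p (1 : ℕ → ℂ_[p])) = 0 :=
    coeff_ghostSeries_of_forall_ne _ fun k => (pow_ne_zero k hp.out.ne_zero).symm
  rw [coeff_X_mul_derivative, coeff_mul, Finset.Nat.antidiagonal_succ] at h
  simpa [h0, h1, (isGhostExp_artinHasse p).1] using h

variable {F : ℤ_[p]⟦X⟧} {π : ℕ → ℂ_[p]}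

/-- A nonzero zero of a Lubin-Tate series satisfies `‖π₀‖ ^ (p - 1) = ‖p‖`. -/
theorem norm_prime_eq_pow (hF : IsLubinTate p F) (hπ : IsTateGenerator p F π) :
    ‖(p : ℂ_[p])‖ = ‖π 0‖ ^ (p - 1) := by
  obtain ⟨G, hG⟩ := hF.exists_evalZp_eq
  have hlt := hπ.norm_lt_one 0
  have h0 := hπ.eval_zero
  rw [hG _ hlt, ← mul_pow_sub_one hp.out.ne_zero (π 0)] at h0
  have h1 : π 0 * (p * (1 + π 0 * evalZp p G (π 0)) + π 0 ^ (p - 1)) = 0 := by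
    rw [← h0]; ring
  have h2 := (mul_eq_zero.1 h1).resolve_left hπ.ne_zero
  have h3 : ‖π 0 * evalZp p G (π 0)‖ < 1 := by
    rw [norm_mul]
    exact (mul_le_of_le_one_right (norm_nonneg _) (norm_evalZp_le_one G hlt.le)).trans_lt hlt
  have h4 : ‖1 + π 0 * evalZp p G (π 0)‖ = 1 := by
    have := IsUltrametricDist.norm_add_eq_max_of_norm_ne_norm
      (x := (1 : ℂ_[p])) (y := π 0 * evalZp p G (π 0)) (by rw [norm_one]; exact h3.ne')
    rw [this, norm_one, max_eq_left h3.le]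
  rw [← norm_pow, eq_neg_of_add_eq_zero_right h2, norm_neg, norm_mul, h4, mul_one]

theorem mul_add_two_le_pow (a : ℕ) {k : ℕ} (hk : 2 ≤ k) : (a + 1) * k + 2 ≤ (a + 2) ^ k := by
  induction k, hk using Nat.le_induction with
  | base => nlinarith
  | succ k _ ih =>
    rw [pow_succ]
    nlinarith [Nat.mul_le_mul_right (a + 2) ih, Nat.zero_le (a * a * k), Nat.zero_le (a * k)]

theorem mul_add_two_le_two_mul_pow (a : ℕ) (j : ℕ) : (a + 1) * j + 2 ≤ 2 * (a + 2) ^ j := by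
  induction j with
  | zero => simp
  | succ j ih =>
    rw [pow_succ]
    nlinarith [Nat.mul_le_mul_right (a + 2) ih, Nat.zero_le (a * a * j), Nat.zero_le (a * j)]

/-- The components of positive index of `ϖ₀ - V ϖ₀`, whose ghost components are
`(π₀, -p π₀, 0, …)`, are divisible by `π₀²`. -/
theorem norm_coeff_varpi_zero_sub_le (hF : IsLubinTate p F) (hπ : IsTateGenerator p F π) {k : ℕ}
    (hk : 1 ≤ k) :
    ‖(varpi p π 0 - WittVector.verschiebung (varpi p π 0)).coeff k‖ ≤ ‖π 0‖ ^ 2 := by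
  set e := varpi p π 0 - WittVector.verschiebung (varpi p π 0) with he
  obtain ⟨a, ha⟩ : ∃ a, p = a + 2 := ⟨p - 2, by have := hp.out.two_le; omega⟩
  have hP1 := (hπ.norm_lt_one 0).le
  have hpn : ‖(p : ℂ_[p])‖ = ‖π 0‖ ^ (a + 1) := by
    rw [norm_prime_eq_pow hF hπ]; congr 1; omega
  have hppow : ∀ j, p ^ j = (a + 2) ^ j := fun j => congrArg (· ^ j) ha
  have hp0 := norm_prime_pos p
  have g1 : WittVector.ghostComponent 1 e = - (p * π 0) := by
    rw [he, map_sub, WittVector.ghostComponent_verschiebung, ghostComponent_varpi,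
      ghostComponent_varpi]
    simp
  have g2 : ∀ n, WittVector.ghostComponent (n + 2) e = 0 := fun n => by
    rw [he, map_sub, WittVector.ghostComponent_verschiebung, ghostComponent_varpi,
      ghostComponent_varpi]
    simp
  have e0 : e.coeff 0 = π 0 := by
    have h := pow_mul_coeff_eq e 0
    rw [he, map_sub, WittVector.ghostComponent_zero_verschiebung, ghostComponent_varpi] at h
    simpa using h
  induction k using Nat.strong_induction_on with
  | _ k ih =>
  refine le_of_mul_le_mul_left ?_ (pow_pos hp0 k)
  rw [norm_coeff_mul_eq]
  rcases hk.eq_or_lt with rfl | hk2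
  · obtain ⟨G, hG⟩ := hF.exists_evalZp_eq
    have h0 := hπ.eval_zero
    rw [hG _ (hπ.norm_lt_one 0)] at h0
    have h1 : WittVector.ghostComponent 1 e -
        ∑ i ∈ Finset.range 1, (p : ℂ_[p]) ^ i * e.coeff i ^ p ^ (1 - i) =
        p * π 0 ^ 2 * evalZp p G (π 0) := by
      rw [g1, Finset.sum_range_one, e0]
      simp only [pow_zero, one_mul, Nat.sub_zero, pow_one]
      linear_combination -h0
    rw [h1, norm_mul, norm_mul, norm_pow, pow_one]
    exact mul_le_of_le_one_right (by positivity) (norm_evalZp_le_one G hP1)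
  · obtain ⟨n, rfl⟩ : ∃ n, k = n + 2 := ⟨k - 2, by omega⟩
    rw [g2, zero_sub, norm_neg, hpn]
    refine norm_sum_le_of_le (by positivity) fun i hi => ?_
    rw [Finset.mem_range] at hi
    rw [norm_mul, norm_pow, norm_pow, hpn]
    rcases Nat.eq_zero_or_pos i with rfl | hi0
    · rw [e0, pow_zero, one_mul, ← pow_mul, ← pow_add]
      refine pow_le_pow_of_le_one (norm_nonneg _) hP1 ?_
      rw [hppow]
      exact mul_add_two_le_pow a (by omega)
    · have h1 := pow_le_pow_left₀ (norm_nonneg _) (ih i hi hi0) (p ^ (n + 2 - i))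
      refine (mul_le_mul_of_nonneg_left h1 (by positivity)).trans ?_
      rw [← pow_mul, ← pow_mul, ← pow_mul, ← pow_add, ← pow_add]
      refine pow_le_pow_of_le_one (norm_nonneg _) hP1 ?_
      have h2 := mul_add_two_le_two_mul_pow a (n + 2 - i)
      have h3 : (a + 1) * (n + 2) = (a + 1) * i + (a + 1) * (n + 2 - i) := by
        rw [← mul_add, Nat.add_sub_cancel' hi.le]
      rw [hppow, h3]
      omega

/-- The Pulita exponential of `ϖ₀` is `1 + π₀ X` up to multiples of `π₀²`. -/
theorem gaussLE_artinHasseE_varpi_zero_sub (hF : IsLubinTate p F) (hπ : IsTateGenerator p F π) :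
    GaussLE (‖π 0‖ ^ 2)
      (artinHasseE p (varpi p π 0 - WittVector.verschiebung (varpi p π 0)) -
        (1 + PowerSeries.monomial 1 (π 0))) := by
  set e := varpi p π 0 - WittVector.verschiebung (varpi p π 0) with he
  have hP1 := (hπ.norm_lt_one 0).le
  have hw := (wittLE_varpi hF hπ 0).mono hP1
  have hele : ∀ i, ‖e.coeff i‖ ≤ 1 := hw.sub zero_le_one le_rfl (hw.verschiebung zero_le_one)
  have e0 : e.coeff 0 = π 0 := by
    have h := pow_mul_coeff_eq e 0
    rw [he, map_sub, WittVector.ghostComponent_zero_verschiebung, ghostComponent_varpi] at h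
    simpa using h
  intro n
  have h1 := norm_coeff_artinHasseE_sub_le (sq_nonneg ‖π 0‖) 1 hele
    (fun i hi => norm_coeff_varpi_zero_sub_le hF hπ hi) n (by omega)
  rw [Finset.prod_range_one] at h1
  have h2 : ‖coeff n (comp p (artinHasse p) (PowerSeries.C (e.coeff 0) * PowerSeries.X ^ p ^ 0) -
      (1 + PowerSeries.monomial 1 (π 0)))‖ ≤ ‖π 0‖ ^ 2 := by
    rw [map_sub, coeff_artinHasse_factor, e0, map_add, coeff_one, coeff_monomial]
    simp only [pow_zero, one_dvd, if_true, Nat.div_one]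
    rcases n with _ | _ | n
    · rw [coeff_zero_artinHasse]; simp
    · rw [zero_add, coeff_one_artinHasse]; simp
    · rw [if_neg (by omega), if_neg (by omega), add_zero, sub_zero, norm_mul, norm_pow]
      refine (mul_le_of_le_one_right (by positivity) (norm_coeff_artinHasse_le_one p _)).trans ?_
      exact pow_le_pow_of_le_one (norm_nonneg _) hP1 (by omega)
  have h3 := norm_add_le_of_le h1 h2
  rwa [← map_add, sub_add_sub_cancel] at h3

theorem norm_evalAt_varpi_zero_sub_le (hF : IsLubinTate p F) (hπ : IsTateGenerator p F π)
    {z : ℂ_[p]} (hz : ‖z‖ ≤ 1) :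
    ‖evalAt (artinHasseE p (varpi p π 0 - WittVector.verschiebung (varpi p π 0))) z -
      (1 + π 0 * z)‖ ≤ ‖π 0‖ ^ 2 := by
  have hG := gaussLE_artinHasseE_varpi_zero_sub hF hπ
  set f := artinHasseE p (varpi p π 0 - WittVector.verschiebung (varpi p π 0)) with hf
  have h1 : ConvergesAt (1 : ℂ_[p]⟦X⟧) z := by simpa using convergesAt_monomial 1 z 0
  have h2 : ConvergesAt (1 + PowerSeries.monomial 1 (π 0)) z := by
    have := Summable.add h1 (convergesAt_monomial (π 0) z 1)
    simpa only [ConvergesAt, map_add, add_mul] using this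
  have h3 : ConvergesAt f z := (isNull_artinHasseE_varpi_sub hF hπ 0).convergesAt hz
  have h4 : ConvergesAt (f - (1 + PowerSeries.monomial 1 (π 0))) z := by
    have := Summable.sub h3 h2
    simpa only [ConvergesAt, map_sub, sub_mul] using this
  have h5 : evalAt f z = evalAt (f - (1 + PowerSeries.monomial 1 (π 0))) z + (1 + π 0 * z) := by
    conv_lhs => rw [← sub_add_cancel f (1 + PowerSeries.monomial 1 (π 0))]
    rw [evalAt_add h4 h2, evalAt_add h1 (convergesAt_monomial _ _ _), evalAt_one, evalAt_monomial,
      pow_one]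
  rw [h5, add_sub_cancel_right]
  exact norm_evalAt_le (sq_nonneg _) hG hz

theorem norm_prod_sub_one_add_le {ι : Type*} (S : Finset ι) {x u : ι → ℂ_[p]} {c : ℂ_[p]}
    (hc : ‖c‖ ≤ 1) (hu : ∀ i ∈ S, ‖u i‖ ≤ 1)
    (hx : ∀ i ∈ S, ‖x i - (1 + c * u i)‖ ≤ ‖c‖ ^ 2) :
    ‖∏ i ∈ S, x i - (1 + c * ∑ i ∈ S, u i)‖ ≤ ‖c‖ ^ 2 := by
  classical
  have hc2 : ‖c‖ ^ 2 ≤ 1 := pow_le_one₀ (norm_nonneg _) hc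
  induction S using Finset.induction_on with
  | empty => simp
  | insert a S ha ih =>
    rw [Finset.prod_insert ha, Finset.sum_insert ha]
    have ih' := ih (fun i hi => hu i (Finset.mem_insert_of_mem hi))
      (fun i hi => hx i (Finset.mem_insert_of_mem hi))
    have hua := hu a (Finset.mem_insert_self _ _)
    have hxa := hx a (Finset.mem_insert_self _ _)
    have hS : ‖∑ i ∈ S, u i‖ ≤ 1 :=
      norm_sum_le_of_le zero_le_one fun i hi => hu i (Finset.mem_insert_of_mem hi)
    have h1 : ∀ {v : ℂ_[p]}, ‖v‖ ≤ 1 → ‖1 + c * v‖ ≤ 1 := fun {v} hv =>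
      norm_add_le_of_le (by simp) (by rw [norm_mul]; exact mul_le_one₀ hc (norm_nonneg _) hv)
    have h2 : ‖x a‖ ≤ 1 := by
      have := norm_add_le_of_le (hxa.trans hc2) (h1 hua)
      rwa [sub_add_cancel] at this
    have h3 : x a * ∏ i ∈ S, x i - (1 + c * (u a + ∑ i ∈ S, u i)) =
        x a * (∏ i ∈ S, x i - (1 + c * ∑ i ∈ S, u i)) +
          ((1 + c * ∑ i ∈ S, u i) * (x a - (1 + c * u a)) + c ^ 2 * (u a * ∑ i ∈ S, u i)) := by
      ring
    rw [h3]
    refine norm_add_le_of_le ?_ (norm_add_le_of_le ?_ ?_)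
    · rw [norm_mul]; exact (mul_le_of_le_one_left (norm_nonneg _) h2).trans ih'
    · rw [norm_mul]; exact (mul_le_of_le_one_left (norm_nonneg _) (h1 hS)).trans hxa
    · rw [norm_mul, norm_mul, norm_pow]
      exact mul_le_of_le_one_right (sq_nonneg _) (mul_le_one₀ hua (norm_nonneg _) hS)

theorem convergesAt_prod {ι : Type*} (S : Finset ι) {f : ι → ℂ_[p]⟦X⟧} {z : ℂ_[p]}
    (hf : ∀ i ∈ S, ConvergesAt (f i) z) :
    ConvergesAt (∏ i ∈ S, f i) z ∧ evalAt (∏ i ∈ S, f i) z = ∏ i ∈ S, evalAt (f i) z := by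
  classical
  induction S using Finset.induction_on with
  | empty =>
    refine ⟨?_, by simpa using evalAt_one z⟩
    simpa using convergesAt_monomial 1 z 0
  | insert a S ha ih =>
    obtain ⟨h1, h2⟩ := ih fun i hi => hf i (Finset.mem_insert_of_mem hi)
    have h3 := hf a (Finset.mem_insert_self _ _)
    rw [Finset.prod_insert ha, Finset.prod_insert ha]
    exact ⟨h3.mul h1, by rw [evalAt_mul h3 h1, h2]⟩

theorem frobenius_iterate_varpi (π : ℕ → ℂ_[p]) (m : ℕ) :
    WittVector.frobenius^[m] (varpi p π m) = varpi p π 0 := by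
  induction m with
  | zero => rfl
  | succ m ih => rw [Function.iterate_succ_apply, frobenius_varpi_succ, ih]

/-- The value of the generalized Pulita exponential at a Witt vector concentrated in degree `m`. -/
theorem evalAt_artinHasseE_verschiebungDiff_top (hF : IsLubinTate p F)
    (hπ : IsTateGenerator p F π) {s : ℕ} (m : ℕ) {ζ t : ℂ_[p]} (hζ : ζ ^ p ^ s = ζ)
    (hζ1 : ‖ζ‖ ≤ 1) (ht1 : ‖t‖ ≤ 1) :
    evalAt (artinHasseE p (verschiebungDiff s (varpi p π m *
      WittVector.verschiebung^[m] (WittVector.teichmuller p ζ)))) t =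
    ∏ i ∈ Finset.range s,
      evalAt (artinHasseE p (varpi p π 0 - WittVector.verschiebung (varpi p π 0)))
        ((ζ * t ^ p ^ m) ^ p ^ i) := by
  have h1 : varpi p π m * WittVector.verschiebung^[m] (WittVector.teichmuller p ζ) =
      WittVector.verschiebung^[m] (varpi p π 0 * WittVector.teichmuller p ζ) := by
    rw [mul_comm, WittVector.iterate_verschiebung_mul_left, frobenius_iterate_varpi, mul_comm]
  have h2 : ∀ x : WittVector p ℂ_[p], verschiebungDiff s (WittVector.verschiebung^[m] x) =
      WittVector.verschiebung^[m] (verschiebungDiff s x) := fun x => by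
    rw [verschiebungDiff, verschiebungDiff,
      iterate_map_sub (WittVector.verschiebung (p := p) (R := ℂ_[p])),
      ← Function.iterate_add_apply, ← Function.iterate_add_apply, add_comm]
  have hz : ‖ζ * t ^ p ^ m‖ ≤ 1 := by
    rw [norm_mul, norm_pow]
    exact mul_le_one₀ hζ1 (by positivity) (pow_le_one₀ (norm_nonneg _) ht1)
  rw [h1, h2, artinHasseE_verschiebung_iterate _ _ (pow_ne_zero m hp.out.ne_zero), evalAt_expand,
    verschiebungDiff_mul_teichmuller hζ, artinHasseE_teichmuller_mul, evalAt_rescale,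
    artinHasseE_verschiebungDiff_eq_prod, (convergesAt_prod _ fun i _ => ?_).2]
  · exact Finset.prod_congr rfl fun i _ => evalAt_expand _ _ _ _
  · exact ((isNull_artinHasseE_varpi_sub hF hπ 0).expand _ _).convergesAt hz

theorem evalAt_artinHasseE_verschiebungDiff_top_ne_one (hF : IsLubinTate p F)
    (hπ : IsTateGenerator p F π) {s : ℕ} (m : ℕ) {ζ t : ℂ_[p]} (hζ : ζ ^ p ^ s = ζ)
    (hζ1 : ‖ζ‖ ≤ 1) (ht1 : ‖t‖ ≤ 1)
    (hsum : ‖∑ i ∈ Finset.range s, (ζ * t ^ p ^ m) ^ p ^ i‖ = 1) :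
    evalAt (artinHasseE p (verschiebungDiff s (varpi p π m *
      WittVector.verschiebung^[m] (WittVector.teichmuller p ζ)))) t ≠ 1 := by
  have hz : ‖ζ * t ^ p ^ m‖ ≤ 1 := by
    rw [norm_mul, norm_pow]
    exact mul_le_one₀ hζ1 (by positivity) (pow_le_one₀ (norm_nonneg _) ht1)
  have hzi : ∀ i : ℕ, ‖(ζ * t ^ p ^ m) ^ p ^ i‖ ≤ 1 := fun i => by
    rw [norm_pow]; exact pow_le_one₀ (norm_nonneg _) hz
  rw [evalAt_artinHasseE_verschiebungDiff_top hF hπ m hζ hζ1 ht1]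
  intro h
  have h1 := norm_prod_sub_one_add_le (Finset.range s) (hπ.norm_lt_one 0).le
    (fun i _ => hzi i) fun i _ => norm_evalAt_varpi_zero_sub_le hF hπ (hzi i)
  rw [h, sub_add_cancel_left, norm_neg, norm_mul, hsum, mul_one] at h1
  have h2 : 0 < ‖π 0‖ := norm_pos_iff.2 hπ.ne_zero
  have h3 := hπ.norm_lt_one 0
  nlinarith

end Nontriviality

/-! ### The reduction map -/

section Reduction

variable {p : ℕ} [hp : Fact p.Prime]

theorem norm_coeff_minpoly_lt_one {z : ℂ_[p]} (hz : IsAlgebraic ℚ_[p] z) (hz1 : ‖z‖ < 1) {n : ℕ}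
    (hn : n < (minpoly ℚ_[p] z).natDegree) : ‖(minpoly ℚ_[p] z).coeff n‖ < 1 := by
  have halg : Algebra.IsAlgebraic ℚ_[p] (IntermediateField.adjoin ℚ_[p] {z}) :=
    IntermediateField.isAlgebraic_adjoin_simple hz.isIntegral
  have h1 := NormedAlgebra.norm_eq_spectralNorm ℚ_[p]
    (IntermediateField.AdjoinSimple.gen ℚ_[p] z)
  rw [spectralNorm, IntermediateField.minpoly_gen] at h1
  have h2 : ‖IntermediateField.AdjoinSimple.gen ℚ_[p] z‖ = ‖z‖ := rfl
  have h3 := le_ciSup (spectralValueTerms_bddAbove (minpoly ℚ_[p] z)) n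
  rw [← spectralValue, ← h1, h2, spectralValueTerms_of_lt_natDegree _ hn] at h3
  by_contra h
  rw [not_lt] at h
  have h4 : (1 : ℝ) ≤ ‖(minpoly ℚ_[p] z).coeff n‖ ^
      (1 / ((minpoly ℚ_[p] z).natDegree - n : ℝ)) := by
    refine Real.one_le_rpow h (one_div_nonneg.2 (sub_nonneg.2 ?_))
    exact_mod_cast hn.le
  linarith

/-- An algebraic element of norm less than `1` has a power that is divisible by `p`, with a quotient
in `ℤ_p[z]`. -/
theorem exists_pow_eq_prime_mul {z : ℂ_[p]} (hz : IsAlgebraic ℚ_[p] z) (hz1 : ‖z‖ < 1)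
    (S : Subalgebra ℤ_[p] ℂ_[p]) (hzS : z ∈ S) : ∃ n, ∃ y ∈ S, z ^ n = p * y := by
  set f := minpoly ℚ_[p] z with hf
  have hmonic : f.Monic := minpoly.monic hz.isIntegral
  have hex : ∀ n, ∃ b : ℤ_[p], n < f.natDegree → f.coeff n = p * b := fun n => by
    by_cases hn : n < f.natDegree
    · have h1 := norm_coeff_minpoly_lt_one hz hz1 hn
      obtain ⟨b, hb⟩ := (PadicInt.norm_lt_one_iff_dvd ⟨f.coeff n, h1.le⟩).1 h1
      exact ⟨b, fun _ => by simpa using congrArg (fun x : ℤ_[p] => (x : ℚ_[p])) hb⟩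
    · exact ⟨0, fun h => absurd h hn⟩
  choose b hb using hex
  refine ⟨f.natDegree, - ∑ n ∈ Finset.range f.natDegree, algebraMap ℤ_[p] ℂ_[p] (b n) * z ^ n,
    neg_mem (sum_mem fun n _ => mul_mem (S.algebraMap_mem _) (pow_mem hzS n)), ?_⟩
  have h0 : Polynomial.aeval z f = 0 := minpoly.aeval _ _
  rw [Polynomial.aeval_eq_sum_range, Finset.sum_range_succ, hmonic.coeff_natDegree, one_smul] at h0
  rw [mul_neg, Finset.mul_sum, eq_neg_iff_add_eq_zero, add_comm, ← h0]
  congr 1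
  refine Finset.sum_congr rfl fun n hn => ?_
  rw [hb n (Finset.mem_range.1 hn), Algebra.smul_def, map_mul, map_natCast, mul_assoc,
    IsScalarTower.algebraMap_apply ℤ_[p] ℚ_[p] ℂ_[p]]
  rfl

/-- A ring homomorphism to a field of characteristic `p` kills the algebraic elements of norm less
than one, as these have a power divisible by `p`. -/
theorem map_eq_zero_of_norm_lt_one {k : Type*} [Field k] [CharP k p] {S : Subalgebra ℤ_[p] ℂ_[p]}
    (f : S →+* k) {x : S} (hx : IsAlgebraic ℚ_[p] (x : ℂ_[p])) (hx1 : ‖(x : ℂ_[p])‖ < 1) :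
    f x = 0 := by
  obtain ⟨n, y, hy, h⟩ := exists_pow_eq_prime_mul hx hx1 S x.2
  have h1 : x ^ n = (p : S) * ⟨y, hy⟩ := Subtype.ext (by simpa using h)
  have h2 := congrArg f h1
  rw [map_pow, map_mul, map_natCast, CharP.cast_eq_zero, zero_mul] at h2
  exact eq_zero_of_pow_eq_zero h2

variable {F : ℤ_[p]⟦X⟧} {s : ℕ}

theorem pow_card_of_mem_mu {z : ℂ_[p]} (hz : z ∈ mu p s) : z ^ p ^ s = z := by
  have h : z ^ (p ^ s - 1) = 1 := hz
  rw [← Nat.sub_add_cancel (Nat.pow_pos hp.out.pos : 1 ≤ p ^ s), pow_succ, h, one_mul]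

theorem mem_Zmu_of_pow_eq {z : ℂ_[p]} (hz : z ^ p ^ s = z) : z ∈ Zmu p s := by
  rcases eq_or_ne z 0 with rfl | h0
  · exact zero_mem _
  · refine Algebra.subset_adjoin (mul_left_cancel₀ h0 ?_ : z ^ (p ^ s - 1) = 1)
    rw [← pow_succ', Nat.sub_add_cancel (Nat.pow_pos hp.out.pos : 1 ≤ p ^ s), hz, mul_one]

theorem isAlgebraic_of_mem_mu (hs : s ≠ 0) {z : ℂ_[p]} (hz : z ∈ mu p s) :
    IsAlgebraic ℚ_[p] z := by
  have h : z ^ (p ^ s - 1) = 1 := hz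
  have hpos : 0 < p ^ s - 1 := Nat.sub_pos_of_lt (Nat.one_lt_pow hs hp.out.one_lt)
  exact IsAlgebraic.of_pow hpos (h ▸ isAlgebraic_one)

theorem isAlgebraic_of_mem_Omu (hs : s ≠ 0) {x : ℂ_[p]} (hx : x ∈ Omu p F s) :
    IsAlgebraic ℚ_[p] x := by
  induction hx using Algebra.adjoin_induction with
  | mem x hx =>
    rcases hx with hx | hx
    · exact hx.1
    · exact isAlgebraic_of_mem_mu hs hx
  | algebraMap r =>
    rw [IsScalarTower.algebraMap_apply ℤ_[p] ℚ_[p] ℂ_[p]]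
    exact isAlgebraic_algebraMap _
  | add x y _ _ hx hy => exact hx.add hy
  | mul x y _ _ hx hy => exact hx.mul hy

theorem norm_le_one_of_mem_Omu (hs : s ≠ 0) {x : ℂ_[p]} (hx : x ∈ Omu p F s) : ‖x‖ ≤ 1 := by
  induction hx using Algebra.adjoin_induction with
  | mem x hx =>
    rcases hx with hx | hx
    · exact hx.2.1.le
    · exact norm_le_one_of_pow_eq hs (pow_card_of_mem_mu hx)
  | algebraMap r => rw [norm_algebraMap_padicInt]; exact r.norm_le_one
  | add x y _ _ hx hy => exact norm_add_le_of_le hx hy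
  | mul x y _ _ hx hy => rw [norm_mul]; exact mul_le_one₀ hx (norm_nonneg _) hy

theorem norm_padicInt_pow_sub_lt_one (r : ℤ_[p]) : ‖r ^ p ^ s - r‖ < 1 := by
  rw [PadicInt.norm_lt_one_iff_dvd, ← Ideal.mem_span_singleton, ← PadicInt.maximalIdeal_eq_span_p,
    ← PadicInt.ker_toZMod, RingHom.mem_ker, map_sub, map_pow, ZMod.pow_card_pow, sub_self]

/-- The residue field of `𝓞[μ_{q-1}]` is contained in `𝔽_q`. -/
theorem norm_pow_sub_lt_one_of_mem_Omu (hs : s ≠ 0) {x : ℂ_[p]} (hx : x ∈ Omu p F s) :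
    ‖x ^ p ^ s - x‖ < 1 := by
  have hq : p ^ s ≠ 0 := pow_ne_zero s hp.out.ne_zero
  induction hx using Algebra.adjoin_induction with
  | mem x hx =>
    rcases hx with hx | hx
    · refine norm_sub_lt_of_lt ?_ hx.2.1
      rw [norm_pow]; exact pow_lt_one₀ (norm_nonneg _) hx.2.1 hq
    · rw [pow_card_of_mem_mu hx, sub_self, norm_zero]; exact zero_lt_one
  | algebraMap r =>
    rw [← map_pow, ← map_sub, norm_algebraMap_padicInt]
    exact norm_padicInt_pow_sub_lt_one r
  | add x y hx' hy' hx hy =>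
    have hx1 := norm_le_one_of_mem_Omu hs hx'
    have hy1 := norm_le_one_of_mem_Omu hs hy'
    obtain ⟨r, hr⟩ := exists_add_pow_prime_pow_eq hp.out (⟨x, hx1⟩ : unitBall p) ⟨y, hy1⟩ s
    have hr' := congrArg (fun u : unitBall p => (u : ℂ_[p])) hr
    simp only [Subring.coe_add, Subring.coe_mul, Subring.coe_pow, Subring.coe_natCast] at hr'
    have h1 : (x + y) ^ p ^ s - (x + y) = (x ^ p ^ s - x) + (y ^ p ^ s - y) + p * x * y * r := by
      rw [hr']; ring
    rw [h1]
    refine norm_add_lt_of_lt (norm_add_lt_of_lt hx hy) ?_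
    rw [norm_mul, norm_mul, norm_mul]
    refine lt_of_le_of_lt (mul_le_of_le_one_right (by positivity) r.2) ?_
    refine lt_of_le_of_lt (mul_le_of_le_one_right (by positivity) hy1) ?_
    exact lt_of_le_of_lt (mul_le_of_le_one_right (by positivity) hx1) (norm_prime_lt_one p)
  | mul x y hx' hy' hx hy =>
    have hx1 := norm_le_one_of_mem_Omu hs hx'
    have hy1 := norm_le_one_of_mem_Omu hs hy'
    have h1 : (x * y) ^ p ^ s - x * y = x ^ p ^ s * (y ^ p ^ s - y) + y * (x ^ p ^ s - x) := by ring
    rw [h1]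
    refine norm_add_lt_of_lt ?_ ?_
    · rw [norm_mul, norm_pow]
      exact lt_of_le_of_lt (mul_le_of_le_one_left (norm_nonneg _)
        (pow_le_one₀ (norm_nonneg _) hx1)) hy
    · rw [norm_mul]; exact lt_of_le_of_lt (mul_le_of_le_one_left (norm_nonneg _) hy1) hx

/-- Every element of `𝓞[μ_{q-1}]` is congruent to zero or to a `(q-1)`-st root of unity modulo
elements of norm less than `1`. -/
theorem exists_pow_eq_self_norm_sub_lt_one (hs : s ≠ 0) {x : ℂ_[p]} (hx : x ∈ Omu p F s) :
    ∃ τ : ℂ_[p], τ ^ p ^ s = τ ∧ ‖x - τ‖ < 1 := by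
  have hq : 1 < p ^ s := Nat.one_lt_pow hs hp.out.one_lt
  set f : Polynomial ℂ_[p] := Polynomial.X ^ p ^ s - Polynomial.X with hf
  have hdeg : (Polynomial.X : Polynomial ℂ_[p]).degree < (p ^ s : ℕ) := by
    rw [Polynomial.degree_X]; exact_mod_cast hq
  have hmonic : f.Monic := Polynomial.monic_X_pow_sub hdeg
  have h1 := (IsAlgClosed.splits f).eval_eq_prod_roots_of_monic hmonic x
  have h2 := norm_pow_sub_lt_one_of_mem_Omu hs hx
  have h3 : f.eval x = x ^ p ^ s - x := by simp [hf]
  rw [← h3, h1] at h2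
  by_contra hcon
  push Not at hcon
  refine absurd h2 (not_lt.2 ?_)
  have h4 : ∀ τ ∈ f.roots, 1 ≤ ‖x - τ‖ := fun τ hτ => by
    refine hcon τ ?_
    have := Polynomial.isRoot_of_mem_roots hτ
    rw [Polynomial.IsRoot.def, hf, Polynomial.eval_sub, Polynomial.eval_pow,
      Polynomial.eval_X, sub_eq_zero] at this
    exact this
  generalize f.roots = m at h4
  induction m using Multiset.induction_on with
  | empty => simp
  | cons a m ih =>
    rw [Multiset.map_cons, Multiset.prod_cons, norm_mul]
    exact one_le_mul_of_one_le_of_one_le (h4 a (Multiset.mem_cons_self _ _))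
      (ih fun τ hτ => h4 τ (Multiset.mem_cons_of_mem hτ))

variable {k : Type*} [Field k] [CharP k p]

theorem map_eq_of_norm_sub_lt_one (hs : s ≠ 0) (f : Zmu p s →+* k) {x y : Zmu p s}
    (h : ‖(x : ℂ_[p]) - y‖ < 1) : f x = f y := by
  rw [← sub_eq_zero, ← map_sub]
  have h1 : IsAlgebraic ℚ_[p] ((x - y : Zmu p s) : ℂ_[p]) :=
    isAlgebraic_of_mem_Omu (F := 0) hs (Zmu_le_Omu p 0 s (x - y).2)
  have h2 : ‖((x - y : Zmu p s) : ℂ_[p])‖ < 1 := by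
    rw [AddSubgroupClass.coe_sub]; exact h
  exact map_eq_zero_of_norm_lt_one f h1 h2

/-- Reduction is unique, and its kernel consists of the elements of norm less than `1`. -/
theorem exists_reduction (hs : s ≠ 0) (red₀ : Zmu p s →+* k) :
    ∃ red : Omu p F s →+* k,
      (∀ x, red (Subalgebra.inclusion (Zmu_le_Omu p F s) x) = red₀ x) ∧
      (∀ red' : Omu p F s →+* k,
        (∀ x, red' (Subalgebra.inclusion (Zmu_le_Omu p F s) x) = red₀ x) → red' = red) ∧
      ∀ x : Omu p F s, red x = 0 ↔ ‖(x : ℂ_[p])‖ < 1 := by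
  have hex : ∀ x : Omu p F s, ∃ τ : Zmu p s, τ ^ p ^ s = τ ∧ ‖(x : ℂ_[p]) - τ‖ < 1 := fun x => by
    obtain ⟨τ, h1, h2⟩ := exists_pow_eq_self_norm_sub_lt_one hs x.2
    exact ⟨⟨τ, mem_Zmu_of_pow_eq h1⟩, Subtype.ext h1, h2⟩
  choose τ hτ hτx using hex
  have hτ1 : ∀ x, ‖(τ x : ℂ_[p])‖ ≤ 1 := fun x =>
    norm_le_one_of_mem_Omu hs (Zmu_le_Omu p F s (τ x).2)
  have key : ∀ (x : Omu p F s) (y : Zmu p s), ‖(x : ℂ_[p]) - y‖ < 1 → red₀ (τ x) = red₀ y :=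
    fun x y h => map_eq_of_norm_sub_lt_one hs red₀ (by
      have := norm_sub_lt_of_lt h (hτx x)
      rwa [sub_sub_sub_cancel_left] at this)
  have hone : red₀ (τ 1) = 1 := by
    rw [key 1 1 (by simp), map_one]
  have hzero : red₀ (τ 0) = 0 := by
    rw [key 0 0 (by simp), map_zero]
  have hmul : ∀ x y, red₀ (τ (x * y)) = red₀ (τ x) * red₀ (τ y) := fun x y => by
    rw [← map_mul]
    refine key _ _ ?_
    have h : ((x * y : Omu p F s) : ℂ_[p]) - ((τ x * τ y : Zmu p s) : ℂ_[p]) =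
        x * (y - τ y) + τ y * (x - τ x) := by
      rw [MulMemClass.coe_mul, MulMemClass.coe_mul]; ring
    rw [h]
    refine norm_add_lt_of_lt ?_ ?_
    · rw [norm_mul]
      exact (mul_le_of_le_one_left (norm_nonneg _) (norm_le_one_of_mem_Omu hs x.2)).trans_lt
        (hτx y)
    · rw [norm_mul]
      exact (mul_le_of_le_one_left (norm_nonneg _) (hτ1 y)).trans_lt (hτx x)
  have hadd : ∀ x y, red₀ (τ (x + y)) = red₀ (τ x) + red₀ (τ y) := fun x y => by
    rw [← map_add]
    refine key _ _ ?_
    have h : ((x + y : Omu p F s) : ℂ_[p]) - ((τ x + τ y : Zmu p s) : ℂ_[p]) =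
        (x - τ x) + (y - τ y) := by
      rw [AddMemClass.coe_add, AddMemClass.coe_add]; ring
    rw [h]
    exact norm_add_lt_of_lt (hτx x) (hτx y)
  have hext : ∀ x, red₀ (τ (Subalgebra.inclusion (Zmu_le_Omu p F s) x)) = red₀ x := fun x => by
    refine key _ _ ?_
    rw [Subalgebra.coe_inclusion, sub_self, norm_zero]
    exact zero_lt_one
  refine ⟨⟨⟨⟨fun x => red₀ (τ x), hone⟩, hmul⟩, hzero, hadd⟩, hext,
    fun red' hred' => RingHom.ext fun x => ?_, fun x => ⟨fun h => ?_, fun h => ?_⟩⟩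
  · have h0 : ‖((x - Subalgebra.inclusion (Zmu_le_Omu p F s) (τ x) : Omu p F s) : ℂ_[p])‖ < 1 := by
      rw [AddSubgroupClass.coe_sub, Subalgebra.coe_inclusion]
      exact hτx x
    have h1 := map_eq_zero_of_norm_lt_one red' (isAlgebraic_of_mem_Omu hs (Subtype.prop _)) h0
    rw [map_sub, hred', sub_eq_zero] at h1
    exact h1
  · have h1 : red₀ (τ x) = 0 := h
    have h2 : τ x = 0 := by
      by_contra h0
      have h3 : τ x ^ (p ^ s - 1) = 1 := by
        refine mul_left_cancel₀ h0 ?_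
        rw [← pow_succ', Nat.sub_add_cancel (Nat.pow_pos hp.out.pos : 1 ≤ p ^ s), hτ, mul_one]
      have h4 := congrArg red₀ h3
      rw [map_pow, h1, map_one, zero_pow] at h4
      · exact zero_ne_one h4
      · exact (Nat.sub_pos_of_lt (Nat.one_lt_pow hs hp.out.one_lt)).ne'
    have := hτx x
    rwa [h2, ZeroMemClass.coe_zero, sub_zero] at this
  · have h1 : red₀ (τ x) = red₀ 0 := by
      refine key x 0 ?_
      rwa [ZeroMemClass.coe_zero, sub_zero]
    rw [map_zero] at h1
    exact h1

/-- Teichmüller representatives: every element of `𝔽_q` is the reduction of zero or of a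
`(q-1)`-st root of unity. -/
theorem exists_lift_pow_eq_self [Fintype k] (hk : Fintype.card k = p ^ s) (hs : s ≠ 0)
    (red₀ : Zmu p s →+* k) (c : k) : ∃ τ : Zmu p s, τ ^ p ^ s = τ ∧ red₀ τ = c := by
  rcases eq_or_ne c 0 with rfl | hc
  · exact ⟨0, zero_pow (pow_ne_zero s hp.out.ne_zero), map_zero _⟩
  have hN : 0 < p ^ s - 1 := Nat.sub_pos_of_lt (Nat.one_lt_pow hs hp.out.one_lt)
  have hN1 : p ^ s - 1 + 1 = p ^ s := Nat.sub_add_cancel (Nat.pow_pos hp.out.pos)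
  have : NeZero (p ^ s - 1) := ⟨hN.ne'⟩
  obtain ⟨ζ, hζ⟩ := HasEnoughRootsOfUnity.exists_primitiveRoot ℂ_[p] (p ^ s - 1)
  have hζq : ζ ^ p ^ s = ζ := pow_card_of_mem_mu hζ.pow_eq_one
  set z : Zmu p s := ⟨ζ, mem_Zmu_of_pow_eq hζq⟩ with hz
  have hzprim : IsPrimitiveRoot z (p ^ s - 1) :=
    IsPrimitiveRoot.of_map_of_injective (f := (Zmu p s).subtype) hζ Subtype.val_injective
  have hprim : IsPrimitiveRoot (red₀ z) (p ^ s - 1) := by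
    refine ⟨by rw [← map_pow, hzprim.pow_eq_one, map_one], fun l hl => ?_⟩
    refine hzprim.dvd_of_pow_eq_one l ?_
    by_contra hne
    have h1 := mul_geom_sum (z ^ l) (p ^ s - 1)
    rw [← pow_mul, mul_comm l, pow_mul, hzprim.pow_eq_one, one_pow, sub_self] at h1
    have h2 := congrArg red₀ ((mul_eq_zero.1 h1).resolve_left (sub_ne_zero.2 hne))
    rw [map_sum, map_zero] at h2
    simp only [map_pow, hl, one_pow, Finset.sum_const, Finset.card_range, nsmul_eq_mul,
      mul_one] at h2
    have h3 : ((p ^ s : ℕ) : k) = 0 := by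
      rw [Nat.cast_pow, CharP.cast_eq_zero, zero_pow hs]
    rw [← hN1, Nat.cast_succ, h2, zero_add] at h3
    exact one_ne_zero h3
  have hc1 : c ^ (p ^ s - 1) = 1 := by rw [← hk]; exact FiniteField.pow_card_sub_one_eq_one c hc
  obtain ⟨i, -, hi⟩ := hprim.eq_pow_of_pow_eq_one hc1
  refine ⟨z ^ i, ?_, by rw [map_pow, hi]⟩
  rw [← pow_mul, mul_comm, pow_mul, show z ^ p ^ s = z from Subtype.ext hζq]

end Reduction

/-! ### The action of the absolute Frobenius -/

section FrobeniusFixed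

variable {p : ℕ} [hp : Fact p.Prime]

theorem norm_natCast_pow_sub_one {s : ℕ} (hs : s ≠ 0) : ‖((p ^ s - 1 : ℕ) : ℂ_[p])‖ = 1 := by
  rw [Nat.cast_sub (Nat.pow_pos hp.out.pos : 1 ≤ p ^ s), Nat.cast_one, Nat.cast_pow]
  have h1 : ‖(p : ℂ_[p]) ^ s‖ < 1 := by
    rw [norm_pow]; exact pow_lt_one₀ (norm_nonneg _) (norm_prime_lt_one p) hs
  rw [sub_eq_add_neg, IsUltrametricDist.norm_add_eq_max_of_norm_ne_norm
    (by rw [norm_neg, norm_one]; exact h1.ne), norm_neg, norm_one, max_eq_right h1.le]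

/-- Distinct `(q-1)`-st roots of unity are not congruent. -/
theorem eq_of_mem_mu_of_norm_sub_lt_one {s : ℕ} (hs : s ≠ 0) {x y : ℂ_[p]} (hx : x ∈ mu p s)
    (hy : y ∈ mu p s) (h : ‖x - y‖ < 1) : x = y := by
  have hx1 : x ^ (p ^ s - 1) = 1 := hx
  have hy1 : y ^ (p ^ s - 1) = 1 := hy
  have hN : p ^ s - 1 ≠ 0 := (Nat.sub_pos_of_lt (Nat.one_lt_pow hs hp.out.one_lt)).ne'
  have hy0 : y ≠ 0 := by
    rintro rfl
    rw [zero_pow hN] at hy1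
    exact zero_ne_one hy1
  have hny : ‖y‖ = 1 := by
    refine (pow_eq_one_iff_of_nonneg (norm_nonneg _) hN).1 ?_
    rw [← norm_pow, hy1, norm_one]
  -- If `u = x / y ≠ 1`, then `∑ u ^ i = 0`, whereas this sum is congruent to the unit `q - 1`.
  set u := x / y with hu
  have hu1 : u ^ (p ^ s - 1) = 1 := by rw [hu, div_pow, hx1, hy1, div_one]
  have hulue : ‖u - 1‖ < 1 := by
    rwa [hu, div_sub_one hy0, norm_div, hny, div_one]
  have hnu : ‖u‖ ≤ 1 := by
    have := norm_add_le_of_le hulue.le (norm_one (α := ℂ_[p])).le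
    rwa [sub_add_cancel] at this
  by_contra hne
  have hune : u - 1 ≠ 0 := fun h0 => hne ((div_eq_one_iff_eq hy0).1 (sub_eq_zero.1 h0))
  have h1 := mul_geom_sum u (p ^ s - 1)
  rw [hu1, sub_self] at h1
  have h2 := (mul_eq_zero.1 h1).resolve_left hune
  have h3 : ((p ^ s - 1 : ℕ) : ℂ_[p]) = - ∑ i ∈ Finset.range (p ^ s - 1), (u ^ i - 1) := by
    rw [Finset.sum_sub_distrib, h2]; simp
  have h4 : ‖∑ i ∈ Finset.range (p ^ s - 1), (u ^ i - 1)‖ ≤ ‖u - 1‖ := by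
    refine norm_sum_le_of_le (norm_nonneg _) fun i _ => ?_
    rw [← mul_geom_sum, norm_mul]
    refine mul_le_of_le_one_right (norm_nonneg _) (norm_sum_le_of_le zero_le_one fun j _ => ?_)
    rw [norm_pow]; exact pow_le_one₀ (norm_nonneg _) hnu
  rw [← norm_neg, ← h3, norm_natCast_pow_sub_one hs] at h4
  exact absurd hulue (not_lt.2 h4)

variable {F : ℤ_[p]⟦X⟧} {φ : ℂ_[p] ≃+* ℂ_[p]} {s : ℕ}

theorem IsAbsoluteFrobenius.apply_of_mem_mu (hφ : IsAbsoluteFrobenius p F φ) (hs : s ≠ 0)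
    {z : ℂ_[p]} (hz : z ∈ mu p s) : φ z = z ^ p := by
  have hz1 : z ^ (p ^ s - 1) = 1 := hz
  refine eq_of_mem_mu_of_norm_sub_lt_one hs ?_ ?_
    (hφ.norm_sub_pow_lt_one z (norm_le_one_of_pow_eq hs (pow_card_of_mem_mu hz)))
  · change φ z ^ (p ^ s - 1) = 1
    rw [← map_pow, hz1, map_one]
  · change (z ^ p) ^ (p ^ s - 1) = 1
    rw [← pow_mul, mul_comm, pow_mul, hz1, one_pow]

theorem IsAbsoluteFrobenius.iterate_apply_of_mem_Omu (hφ : IsAbsoluteFrobenius p F φ) (hs : s ≠ 0)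
    {x : ℂ_[p]} (hx : x ∈ Omu p F s) : φ^[s] x = x := by
  have hfix : ∀ {x : ℂ_[p]}, x ∈ lubinTateField p F → φ^[s] x = x := fun {x} hx =>
    Function.iterate_fixed (hφ.fixes x hx) s
  induction hx using Algebra.adjoin_induction with
  | mem x hx =>
    rcases hx with hx | hx
    · exact hfix (IntermediateField.subset_adjoin _ _ hx)
    · have h : ∀ i, φ^[i] x = x ^ p ^ i := fun i => by
        induction i with
        | zero => simp
        | succ i ih =>
          rw [Function.iterate_succ_apply', ih, map_pow, hφ.apply_of_mem_mu hs hx, ← pow_mul,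
            pow_succ']
      rw [h, pow_card_of_mem_mu hx]
  | algebraMap r =>
    refine hfix ?_
    rw [IsScalarTower.algebraMap_apply ℤ_[p] ℚ_[p] ℂ_[p]]
    exact (lubinTateField p F).algebraMap_mem _
  | add x y _ _ hx hy => rw [iterate_map_add, hx, hy]
  | mul x y _ _ hx hy => rw [iterate_map_mul, hx, hy]

theorem iterate_map_eq_of_coeff_mem_Omu (hφ : IsAbsoluteFrobenius p F φ) (hs : s ≠ 0)
    {a : WittVector p ℂ_[p]} (ha : ∀ i, a.coeff i ∈ Omu p F s) :
    (WittVector.map (φ : ℂ_[p] →+* ℂ_[p]))^[s] a = a := by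
  have h : ∀ n i, ((WittVector.map (φ : ℂ_[p] →+* ℂ_[p]))^[n] a).coeff i = φ^[n] (a.coeff i) :=
    fun n i => by
      induction n with
      | zero => rfl
      | succ n ih =>
        rw [Function.iterate_succ_apply', WittVector.map_coeff, ih, Function.iterate_succ_apply']
        rfl
  ext i
  rw [h, hφ.iterate_apply_of_mem_Omu hs (ha i)]

end FrobeniusFixed

/-! ### Telescoping of the generalized Pulita exponential -/

section Telescoping

variable {p : ℕ} [hp : Fact p.Prime]

theorem comp_X_pow (f : ℂ_[p]⟦X⟧) (n : ℕ) (hn : n ≠ 0) :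
    comp p f (PowerSeries.X ^ n) = PowerSeries.expand n hn f := by
  rw [comp, PowerSeries.expand_apply]

theorem theta_mul_eq (π : ℕ → ℂ_[p]) (φ : ℂ_[p] ≃+* ℂ_[p]) (m : ℕ) (a : WittVector p ℂ_[p]) :
    theta p π φ m a * PowerSeries.expand p hp.out.ne_zero
      (artinHasseE p (varpi p π m * WittVector.map (φ : ℂ_[p] →+* ℂ_[p]) a)) =
      artinHasseE p (varpi p π m * a) := by
  rw [theta, comp_X_pow _ p hp.out.ne_zero, mul_assoc, PowerSeries.inv_mul_cancel, mul_one]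
  rw [constantCoeff_expand, constantCoeff_artinHasseE]
  exact one_ne_zero

/-- The product that defines `θ_{m,s}(a)` telescopes if `a^{φ^s} = a`. -/
theorem thetaGen_eq (π : ℕ → ℂ_[p]) (φ : ℂ_[p] ≃+* ℂ_[p]) (m s : ℕ) {a : WittVector p ℂ_[p]}
    (ha : (WittVector.map (φ : ℂ_[p] →+* ℂ_[p]))^[s] a = a) :
    thetaGen p π φ m s a = artinHasseE p (verschiebungDiff s (varpi p π m * a)) := by
  have hp0 : ∀ i, p ^ i ≠ 0 := fun i => pow_ne_zero i hp.out.ne_zero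
  have key : ∀ n, (∏ i ∈ Finset.range n,
      comp p (theta p π φ m ((WittVector.map (φ : ℂ_[p] →+* ℂ_[p]))^[i] a))
        (PowerSeries.X ^ (p ^ i))) * PowerSeries.expand (p ^ n) (hp0 n)
          (artinHasseE p (varpi p π m * (WittVector.map (φ : ℂ_[p] →+* ℂ_[p]))^[n] a)) =
      artinHasseE p (varpi p π m * a) := fun n => by
    induction n with
    | zero => simp
    | succ n ih =>
      have h : ∀ f : ℂ_[p]⟦X⟧, PowerSeries.expand (p ^ (n + 1)) (hp0 (n + 1)) f =
          PowerSeries.expand (p ^ n) (hp0 n) (PowerSeries.expand p hp.out.ne_zero f) := fun f => by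
        simp only [pow_succ, PowerSeries.expand_mul _ (hp0 n) p hp.out.ne_zero]
      rw [Finset.prod_range_succ, comp_X_pow _ _ (hp0 n), mul_assoc, Function.iterate_succ_apply',
        ← ih, ← theta_mul_eq π φ m ((WittVector.map (φ : ℂ_[p] →+* ℂ_[p]))^[n] a), map_mul, h]
  have h1 := key s
  rw [ha] at h1
  have h2 : artinHasseE p (verschiebungDiff s (varpi p π m * a)) *
      PowerSeries.expand (p ^ s) (hp0 s) (artinHasseE p (varpi p π m * a)) =
      artinHasseE p (varpi p π m * a) := by
    rw [← artinHasseE_verschiebung_iterate, ← artinHasseE_add, verschiebungDiff, sub_add_cancel]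
  refine mul_right_cancel₀ (fun h => ?_) (h1.trans h2.symm)
  have h3 := congrArg constantCoeff h
  rw [constantCoeff_expand, constantCoeff_artinHasseE, map_zero] at h3
  exact one_ne_zero h3

end Telescoping

/-! ### The induced character -/

section InducedCharacter

variable {p : ℕ} [hp : Fact p.Prime] {F : ℤ_[p]⟦X⟧} {π : ℕ → ℂ_[p]}

theorem varpi_mul_truncWitt (π : ℕ → ℂ_[p]) (m : ℕ) (a : WittVector p ℂ_[p]) :
    varpi p π m * truncWitt (m + 1) a = varpi p π m * a :=
  ext_ghostComponent fun n => by
    rw [map_mul, map_mul, ghostComponent_varpi]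
    split_ifs with h
    · rw [ghostComponent_truncWitt (by omega)]
    · rw [zero_mul, zero_mul]

/-- The generalized Pulita exponential of a Witt vector whose first `m + 1` components have norm
less than `1` has the value `1` at each `t` with `t ^ (p ^ s) = t`. -/
theorem evalAt_artinHasseE_eq_one (hF : IsLubinTate p F) (hπ : IsTateGenerator p F π) {m s : ℕ}
    {a : WittVector p ℂ_[p]} (ha : ∀ i ≤ m, ‖a.coeff i‖ < 1) {t : ℂ_[p]} (ht : t ^ p ^ s = t)
    (ht1 : ‖t‖ ≤ 1) :
    ConvergesAt (artinHasseE p (verschiebungDiff s (varpi p π m * a))) t ∧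
      evalAt (artinHasseE p (verschiebungDiff s (varpi p π m * a))) t = 1 := by
  obtain ⟨r, hr0, hr1, hπr, har⟩ :
      ∃ r : ℝ, 0 ≤ r ∧ r < 1 ∧ ‖π m‖ ≤ r ∧ ∀ i < m + 1, ‖a.coeff i‖ ≤ r := by
    have hne : (Finset.range (m + 1)).Nonempty := ⟨0, by simp⟩
    refine ⟨max ‖π m‖ ((Finset.range (m + 1)).sup' hne fun i => ‖a.coeff i‖),
      (norm_nonneg _).trans (le_max_left _ _), max_lt (hπ.norm_lt_one m) ?_, le_max_left _ _,
      fun i hi => le_max_of_le_right ?_⟩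
    · rw [Finset.sup'_lt_iff]
      exact fun i hi => ha i (Nat.lt_succ_iff.1 (Finset.mem_range.1 hi))
    · exact Finset.le_sup' (fun i => ‖a.coeff i‖) (Finset.mem_range.2 hi)
  rw [← varpi_mul_truncWitt]
  set b := truncWitt (m + 1) a with hb
  have hble : WittLE r b := wittLE_truncWitt hr0 har
  have hw : WittLE r (varpi p π m) := (wittLE_varpi hF hπ m).mono hπr
  set x := varpi p π m * b with hx
  have hx1 : ConvergesAt (artinHasseE p x) t := (isNull_artinHasseE_mul hr1 hw hble).convergesAt ht1
  have hnx : IsNull (artinHasseE p (-x)) := by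
    rw [hx, ← mul_neg]
    exact isNull_artinHasseE_mul hr1 hw (hble.neg hr0 hr1.le)
  have hq : p ^ s ≠ 0 := pow_ne_zero s hp.out.ne_zero
  have hsplit : artinHasseE p (verschiebungDiff s x) =
      artinHasseE p x * PowerSeries.expand (p ^ s) hq (artinHasseE p (-x)) := by
    rw [← artinHasseE_verschiebung_iterate, ← artinHasseE_add, verschiebungDiff, sub_eq_add_neg,
      iterate_map_neg (WittVector.verschiebung (p := p) (R := ℂ_[p]))]
  have hx2 : ConvergesAt (PowerSeries.expand (p ^ s) hq (artinHasseE p (-x))) t :=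
    (hnx.expand _ _).convergesAt ht1
  rw [hsplit]
  refine ⟨hx1.mul hx2, ?_⟩
  rw [evalAt_mul hx1 hx2, evalAt_expand, ht, ← evalAt_mul hx1 (hnx.convergesAt ht1),
    ← artinHasseE_add, add_neg_cancel, artinHasseE_zero, evalAt_one]

/-- A function that turns sums into products and is trivial on the kernel of a surjective ring
homomorphism induces an additive character of the target. -/
theorem exists_addChar_of_surjective {A B M : Type*} [CommRing A] [CommRing B] [Field M]
    {ρ : A →+* B} (hρ : Function.Surjective ρ) {f : A → M} (hadd : ∀ x y, f (x + y) = f x * f y)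
    (hker : ∀ x, ρ x = 0 → f x = 1) : ∃ ψ : AddChar B Mˣ, ∀ x, ((ψ (ρ x) : Mˣ) : M) = f x := by
  have h0 : f 0 = 1 := hker 0 (map_zero ρ)
  have hinv : ∀ x, f x * f (-x) = 1 := fun x => by rw [← hadd, add_neg_cancel, h0]
  have hinv' : ∀ x, f (-x) * f x = 1 := fun x => by rw [mul_comm, hinv]
  have hwd : ∀ {x y}, ρ x = ρ y → f x = f y := fun {x y} h => by
    have h1 := hker (x - y) (by rw [map_sub, h, sub_self])
    rw [← sub_add_cancel x y, hadd, h1, one_mul]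
  choose g hg using hρ
  refine ⟨⟨fun y => ⟨f (g y), f (-g y), hinv _, hinv' _⟩, Units.ext ?_, fun x y => Units.ext ?_⟩,
    fun x => hwd (hg _)⟩
  · exact hker _ (hg 0)
  · change f (g (x + y)) = f (g x) * f (g y)
    rw [← hadd]
    exact hwd (by rw [hg, map_add, hg, hg])

variable {φ : ℂ_[p] ≃+* ℂ_[p]} {s : ℕ} {k : Type*} [Field k] {red : Omu p F s →+* k}

theorem thetaGen_map_subtype (hφ : IsAbsoluteFrobenius p F φ) (hs : s ≠ 0) (m : ℕ)
    (a : WittVector p (Omu p F s)) :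
    thetaGen p π φ m s (WittVector.map (Omu p F s).subtype a) =
      artinHasseE p (verschiebungDiff s (varpi p π m * WittVector.map (Omu p F s).subtype a)) :=
  thetaGen_eq π φ m s (iterate_map_eq_of_coeff_mem_Omu hφ hs fun i => by
    rw [WittVector.map_coeff]; exact Subtype.prop _)

/-- Convergence of the generalized Pulita exponentials at `t`: modulo a vector whose components have
norm less than `1`, every vector over `𝓞[μ_{q-1}]` has Teichmüller components. -/
theorem convergesAt_artinHasseE_map_subtype (hF : IsLubinTate p F) (hπ : IsTateGenerator p F π)
    (hs : s ≠ 0) (hker : ∀ x : Omu p F s, red x = 0 ↔ ‖(x : ℂ_[p])‖ < 1)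
    (hlift : ∀ c, ∃ τ : Omu p F s, τ ^ p ^ s = τ ∧ red τ = c) (m : ℕ)
    {t : ℂ_[p]} (ht : t ^ p ^ s = t) (a : WittVector p (Omu p F s)) :
    ConvergesAt (artinHasseE p
      (verschiebungDiff s (varpi p π m * WittVector.map (Omu p F s).subtype a))) t := by
  have ht1 := norm_le_one_of_pow_eq hs ht
  choose τ hτ hτred using hlift
  set b : WittVector p (Omu p F s) := WittVector.mk p fun i => τ (red (a.coeff i)) with hb
  have h1 : WittVector.map red (a - b) = 0 := by
    rw [map_sub, sub_eq_zero]
    ext i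
    rw [WittVector.map_coeff, WittVector.map_coeff, hb, WittVector.coeff_mk, hτred]
  have h2 : ∀ i ≤ m, ‖(WittVector.map (Omu p F s).subtype (a - b)).coeff i‖ < 1 := fun i _ => by
    have := congrArg (fun w => WittVector.coeff w i) h1
    simp only [WittVector.map_coeff, WittVector.zero_coeff] at this
    rw [WittVector.map_coeff]
    exact (hker _).1 this
  have h3 : ∀ i, (WittVector.map (Omu p F s).subtype b).coeff i ^ p ^ s =
      (WittVector.map (Omu p F s).subtype b).coeff i := fun i => by
    rw [WittVector.map_coeff, hb, WittVector.coeff_mk, ← map_pow, hτ]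
  have h4 : WittVector.map (Omu p F s).subtype a = WittVector.map (Omu p F s).subtype b +
      WittVector.map (Omu p F s).subtype (a - b) := by rw [← map_add, add_sub_cancel]
  rw [h4, mul_add, verschiebungDiff_add, artinHasseE_add]
  exact ((isNull_artinHasseE_verschiebungDiff_mul hF hπ hs m h3).convergesAt ht1).mul
    (evalAt_artinHasseE_eq_one hF hπ h2 ht ht1).1

theorem truncate_map_surjective (ℓ : ℕ)
    (hlift : ∀ c, ∃ τ : Omu p F s, τ ^ p ^ s = τ ∧ red τ = c) :
    Function.Surjective ((WittVector.truncate (p := p) ℓ).comp (WittVector.map red)) := by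
  rw [RingHom.coe_comp]
  refine (WittVector.truncate_surjective p ℓ k).comp (WittVector.map_surjective red fun c => ?_)
  obtain ⟨τ, -, hτ⟩ := hlift c
  exact ⟨τ, hτ⟩

/-- The value `θ(a)(t)` depends only on the first `ℓ` components of the reduction of `a`, by
`evalAt_artinHasseE_eq_one`, and is multiplicative in `a`, hence defines a character. -/
theorem exists_isInducedCharacter (hF : IsLubinTate p F) (hπ : IsTateGenerator p F π)
    (hφ : IsAbsoluteFrobenius p F φ) (hs : s ≠ 0)
    (hker : ∀ x : Omu p F s, red x = 0 ↔ ‖(x : ℂ_[p])‖ < 1)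
    (hlift : ∀ c, ∃ τ : Omu p F s, τ ^ p ^ s = τ ∧ red τ = c) {ℓ : ℕ} (hℓ : 1 ≤ ℓ)
    {t : ℂ_[p]} (ht : t ^ p ^ s = t) :
    ∃ ψ : AddChar (TruncatedWittVector p ℓ k) ℂ_[p]ˣ, IsInducedCharacter p F π φ ℓ s t red ψ := by
  have hconv := convergesAt_artinHasseE_map_subtype hF hπ hs hker hlift (ℓ - 1) ht
  obtain ⟨ψ, hψ⟩ := exists_addChar_of_surjective (truncate_map_surjective ℓ hlift)
    (f := fun a => evalAt (artinHasseE p (verschiebungDiff s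
      (varpi p π (ℓ - 1) * WittVector.map (Omu p F s).subtype a))) t)
    (fun x y => by
      rw [map_add, mul_add, verschiebungDiff_add, artinHasseE_add,
        evalAt_mul (hconv x) (hconv y)])
    (fun x hx => by
      refine (evalAt_artinHasseE_eq_one hF hπ (fun i hi => ?_) ht
        (norm_le_one_of_pow_eq hs ht)).2
      have h1 := (WittVector.mem_ker_truncate ℓ (WittVector.map red x)).1 hx i (by omega)
      rw [WittVector.map_coeff] at h1 ⊢
      exact (hker _).1 h1)
  refine ⟨ψ, fun a => ?_⟩
  have h1 := hψ a
  rw [RingHom.comp_apply] at h1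
  rw [h1, thetaGen_map_subtype hφ hs]
  exact (hconv a).hasSum

theorem IsInducedCharacter.unique {ℓ : ℕ} {t : ℂ_[p]}
    (hlift : ∀ c, ∃ τ : Omu p F s, τ ^ p ^ s = τ ∧ red τ = c)
    {ψ ψ' : AddChar (TruncatedWittVector p ℓ k) ℂ_[p]ˣ}
    (hψ : IsInducedCharacter p F π φ ℓ s t red ψ)
    (hψ' : IsInducedCharacter p F π φ ℓ s t red ψ') : ψ' = ψ := by
  ext y
  obtain ⟨a, rfl⟩ := truncate_map_surjective ℓ hlift y
  exact (hψ' a).unique (hψ a)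

end InducedCharacter

/-! ### Nontriviality of the induced character -/

section NontrivialCharacter

variable {p : ℕ} [hp : Fact p.Prime]

theorem map_iterate_verschiebung {R S : Type*} [CommRing R] [CommRing S] (f : R →+* S) (m : ℕ)
    (x : WittVector p R) : WittVector.map f (WittVector.verschiebung^[m] x) =
      WittVector.verschiebung^[m] (WittVector.map f x) := by
  induction m with
  | zero => rfl
  | succ m ih =>
    rw [Function.iterate_succ_apply', Function.iterate_succ_apply', WittVector.map_verschiebung, ih]

variable {k : Type*} [Field k] [Fintype k]

/-- The trace of a finite field over its prime field does not vanish. -/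
theorem exists_sum_pow_ne_zero {s : ℕ} (hs : s ≠ 0) (hk : Fintype.card k = p ^ s) :
    ∃ c : k, ∑ i ∈ Finset.range s, c ^ p ^ i ≠ 0 := by
  by_contra h
  push Not at h
  set f : Polynomial k := ∑ i ∈ Finset.range s, Polynomial.X ^ p ^ i with hf
  have hdeg : f.natDegree < Fintype.card k := by
    refine lt_of_le_of_lt (Polynomial.natDegree_sum_le_of_forall_le (n := p ^ (s - 1)) _ _
      fun i hi => ?_) ?_
    · rw [Polynomial.natDegree_X_pow]
      have := Finset.mem_range.1 hi
      exact Nat.pow_le_pow_right hp.out.pos (by omega)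
    · rw [hk]
      exact Nat.pow_lt_pow_right hp.out.one_lt (by omega)
  have h0 : f = 0 := by
    refine Polynomial.eq_zero_of_natDegree_lt_card_of_eval_eq_zero f Function.injective_id
      (fun c => ?_) hdeg
    rw [hf, Polynomial.eval_finsetSum]
    simpa using h c
  have h1 : f.coeff 1 = 1 := by
    rw [hf, Polynomial.finsetSum_coeff, Finset.sum_eq_single 0]
    · simp
    · intro i _ hi
      rw [Polynomial.coeff_X_pow, if_neg (Nat.one_lt_pow hi hp.out.one_lt).ne]
    · exact fun h => absurd (Finset.mem_range.2 (Nat.pos_of_ne_zero hs)) h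
  rw [h0, Polynomial.coeff_zero] at h1
  exact zero_ne_one h1

variable {F : ℤ_[p]⟦X⟧} {π : ℕ → ℂ_[p]} {φ : ℂ_[p] ≃+* ℂ_[p]} {s : ℕ} {red : Omu p F s →+* k}

/-- For `t ≠ 0` the induced character is nontrivial on `V ^ (ℓ - 1) W_ℓ(𝔽_q)`. -/
theorem IsInducedCharacter.exists_ne_one (hF : IsLubinTate p F) (hπ : IsTateGenerator p F π)
    (hφ : IsAbsoluteFrobenius p F φ) (hs : s ≠ 0) (hk : Fintype.card k = p ^ s)
    (hker : ∀ x : Omu p F s, red x = 0 ↔ ‖(x : ℂ_[p])‖ < 1)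
    (hlift : ∀ c, ∃ τ : Omu p F s, τ ^ p ^ s = τ ∧ red τ = c) {ℓ : ℕ}
    {t : ℂ_[p]} (ht : t ^ p ^ s = t) (ht0 : t ≠ 0)
    {ψ : AddChar (TruncatedWittVector p ℓ k) ℂ_[p]ˣ}
    (hψ : IsInducedCharacter p F π φ ℓ s t red ψ) :
    ∃ c : k, ψ (WittVector.truncate ℓ
      (WittVector.verschiebung^[ℓ - 1] (WittVector.teichmuller p c))) ≠ 1 := by
  obtain ⟨c, hc⟩ := exists_sum_pow_ne_zero hs hk
  obtain ⟨τ, hτ, hτc⟩ := hlift c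
  set m := ℓ - 1 with hm
  have hτ' : (τ : ℂ_[p]) ^ p ^ s = τ := by
    rw [← SubmonoidClass.coe_pow, hτ]
  set ζ : ℂ_[p] := τ * (t ^ p ^ m)⁻¹ with hζ
  have hζt : ζ * t ^ p ^ m = τ := by
    rw [hζ, mul_assoc, inv_mul_cancel₀ (pow_ne_zero _ ht0), mul_one]
  have hζq : ζ ^ p ^ s = ζ := by
    rw [hζ, mul_pow, hτ', inv_pow, ← pow_mul, mul_comm (p ^ m), pow_mul, ht]
  have hζ1 := norm_le_one_of_pow_eq hs hζq
  have ht1 := norm_le_one_of_pow_eq hs ht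
  set z : Omu p F s := ⟨ζ, Zmu_le_Omu p F s (mem_Zmu_of_pow_eq hζq)⟩ with hz
  have hsum : ‖∑ i ∈ Finset.range s, (ζ * t ^ p ^ m) ^ p ^ i‖ = 1 := by
    have h1 : ((∑ i ∈ Finset.range s, τ ^ p ^ i : Omu p F s) : ℂ_[p]) =
        ∑ i ∈ Finset.range s, (τ : ℂ_[p]) ^ p ^ i := by
      rw [AddSubmonoidClass.coe_finsetSum]
      exact Finset.sum_congr rfl fun i _ => SubmonoidClass.coe_pow _ _
    rw [hζt, ← h1]
    refine le_antisymm (norm_le_one_of_mem_Omu hs (Subtype.prop _)) (not_lt.1 fun h2 => hc ?_)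
    have h3 := (hker _).2 h2
    rw [map_sum] at h3
    simpa only [map_pow, hτc] using h3
  have hne := evalAt_artinHasseE_verschiebungDiff_top_ne_one hF hπ m hζq hζ1 ht1 hsum
  set a : WittVector p (Omu p F s) :=
    WittVector.verschiebung^[m] (WittVector.teichmuller p z) with ha
  refine ⟨red z, fun h => hne ?_⟩
  have h1 := hψ a
  rw [thetaGen_map_subtype hφ hs] at h1
  have h2 : WittVector.map red a =
      WittVector.verschiebung^[m] (WittVector.teichmuller p (red z)) := by
    rw [ha, map_iterate_verschiebung, WittVector.map_teichmuller]
  have h3 : WittVector.map (Omu p F s).subtype a =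
      WittVector.verschiebung^[m] (WittVector.teichmuller p ζ) := by
    rw [ha, map_iterate_verschiebung, WittVector.map_teichmuller]; rfl
  rw [h2, h, h3, Units.val_one] at h1
  exact h1.tsum_eq

end NontrivialCharacter

/-! ### Characters of truncated Witt vectors -/

section Duality

variable {p : ℕ} [hp : Fact p.Prime] {k : Type*} [Field k] [CharP k p]

/-- The ideal `V ^ (ℓ - 1) W_ℓ(k)` is contained in every nonzero ideal of `W_ℓ(k)`. -/
theorem exists_mul_eq_truncate_verschiebung [PerfectRing k p] {ℓ : ℕ}
    {a : TruncatedWittVector p ℓ k} (ha : a ≠ 0) (c : k) :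
    ∃ y, a * y = WittVector.truncate ℓ
      (WittVector.verschiebung^[ℓ - 1] (WittVector.teichmuller p c)) := by
  classical
  obtain ⟨x, rfl⟩ := WittVector.truncate_surjective p ℓ k a
  have hex : ∃ i, i < ℓ ∧ x.coeff i ≠ 0 := by
    by_contra h
    push Not at h
    exact ha ((WittVector.mem_ker_truncate ℓ x).2 h)
  set i := Nat.find hex with hi
  obtain ⟨hiℓ, hxi⟩ := Nat.find_spec hex
  have hlow : ∀ j < i, x.coeff j = 0 := fun j hj => by
    by_contra h0
    exact Nat.find_min hex hj ⟨hj.trans hiℓ, h0⟩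
  have hx := WittVector.eq_iterate_verschiebung hlow
  set x' := x.shift i with hx'
  have hx0 : x'.coeff 0 ≠ 0 := by rwa [hx', WittVector.shift_coeff, add_zero]
  obtain ⟨j, hj⟩ : ∃ j, i + j = ℓ - 1 := ⟨ℓ - 1 - i, by omega⟩
  obtain ⟨d, hd⟩ := (iterateFrobeniusEquiv k p i).surjective (c / x'.coeff 0 ^ p ^ j)
  rw [iterateFrobeniusEquiv_apply, iterateFrobenius_def] at hd
  refine ⟨WittVector.truncate ℓ (WittVector.verschiebung^[j] (WittVector.teichmuller p d)), ?_⟩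
  have hprod : x * WittVector.verschiebung^[j] (WittVector.teichmuller p d) =
      WittVector.verschiebung^[ℓ - 1] (WittVector.frobenius^[j] x' *
        WittVector.frobenius^[i] (WittVector.teichmuller p d)) := by
    conv_lhs => rw [hx]
    rw [WittVector.iterate_verschiebung_mul, hj]
  rw [← map_mul, hprod]
  ext n
  rw [WittVector.coeff_truncate, WittVector.coeff_truncate]
  rcases Nat.lt_or_ge (n : ℕ) (ℓ - 1) with hn | hn
  · rw [WittVector.iterate_verschiebung_coeff_eq_zero _ hn,
      WittVector.iterate_verschiebung_coeff_eq_zero _ hn]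
  · have hn' : (n : ℕ) = 0 + (ℓ - 1) := by have := n.2; omega
    rw [hn', WittVector.iterate_verschiebung_coeff, WittVector.iterate_verschiebung_coeff,
      WittVector.mul_coeff_zero, WittVector.iterate_frobenius_coeff,
      WittVector.iterate_frobenius_coeff, WittVector.teichmuller_coeff_zero,
      WittVector.teichmuller_coeff_zero, hd, mul_div_cancel₀ _ (pow_ne_zero _ hx0)]

theorem prime_pow_eq_zero (ℓ : ℕ) : (p : TruncatedWittVector p ℓ k) ^ ℓ = 0 := by
  have h1 : ((p : WittVector p k) ^ ℓ) ∈ RingHom.ker (WittVector.truncate (p := p) ℓ) := by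
    rw [WittVector.mem_ker_truncate]
    intro i hi
    exact WittVector.coeff_p_pow_eq_zero p k hi.ne
  rw [RingHom.mem_ker, map_pow, map_natCast] at h1
  exact h1

theorem prime_pow_pred_ne_zero {ℓ : ℕ} (hℓ : 1 ≤ ℓ) :
    (p : TruncatedWittVector p ℓ k) ^ (ℓ - 1) ≠ 0 := by
  intro h
  have h1 : ((p : WittVector p k) ^ (ℓ - 1)) ∈ RingHom.ker (WittVector.truncate (p := p) ℓ) := by
    rw [RingHom.mem_ker, map_pow, map_natCast, h]
  rw [WittVector.mem_ker_truncate] at h1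
  have h2 := h1 (ℓ - 1) (by omega)
  rw [WittVector.coeff_p_pow] at h2
  exact one_ne_zero h2

variable {M : Type*} [Field M]

theorem card_addChar [IsAlgClosed M] [CharZero M] (B : Type*) [AddCommGroup B] [Finite B] :
    Nat.card (AddChar B Mˣ) = Nat.card B := by
  have : NeZero (Monoid.exponent (Multiplicative B)) := ⟨Monoid.exponent_ne_zero_of_finite⟩
  rw [Nat.card_congr AddChar.toMonoidHomEquiv,
    CommGroup.card_monoidHom_of_hasEnoughRootsOfUnity (Multiplicative B) M]
  rfl

/-- A character `ψ` of a finite commutative ring that is nontrivial on each nonzero principal ideal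
is generating: every character is `y ↦ ψ (a y)` for a unique `a`. -/
theorem existsUnique_eq_mulShift [IsAlgClosed M] [CharZero M] {B : Type*} [CommRing B]
    [Finite B] {ψ : AddChar B Mˣ}
    (hψ : ∀ a : B, a ≠ 0 → ∃ y, ψ (a * y) ≠ 1) (χ : AddChar B Mˣ) :
    ∃! a : B, ∀ y, χ y = ψ (a * y) := by
  have hinj : Function.Injective fun a : B => ψ.mulShift a := fun a b hab => by
    by_contra hne
    obtain ⟨y, hy⟩ := hψ (a - b) (sub_ne_zero.2 hne)
    refine hy ?_
    have h1 : ψ (a * y) = ψ (b * y) := DFunLike.congr_fun hab y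
    rw [sub_mul, sub_eq_add_neg, AddChar.map_add_eq_mul, AddChar.map_neg_eq_inv, h1,
      mul_inv_cancel]
  have hfin : Finite (AddChar B Mˣ) := by
    refine Nat.finite_of_card_ne_zero ?_
    rw [card_addChar]
    exact Nat.card_pos.ne'
  have hbij := (Nat.bijective_iff_injective_and_card _).2 ⟨hinj, (card_addChar (M := M) B).symm⟩
  obtain ⟨a, ha, huniq⟩ := hbij.existsUnique χ
  refine ⟨a, fun y => ?_, fun b hb => huniq b (AddChar.ext _ _ fun y => ?_)⟩
  · rw [← ha]; rfl
  · rw [hb]; rfl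

theorem range_eq_rootsOfUnity {ℓ : ℕ} (hℓ : 1 ≤ ℓ) {ψ : AddChar (TruncatedWittVector p ℓ k) Mˣ}
    (hψ : ∀ a : TruncatedWittVector p ℓ k, a ≠ 0 → ∃ y, ψ (a * y) ≠ 1) :
    Set.range ψ = (rootsOfUnity (p ^ ℓ) M : Set Mˣ) := by
  have hpow : ∀ n y, ψ y ^ p ^ n = ψ ((p : TruncatedWittVector p ℓ k) ^ n * y) := fun n y => by
    rw [← AddChar.map_nsmul_eq_pow, nsmul_eq_mul, Nat.cast_pow]
  have h1 : ∀ y, ψ y ^ p ^ ℓ = 1 := fun y => by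
    rw [hpow, prime_pow_eq_zero, zero_mul, AddChar.map_zero_eq_one]
  obtain ⟨y, hy⟩ := hψ _ (prime_pow_pred_ne_zero hℓ)
  rw [← hpow] at hy
  have hord : orderOf (ψ y) = p ^ ℓ := by
    have h2 : ℓ - 1 + 1 = ℓ := by omega
    have := orderOf_eq_prime_pow (n := ℓ - 1) hy (by rw [h2]; exact h1 y)
    rwa [h2] at this
  have : NeZero (p ^ ℓ) := ⟨pow_ne_zero _ hp.out.ne_zero⟩
  have hprim : IsPrimitiveRoot (ψ y) (p ^ ℓ) := hord ▸ IsPrimitiveRoot.orderOf _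
  ext u
  constructor
  · rintro ⟨x, rfl⟩
    exact (mem_rootsOfUnity _ _).2 (h1 x)
  · intro hu
    rw [SetLike.mem_coe, ← hprim.zpowers_eq] at hu
    obtain ⟨n, rfl⟩ := hu
    exact ⟨n • y, AddChar.map_zsmul_eq_zpow ψ n y⟩

end Duality

end PulitaCharacter

theorem proposition2p4 (p : ℕ) [Fact p.Prime]
    (F : PowerSeries ℤ_[p]) (hF : PulitaCharacter.IsLubinTate p F)
    (π : ℕ → ℂ_[p]) (hπ : PulitaCharacter.IsTateGenerator p F π)
    (φ : ℂ_[p] ≃+* ℂ_[p]) (hφ : PulitaCharacter.IsAbsoluteFrobenius p F φ)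
    (s ℓ : ℕ) (hs : 1 ≤ s) (hℓ : 1 ≤ ℓ)
    {k : Type*} [Field k] [Fintype k] (hk : Fintype.card k = p ^ s)
    (red₀ : PulitaCharacter.Zmu p s →+* k)
    (t : PulitaCharacter.Zmu p s) (ht : t ^ p ^ s = t) :
    ∃ red : PulitaCharacter.Omu p F s →+* k,
      (∀ x, red (Subalgebra.inclusion (PulitaCharacter.Zmu_le_Omu p F s) x) = red₀ x) ∧
      (∀ red' : PulitaCharacter.Omu p F s →+* k,
        (∀ x, red' (Subalgebra.inclusion (PulitaCharacter.Zmu_le_Omu p F s) x) = red₀ x) →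
          red' = red) ∧
      ∃ ψ : AddChar (TruncatedWittVector p ℓ k) ℂ_[p]ˣ,
        PulitaCharacter.IsInducedCharacter p F π φ ℓ s t red ψ ∧
        (∀ ψ' : AddChar (TruncatedWittVector p ℓ k) ℂ_[p]ˣ,
          PulitaCharacter.IsInducedCharacter p F π φ ℓ s t red ψ' → ψ' = ψ) ∧
        ((¬ ∃ z : ℤ_[p], PulitaCharacter.trace p s t = (p : ℚ_[p]) * (z : ℚ_[p])) →
          (∀ χ : AddChar (TruncatedWittVector p ℓ k) ℂ_[p]ˣ,
            ∃! a : TruncatedWittVector p ℓ k, ∀ y, χ y = ψ (a * y)) ∧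
          Set.range ψ = (rootsOfUnity (p ^ ℓ) ℂ_[p] : Set ℂ_[p]ˣ)) := by
  have hs0 : s ≠ 0 := by omega
  have hp : p.Prime := Fact.out
  have hchar : CharP k p := charP_of_card_eq_prime_pow hk
  have ht' : (t : ℂ_[p]) ^ p ^ s = t := by
    rw [← SubmonoidClass.coe_pow, ht]
  obtain ⟨red, hext, huniq, hker⟩ := PulitaCharacter.exists_reduction (F := F) hs0 red₀
  have hlift : ∀ c, ∃ τ : PulitaCharacter.Omu p F s, τ ^ p ^ s = τ ∧ red τ = c := fun c => by
    obtain ⟨τ, h1, h2⟩ := PulitaCharacter.exists_lift_pow_eq_self hk hs0 red₀ c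
    exact ⟨Subalgebra.inclusion (PulitaCharacter.Zmu_le_Omu p F s) τ, by rw [← map_pow, h1],
      by rw [hext, h2]⟩
  obtain ⟨ψ, hψ⟩ := PulitaCharacter.exists_isInducedCharacter hF hπ hφ hs0 hker hlift hℓ ht'
  refine ⟨red, hext, huniq, ψ, hψ, fun ψ' hψ' => hψ.unique hlift hψ', fun htr => ?_⟩
  -- The trace hypothesis only enters through `t ≠ 0`.
  have ht0 : (t : ℂ_[p]) ≠ 0 := by
    intro h0
    refine htr ⟨0, ?_⟩
    have h1 : (⟨(t : ℂ_[p]), PulitaCharacter.Zmu_subset_Qmu p s t.2⟩ : PulitaCharacter.Qmu p s) =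
        0 := Subtype.ext h0
    rw [PulitaCharacter.trace, h1, map_zero, PadicInt.coe_zero, mul_zero]
  obtain ⟨c, hc⟩ := hψ.exists_ne_one hF hπ hφ hs0 hk hker hlift ht' ht0
  have hperf : PerfectRing k p := PerfectRing.ofFiniteOfIsReduced p k
  have hne : ∀ a : TruncatedWittVector p ℓ k, a ≠ 0 → ∃ y, ψ (a * y) ≠ 1 := fun a ha => by
    obtain ⟨y, hy⟩ := PulitaCharacter.exists_mul_eq_truncate_verschiebung ha c
    exact ⟨y, by rwa [hy]⟩
  exact ⟨PulitaCharacter.existsUnique_eq_mulShift hne,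
    PulitaCharacter.range_eq_rootsOfUnity hℓ hne⟩
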